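/- Let $k$ be a field and $r\ge 1$ an integer. Let $B=k\langle x,y\rangle/(y^{r+1})$, graded by $\deg x=\deg y=1$. Let $Q$ be the quiver with vertices $1,\dots,r+1$, with an arrow $x_i:i\to 1$ for each $1\le i\le r+1$ and an arrow $y_i:i\to i+1$ for each $1\le i\le r$. Let $kQ$ be its path algebra, graded by path length, where the product $pq$ of two paths is the path "$p$, then $q$" if $p$ ends where $q$ starts, and $0$ otherwise. For a $\mathbb Z$-graded $k$-algebra $A$ let $\mathsf{Gr}\,A$ be the category of $\mathbb Z$-graded left $A$-modules with degree-preserving homomorphisms, $\mathsf{Fdim}\,A$ its full subcategory of modules that are unions of their finite dimensional submodules, and $\mathsf{gr}\,A$ and $\mathsf{fdim}\,A$ the full subcategories of finitely presented and of finite dimensional modules. For $A=B$ and $A=kQ$ put $\mathsf{QGr}\,A=\mathsf{Gr}\,A/\mathsf{Fdim}\,A$ and $\mathsf{qgr}\,A=\mathsf{gr}\,A/\mathsf{fdim}\,A$. The inclusion of $\mathsf{gr}\,A$ in $\mathsf{Gr}\,A$ induces the canonical functor $\iota_A:\mathsf{qgr}\,A\to\mathsf{QGr}\,A$. Let $\mathcal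 O$ be the image of $A$ in $\mathsf{QGr}\,A$. For $n\in\mathbb Z$ let $\mathcal F\mapsto\mathcal F(n)$ be the functor on $\mathsf{QGr}\,A$ induced by the degree shift $M(n)_i=M_{n+i}$. Then there is an injective homomorphism of graded $k$-algebras $f:B\to kQ$ with $f(x)=x_1+\cdots+x_{r+1}$ and $f(y)=y_1+\cdots+y_r$, and the functor $kQ\otimes_B-:\mathsf{Gr}\,B\to\mathsf{Gr}\,kQ$ induces an equivalence of categories $$F:\mathsf{QGr}\,B\;\xrightarrow{\ \equiv\ }\;\mathsf{QGr}\,kQ .$$ Furthermore: 1. $F$ restricts to an equivalence between $\mathsf{qgr}\,B$ and $\mathsf{qgr}\,kQ$, that is, there is an equivalence $F':\mathsf{qgr}\,B\to\mathsf{qgr}\,kQ$ with $\iota_{kQ}\circ F'\cong F\circ\iota_B$. 2. For every $n\in\mathbb Z$ there is an isomorphism $F(\mathcal F(n))\cong F(\mathcal F)(n)$, natural in $\mathcal F\in\mathsf{QGr}\,B$. 3. $F(\mathcal O)\cong\mathcal O$. -/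

import Mathlib

open CategoryTheory
open scoped DirectSum TensorProduct

universe u

noncomputable section

/-! ### Graded left modules over a `ℤ`-graded algebra -/

/-- A `ℤ`-graded left module over the `ℤ`-graded `k`-algebra `(A, 𝒜)`: a left `A`-module `M`
which is the internal direct sum of `k`-subspaces `M_i`, `i ∈ ℤ`, with `A_i M_j ⊆ M_{i+j}`.
The `k`-module structure is the one obtained through `k → A`. -/
structure GrMod {k A : Type u} [Field k] [Ring A] [Algebra k A] (𝒜 : ℤ → Submodule k A) :
    Type (u + 1) where
  carrier : Type u
  [addCommGroup : AddCommGroup carrier]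
  [moduleBase : Module k carrier]
  [module : Module A carrier]
  [isScalarTower : IsScalarTower k A carrier]
  deg : ℤ → Submodule k carrier
  smul_mem : ∀ {i j : ℤ} {a : A} {m : carrier}, a ∈ 𝒜 i → m ∈ deg j → a • m ∈ deg (i + j)
  isInternal : DirectSum.IsInternal deg

namespace GrMod

attribute [instance] GrMod.addCommGroup GrMod.moduleBase GrMod.module GrMod.isScalarTower

section

variable {k A : Type u} [Field k] [Ring A] [Algebra k A] {𝒜 : ℤ → Submodule k A}

/-- A morphism of graded modules: an `A`-linear map that preserves degree. -/
@[ext]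
structure Hom (M N : GrMod 𝒜) where
  toLin : M.carrier →ₗ[A] N.carrier
  map_deg : ∀ {i : ℤ} {m : M.carrier}, m ∈ M.deg i → toLin m ∈ N.deg i

/-- The category `Gr A` of graded left `A`-modules. -/
instance : Category (GrMod 𝒜) where
  Hom M N := Hom M N
  id M := ⟨LinearMap.id, fun h => h⟩
  comp f g := ⟨g.toLin.comp f.toLin, fun h => g.map_deg (f.map_deg h)⟩

/-- The degree shift `M ↦ M(n)`, where `M(n)_i = M_{n+i}`, as a functor `Gr A ⥤ Gr A`. -/
def shift (𝒜 : ℤ → Submodule k A) (n : ℤ) : GrMod 𝒜 ⥤ GrMod 𝒜 where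
  obj M :=
    { carrier := M.carrier
      deg := fun i => M.deg (n + i)
      smul_mem := by
        intro i j a m ha hm
        have h := M.smul_mem ha hm
        rwa [add_left_comm] at h
      isInternal := by
        have h := M.isInternal
        rw [DirectSum.isInternal_submodule_iff_iSupIndep_and_iSup_eq_top] at h ⊢
        refine ⟨h.1.comp (add_right_injective n), ?_⟩
        rw [← h.2]
        exact (Equiv.addLeft n).iSup_comp (g := M.deg) }
  map f := ⟨f.toLin, fun h => f.map_deg h⟩

/-- `A` as a graded left module over itself. -/
def self (𝒜 : ℤ → Submodule k A) [GradedAlgebra 𝒜] : GrMod 𝒜 where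
  carrier := A
  deg := 𝒜
  smul_mem ha hm := SetLike.mul_mem_graded ha hm
  isInternal := DirectSum.Decomposition.isInternal 𝒜

end

end GrMod

/-! ### Quotient categories -/

section Quotients

/-- An `A`-module belongs to `Fdim A` if it is the union of its finite dimensional submodules. -/
def IsFdim (k A M : Type u) [Field k] [Ring A] [Algebra k A] [AddCommGroup M] [Module k M]
    [Module A M] [IsScalarTower k A M] : Prop :=
  ∀ m : M, ∃ N : Submodule A M, m ∈ N ∧ Module.Finite k N

variable {k A : Type u} [Field k] [Ring A] [Algebra k A]

/-- The morphisms of `Gr A` whose kernel and cokernel belong to `Fdim A`. -/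
def fdimIso (𝒜 : ℤ → Submodule k A) : MorphismProperty (GrMod 𝒜) := fun _ N φ =>
  IsFdim k A (LinearMap.ker (GrMod.Hom.toLin φ)) ∧
    IsFdim k A (N.carrier ⧸ LinearMap.range (GrMod.Hom.toLin φ))

/-- `QGr A = Gr A / Fdim A`: the quotient by a Serre subcategory is the localization at the
morphisms with kernel and cokernel in that subcategory. -/
abbrev QGr (𝒜 : ℤ → Submodule k A) := (fdimIso 𝒜).Localization

/-- The quotient functor `Gr A ⥤ QGr A`. -/
abbrev toQGr (𝒜 : ℤ → Submodule k A) : GrMod 𝒜 ⥤ QGr 𝒜 := (fdimIso 𝒜).Q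

/-- The structure sheaf: the image in `QGr A` of `A` as a graded left module. -/
def structureSheaf (𝒜 : ℤ → Submodule k A) [GradedAlgebra 𝒜] : QGr 𝒜 :=
  (toQGr 𝒜).obj (GrMod.self 𝒜)

/-- The Serre twist `ℱ ↦ ℱ(n)`: the functor `QGr A ⥤ QGr A` induced by the degree shift. -/
def serreTwist (𝒜 : ℤ → Submodule k A) (n : ℤ) : QGr 𝒜 ⥤ QGr 𝒜 :=
  Localization.Construction.lift (GrMod.shift 𝒜 n ⋙ toQGr 𝒜) (fun _ _ φ hφ =>
    (fdimIso 𝒜).Q_inverts ((GrMod.shift 𝒜 n).map φ) hφ)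

/-- `gr A`, the full subcategory of `Gr A` of finitely presented modules. -/
abbrev FpGrMod (𝒜 : ℤ → Submodule k A) :=
  ObjectProperty.FullSubcategory (fun M : GrMod 𝒜 => Module.FinitePresentation A M.carrier)

/-- The morphisms of `gr A` whose kernel and cokernel are finite dimensional. -/
def finDimIso (𝒜 : ℤ → Submodule k A) : MorphismProperty (FpGrMod 𝒜) := fun _ N φ =>
  Module.Finite k (LinearMap.ker (GrMod.Hom.toLin φ.hom)) ∧
    Module.Finite k (N.obj.carrier ⧸ LinearMap.range (GrMod.Hom.toLin φ.hom))

/-- `qgr A = gr A / fdim A`. -/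
abbrev Qgr (𝒜 : ℤ → Submodule k A) := (finDimIso 𝒜).Localization

theorem IsFdim.of_finite (M : Type u) [AddCommGroup M] [Module k M]
    [Module A M] [IsScalarTower k A M] (h : Module.Finite k M) : IsFdim k A M :=
  fun _ => ⟨⊤, trivial, Module.Finite.equiv
    ((Submodule.topEquiv (R := A) (M := M)).restrictScalars k).symm⟩

/-- The canonical functor `qgr A ⥤ QGr A` induced by the inclusion of `gr A` in `Gr A`. -/
def qgrToQGr (𝒜 : ℤ → Submodule k A) : Qgr 𝒜 ⥤ QGr 𝒜 :=
  Localization.Construction.lift (ObjectProperty.ι _ ⋙ toQGr 𝒜) (fun _ _ φ hφ =>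
    (fdimIso 𝒜).Q_inverts φ.hom ⟨.of_finite _ hφ.1, .of_finite _ hφ.2⟩)

end Quotients

/-! ### The functor `D ⊗_B -` on graded modules -/

section Induction

variable {k B D : Type u} [Field k] [Ring B] [Algebra k B] [Ring D] [Algebra k D]

/-- The `D`-submodule of `D ⊗_k M` generated by the elements `d f(b) ⊗ m - d ⊗ b m`. -/
def balanced (f : B →ₐ[k] D) (M : Type u) [AddCommGroup M] [Module k M] [Module B M] :
    Submodule D (D ⊗[k] M) :=
  Submodule.span D {z | ∃ (d : D) (b : B) (m : M), z = (d * f b) ⊗ₜ[k] m - d ⊗ₜ[k] (b • m)}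

/-- The left `D`-module `D ⊗_B M`, where `D` is a right `B`-module through `f : B → D`. -/
abbrev BaseChange (f : B →ₐ[k] D) (M : Type u) [AddCommGroup M] [Module k M] [Module B M] :
    Type u :=
  (D ⊗[k] M) ⧸ balanced f M

namespace BaseChange

section

variable (f : B →ₐ[k] D) {M : Type u} [AddCommGroup M] [Module k M] [Module B M]

/-- The element `d ⊗ m` of `D ⊗_B M`. -/
def tmul (d : D) (m : M) : BaseChange f M := Submodule.Quotient.mk (d ⊗ₜ[k] m)

/-- The pure tensor `d ⊗ m` as a `k`-bilinear function. -/
def tmulBilin (M : Type u) [AddCommGroup M] [Module k M] [Module B M] :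
    D →ₗ[k] M →ₗ[k] BaseChange f M :=
  (TensorProduct.mk k D M).compr₂ ((balanced f M).mkQ.restrictScalars k)

/-- The degree `n` part of `D ⊗_B M` is spanned by the `d ⊗ m` with `deg d + deg m = n`. -/
def grading (𝒟 : ℤ → Submodule k D) (ℳ : ℤ → Submodule k M) (n : ℤ) :
    Submodule k (BaseChange f M) :=
  Submodule.span k {z | ∃ (i j : ℤ) (d : D) (m : M),
    d ∈ 𝒟 i ∧ m ∈ ℳ j ∧ i + j = n ∧ z = tmul f d m}

theorem tmul_mem {𝒟 : ℤ → Submodule k D} {ℳ : ℤ → Submodule k M} {i j : ℤ} {d : D} {m : M}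
    (hd : d ∈ 𝒟 i) (hm : m ∈ ℳ j) : tmul f d m ∈ grading f 𝒟 ℳ (i + j) :=
  Submodule.subset_span ⟨i, j, d, m, hd, hm, rfl, rfl⟩

theorem smul_tmul (c d : D) (m : M) : c • tmul f d m = tmul f (c * d) m := rfl

theorem grading_smul_mem {𝒟 : ℤ → Submodule k D} [GradedAlgebra 𝒟] {ℳ : ℤ → Submodule k M}
    {i j : ℤ} {c : D} {z : BaseChange f M} (hc : c ∈ 𝒟 i) (hz : z ∈ grading f 𝒟 ℳ j) :
    c • z ∈ grading f 𝒟 ℳ (i + j) := by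
  induction hz using Submodule.span_induction with
  | mem z hz =>
    obtain ⟨a, b, d, m, hd, hm, rfl, rfl⟩ := hz
    rw [smul_tmul, ← add_assoc]
    exact tmul_mem f (SetLike.mul_mem_graded hc hd) hm
  | zero => rw [smul_zero]; exact Submodule.zero_mem _
  | add x y _ _ hx hy => rw [smul_add]; exact Submodule.add_mem _ hx hy
  | smul a x _ hx => rw [smul_comm]; exact Submodule.smul_mem _ a hx

end

section

variable {ℬ : ℤ → Submodule k B} {𝒟 : ℤ → Submodule k D} [GradedAlgebra ℬ] [GradedAlgebra 𝒟]
variable (f : ℬ →ₐᵍ[k] 𝒟) {M : Type u} [AddCommGroup M] [Module k M] [Module B M]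
variable {ℳ : ℤ → Submodule k M}

/-- The linear map sending `d ⊗ m`, for `d ∈ D_i` and `m ∈ M_j`, to `d ⊗ m` in degree `i + j`. -/
def preDecompose (f : ℬ →ₐᵍ[k] 𝒟) (ℳ : ℤ → Submodule k M) [DirectSum.Decomposition ℳ] :
    D ⊗[k] M →ₗ[k] ⨁ n, grading f.toAlgHom 𝒟 ℳ n :=
  TensorProduct.lift
    (LinearMap.compl₁₂ (DirectSum.toModule k ℤ _ fun i => LinearMap.flip
        (DirectSum.toModule k ℤ _ fun j => LinearMap.flip
          (LinearMap.mk₂ k (fun (d : 𝒟 i) (m : ℳ j) =>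
            DirectSum.lof k ℤ (fun n => grading f.toAlgHom 𝒟 ℳ n) (i + j)
              ⟨tmulBilin f.toAlgHom M d m, tmul_mem f.toAlgHom d.2 m.2⟩)
            (fun _ _ _ => by rw [← map_add]; congr 1; ext1; simp)
            (fun _ _ _ => by rw [← map_smul]; congr 1)
            (fun _ _ _ => by rw [← map_add]; congr 1; ext1; simp)
            (fun _ _ _ => by rw [← map_smul]; congr 1; ext1; simp))))
      (DirectSum.decomposeLinearEquiv 𝒟).toLinearMap
      (DirectSum.decomposeLinearEquiv ℳ).toLinearMap)

theorem preDecompose_tmul [DirectSum.Decomposition ℳ] {i j : ℤ} {d : D} {m : M}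
    (hd : d ∈ 𝒟 i) (hm : m ∈ ℳ j) :
    preDecompose f ℳ (d ⊗ₜ m) = DirectSum.lof k ℤ (fun n => grading f.toAlgHom 𝒟 ℳ n) (i + j)
      ⟨tmul f.toAlgHom d m, tmul_mem f.toAlgHom hd hm⟩ := by
  simp only [preDecompose, TensorProduct.lift.tmul, LinearMap.compl₁₂_apply,
    LinearEquiv.coe_coe, DirectSum.decomposeLinearEquiv_apply,
    DirectSum.decompose_of_mem _ hd, DirectSum.decompose_of_mem _ hm, ← DirectSum.lof_eq_of k,
    DirectSum.toModule_lof, LinearMap.flip_apply, LinearMap.mk₂_apply]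
  rfl

theorem lof_congr [DirectSum.Decomposition ℳ] {i j : ℤ} (h : i = j) (z : BaseChange f.toAlgHom M)
    (hi : z ∈ grading f.toAlgHom 𝒟 ℳ i) (hj : z ∈ grading f.toAlgHom 𝒟 ℳ j) :
    DirectSum.lof k ℤ (fun n => grading f.toAlgHom 𝒟 ℳ n) i ⟨z, hi⟩ =
      DirectSum.lof k ℤ (fun n => grading f.toAlgHom 𝒟 ℳ n) j ⟨z, hj⟩ := by
  subst h; rfl

theorem tmul_balance (d : D) (b : B) (m : M) :
    tmul f.toAlgHom (d * f b) m = tmul f.toAlgHom d (b • m) :=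
  (Submodule.Quotient.eq _).2 (Submodule.subset_span ⟨d, b, m, rfl⟩)

theorem preDecompose_balanced [DirectSum.Decomposition ℳ]
    (hℳ : ∀ {i j : ℤ} {b : B} {m : M}, b ∈ ℬ i → m ∈ ℳ j → b • m ∈ ℳ (i + j))
    (d : D) (b : B) (m : M) :
    preDecompose f ℳ ((d * f b) ⊗ₜ m) = preDecompose f ℳ (d ⊗ₜ (b • m)) := by
  induction d using DirectSum.Decomposition.inductionOn 𝒟 with
  | zero => simp
  | add d d' h h' => simp only [add_mul, TensorProduct.add_tmul, map_add, h, h']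
  | homogeneous d =>
  induction b using DirectSum.Decomposition.inductionOn ℬ with
  | zero => simp
  | add b b' h h' =>
    simp only [map_add, mul_add, add_smul, TensorProduct.add_tmul, TensorProduct.tmul_add, h, h']
  | homogeneous b =>
  induction m using DirectSum.Decomposition.inductionOn ℳ with
  | zero => simp
  | add m m' h h' => simp only [smul_add, TensorProduct.tmul_add, map_add, h, h']
  | homogeneous m =>
  rw [preDecompose_tmul f (SetLike.mul_mem_graded d.2 (show f b ∈ _ from f.map_mem b.2)) m.2,
    preDecompose_tmul f d.2 (hℳ b.2 m.2)]
  simp only [tmul_balance]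
  exact lof_congr f (add_assoc _ _ _) _ _ _

theorem preDecompose_eq_zero [DirectSum.Decomposition ℳ]
    (hℳ : ∀ {i j : ℤ} {b : B} {m : M}, b ∈ ℬ i → m ∈ ℳ j → b • m ∈ ℳ (i + j))
    {z : D ⊗[k] M} (hz : z ∈ balanced f.toAlgHom M) : preDecompose f ℳ z = 0 := by
  suffices h : ∀ c : D, preDecompose f ℳ (c • z) = 0 by simpa using h 1
  induction hz using Submodule.span_induction with
  | mem z hz =>
    obtain ⟨d, b, m, rfl⟩ := hz
    intro c
    rw [smul_sub, map_sub, sub_eq_zero, TensorProduct.smul_tmul', TensorProduct.smul_tmul',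
      smul_eq_mul, smul_eq_mul, ← mul_assoc]
    exact preDecompose_balanced f hℳ _ _ _
  | zero => simp
  | add x y _ _ hx hy => intro c; rw [smul_add, map_add, hx, hy, add_zero]
  | smul a x _ hx => intro c; rw [← mul_smul]; exact hx _

theorem isInternal (h : DirectSum.IsInternal ℳ)
    (hℳ : ∀ {i j : ℤ} {b : B} {m : M}, b ∈ ℬ i → m ∈ ℳ j → b • m ∈ ℳ (i + j)) :
    DirectSum.IsInternal (grading f.toAlgHom 𝒟 ℳ) := by
  have := h.chooseDecomposition
  let _ : AddCommGroup (⨁ n, grading f.toAlgHom 𝒟 ℳ n) :=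
    inferInstanceAs (AddCommGroup (DirectSum ℤ fun n => grading f.toAlgHom 𝒟 ℳ n))
  let φ : BaseChange f.toAlgHom M →ₗ[k] ⨁ n, grading f.toAlgHom 𝒟 ℳ n :=
    ((balanced f.toAlgHom M).restrictScalars k).liftQ (preDecompose f ℳ)
      (fun z hz => preDecompose_eq_zero f hℳ hz)
  have hφ : ∀ z, φ (Submodule.Quotient.mk z) = preDecompose f ℳ z := fun _ => rfl
  have hright : ∀ (n : ℤ) (z : grading f.toAlgHom 𝒟 ℳ n),
      φ z = DirectSum.lof k ℤ (fun n => grading f.toAlgHom 𝒟 ℳ n) n z := by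
    rintro n ⟨z, hz⟩
    induction hz using Submodule.span_induction with
    | mem z hz =>
      obtain ⟨i, j, d, m, hd, hm, rfl, rfl⟩ := hz
      exact preDecompose_tmul f hd hm
    | zero => simp only [map_zero]; exact (map_zero _).symm
    | add x y hx hy hx' hy' =>
      simp only [map_add, hx', hy'] at *
      rw [← map_add]; rfl
    | smul a x hx hx' =>
      simp only [map_smul, hx'] at *
      rw [← map_smul]; rfl
  have hleft : ∀ z, DirectSum.coeLinearMap (grading f.toAlgHom 𝒟 ℳ) (φ z) = z := by
    intro z
    obtain ⟨z, rfl⟩ := Submodule.Quotient.mk_surjective _ z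
    rw [hφ]
    induction z using TensorProduct.induction_on with
    | zero => rw [map_zero, map_zero]; rfl
    | add x y hx hy => rw [map_add, map_add, hx, hy]; rfl
    | tmul d m =>
    induction d using DirectSum.Decomposition.inductionOn 𝒟 with
    | zero => rw [TensorProduct.zero_tmul, map_zero, map_zero]; rfl
    | add d d' h h' => rw [TensorProduct.add_tmul, map_add, map_add, h, h']; rfl
    | homogeneous d =>
    induction m using DirectSum.Decomposition.inductionOn ℳ with
    | zero => rw [TensorProduct.tmul_zero, map_zero, map_zero]; rfl
    | add m m' h h' => rw [TensorProduct.tmul_add, map_add, map_add, h, h']; rfl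
    | homogeneous m =>
    rw [preDecompose_tmul f d.2 m.2, DirectSum.coeLinearMap_lof]; rfl
  have hright' : φ ∘ₗ DirectSum.coeLinearMap (grading f.toAlgHom 𝒟 ℳ) = LinearMap.id := by
    refine DirectSum.linearMap_ext k fun n => LinearMap.ext fun z => ?_
    simp [hright]
  exact ⟨Function.LeftInverse.injective (g := φ) (fun x => LinearMap.congr_fun hright' x),
    Function.RightInverse.surjective (g := φ) hleft⟩

end

end BaseChange

variable {ℬ : ℤ → Submodule k B} {𝒟 : ℤ → Submodule k D}

/-- The map `id ⊗ φ : D ⊗_k M → D ⊗_k N` sends relations to relations. -/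
theorem balanced_le_comap (f : B →ₐ[k] D) {M N : GrMod ℬ} (φ : M ⟶ N) :
    balanced f M.carrier ≤ (balanced f N.carrier).comap
      (TensorProduct.AlgebraTensorModule.map (LinearMap.id (R := D) (M := D))
        (φ.toLin.restrictScalars k)) := by
  rw [balanced, Submodule.span_le]
  rintro _ ⟨d, b, m, rfl⟩
  refine Submodule.subset_span ⟨d, b, φ.toLin m, ?_⟩
  simp

/-- The functor `D ⊗_B - : Gr B ⥤ Gr D` of a homomorphism `f : B → D` of graded algebras. -/
def inductionFunctor [GradedAlgebra ℬ] [GradedAlgebra 𝒟] (f : ℬ →ₐᵍ[k] 𝒟) : GrMod ℬ ⥤ GrMod 𝒟 where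
  obj M :=
    { carrier := BaseChange f.toAlgHom M.carrier
      deg := BaseChange.grading f.toAlgHom 𝒟 M.deg
      smul_mem := BaseChange.grading_smul_mem f.toAlgHom
      isInternal := BaseChange.isInternal f M.isInternal M.smul_mem }
  map {M N} φ :=
    { toLin := Submodule.mapQ _ _ (TensorProduct.AlgebraTensorModule.map LinearMap.id
        (φ.toLin.restrictScalars k)) (balanced_le_comap f.toAlgHom φ)
      map_deg := by
        intro n z hz
        induction hz using Submodule.span_induction with
        | mem z hz =>
          obtain ⟨i, j, d, m, hd, hm, rfl, rfl⟩ := hz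
          exact BaseChange.tmul_mem f.toAlgHom hd (φ.map_deg hm)
        | zero => rw [map_zero]; exact Submodule.zero_mem _
        | add x y _ _ hx hy => rw [map_add]; exact Submodule.add_mem _ hx hy
        | smul a x _ hx =>
          rw [LinearMap.map_smul_of_tower]; exact Submodule.smul_mem _ a hx }
  map_id M := by
    apply GrMod.Hom.ext
    refine Submodule.linearMap_qext _ (TensorProduct.AlgebraTensorModule.ext fun d m => rfl)
  map_comp φ ψ := by
    apply GrMod.Hom.ext
    refine Submodule.linearMap_qext _ (TensorProduct.AlgebraTensorModule.ext fun d m => rfl)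

end Induction

/-! ### The algebra `k⟨x, y⟩ / (y^{r+1})` -/

section TruncatedAlgebra

/-- The relation `y^{r+1} = 0` on the free algebra on `x` (index `0`) and `y` (index `1`). -/
def TruncRel (k : Type u) [Field k] (r : ℕ) (a b : FreeAlgebra k (Fin 2)) : Prop :=
  a = FreeAlgebra.ι k 1 ^ (r + 1) ∧ b = 0

/-- The algebra `B = k⟨x, y⟩ / (y^{r+1})`. -/
abbrev TruncAlg (k : Type u) [Field k] (r : ℕ) : Type u := RingQuot (TruncRel k r)

namespace TruncAlg

variable (k : Type u) [Field k] (r : ℕ)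

/-- The generators of `B`: `gen 0 = x` and `gen 1 = y`. -/
def gen (i : Fin 2) : TruncAlg k r := RingQuot.mkAlgHom k (TruncRel k r) (FreeAlgebra.ι k i)

/-- The generator `x` of `B`. -/
abbrev x : TruncAlg k r := gen k r 0

/-- The generator `y` of `B`. -/
abbrev y : TruncAlg k r := gen k r 1

/-- The grading of `B` with `deg x = deg y = 1`: the degree `n` part is spanned by the words of
length `n` in `x` and `y`. -/
def grading (n : ℤ) : Submodule k (TruncAlg k r) :=
  Submodule.span k {b | ∃ w : List (Fin 2), (w.length : ℤ) = n ∧ b = (w.map (gen k r)).prod}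

theorem word_mem (w : List (Fin 2)) : (w.map (gen k r)).prod ∈ grading k r w.length :=
  Submodule.subset_span ⟨w, rfl, rfl⟩

theorem gen_mem (i : Fin 2) : gen k r i ∈ grading k r 1 := by
  simpa using word_mem k r [i]

theorem y_pow : y k r ^ (r + 1) = 0 := by
  have h := RingQuot.mkAlgHom_rel k (s := TruncRel k r) ⟨rfl, rfl⟩
  rwa [map_pow, map_zero] at h

instance : SetLike.GradedMonoid (grading k r) where
  one_mem := by simpa using word_mem k r []
  mul_mem := by
    intro i j a b ha hb
    have h : grading k r i * grading k r j ≤ grading k r (i + j) := by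
      rw [grading, grading, Submodule.span_mul_span, Submodule.span_le]
      rintro _ ⟨_, ⟨v, hv, rfl⟩, _, ⟨w, hw, rfl⟩, rfl⟩
      refine Submodule.subset_span ⟨v ++ w, ?_, ?_⟩
      · simp [hv, hw]
      · simp
    exact h (Submodule.mul_mem_mul ha hb)

/-- The algebra homomorphism `B → ⨁ B_n` that splits an element into homogeneous components. -/
def toDirectSum : TruncAlg k r →ₐ[k] ⨁ n, grading k r n :=
  RingQuot.liftAlgHom k ⟨FreeAlgebra.lift k fun i =>
    DirectSum.of (fun n => grading k r n) 1 ⟨gen k r i, gen_mem k r i⟩, by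
      rintro _ _ ⟨rfl, rfl⟩
      rw [map_pow, FreeAlgebra.lift_ι_apply, map_zero, DirectSum.ofPow]
      convert map_zero (DirectSum.of (fun n => grading k r n) ((r + 1) • 1)) using 2
      exact Subtype.ext (y_pow k r)⟩

theorem toDirectSum_gen (i : Fin 2) : toDirectSum k r (gen k r i) =
    DirectSum.of (fun n => grading k r n) 1 ⟨gen k r i, gen_mem k r i⟩ := by
  simp [toDirectSum, gen]

theorem toDirectSum_word (w : List (Fin 2)) : toDirectSum k r (w.map (gen k r)).prod =
    DirectSum.of (fun n => grading k r n) w.length ⟨_, word_mem k r w⟩ := by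
  induction w with
  | nil => exact map_one _
  | cons i w ih =>
    refine (map_mul (toDirectSum k r) (gen k r i) (w.map (gen k r)).prod).trans ?_
    rw [ih, toDirectSum_gen, DirectSum.of_mul_of]
    refine DirectSum.of_eq_of_gradedMonoid_eq (Sigma.subtype_ext ?_ ?_)
    · exact (add_comm _ _).trans (Nat.cast_succ _).symm
    · rfl

instance : GradedAlgebra (grading k r) :=
  GradedAlgebra.ofAlgHom _ (toDirectSum k r)
    (by
      refine RingQuot.ringQuot_ext' k _ _ (FreeAlgebra.hom_ext (funext fun i => ?_))
      change DirectSum.coeAlgHom _ (toDirectSum k r (gen k r i)) = gen k r i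
      rw [toDirectSum_gen, DirectSum.coeAlgHom_of])
    (by
      rintro n ⟨b, hb⟩
      induction hb using Submodule.span_induction with
      | mem b hb =>
        obtain ⟨w, rfl, rfl⟩ := hb
        exact toDirectSum_word k r w
      | zero => simp only [map_zero]; exact (map_zero _).symm
      | add a b _ _ ha hb => simp only [map_add] at *; rw [ha, hb, ← map_add]; rfl
      | smul c a _ ha =>
        simp only [map_smul] at *
        rw [ha, ← DirectSum.lof_eq_of k, ← map_smul]; rfl)

end TruncAlg

end TruncatedAlgebra

/-! ### Path algebras -/

section PathAlgebras

/-- The paths of a quiver, the trivial path at each vertex included. -/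
abbrev QuiverPath (V : Type) [Quiver.{0} V] : Type := Σ (a b : V), Quiver.Path a b

/-- The path algebra of a quiver with finitely many vertices: the vector space on the set of
paths. The product `p q` of two paths is the path `p` followed by `q` if `p` ends where `q`
starts, and `0` otherwise. -/
def PathAlgebra (k : Type u) [Field k] (V : Type) [Quiver.{0} V] : Type u := QuiverPath V →₀ k

namespace PathAlgebra

variable (k : Type u) [Field k] {V : Type} [Quiver.{0} V]

instance : AddCommGroup (PathAlgebra k V) := inferInstanceAs (AddCommGroup (QuiverPath V →₀ k))

instance : Module k (PathAlgebra k V) := inferInstanceAs (Module k (QuiverPath V →₀ k))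

/-- The paths form a basis of the path algebra. -/
def pathBasis (V : Type) [Quiver.{0} V] : Module.Basis (QuiverPath V) k (PathAlgebra k V) :=
  .ofRepr (LinearEquiv.refl k (QuiverPath V →₀ k))

/-- A path as an element of the path algebra. -/
def ofPath (p : QuiverPath V) : PathAlgebra k V := pathBasis k V p

open Classical in
/-- The product of two paths. -/
def pathMul (p q : QuiverPath V) : PathAlgebra k V :=
  if h : p.2.1 = q.1 then ofPath k ⟨p.1, q.2.1, p.2.2.comp (q.2.2.cast h.symm rfl)⟩ else 0

/-- The multiplication of the path algebra: the bilinear extension of the product of paths. -/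
def mulBilin (V : Type) [Quiver.{0} V] :
    PathAlgebra k V →ₗ[k] PathAlgebra k V →ₗ[k] PathAlgebra k V :=
  (pathBasis k V).constr k fun p => (pathBasis k V).constr k fun q => pathMul k p q

instance : Mul (PathAlgebra k V) := ⟨fun a b => mulBilin k V a b⟩

instance [Fintype V] : One (PathAlgebra k V) := ⟨∑ v : V, ofPath k ⟨v, v, .nil⟩⟩

theorem mul_def (a b : PathAlgebra k V) : a * b = mulBilin k V a b := rfl

theorem one_def [Fintype V] : (1 : PathAlgebra k V) = ∑ v : V, ofPath k ⟨v, v, .nil⟩ := rfl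

theorem ofPath_mul_ofPath (p q : QuiverPath V) : ofPath k p * ofPath k q = pathMul k p q := by
  rw [mul_def, mulBilin, ofPath, ofPath, Module.Basis.constr_basis, Module.Basis.constr_basis]

theorem ofPath_mul_of_ne {a b c d : V} (p : Quiver.Path a b) (q : Quiver.Path c d) (h : b ≠ c) :
    ofPath k ⟨a, b, p⟩ * ofPath k ⟨c, d, q⟩ = 0 := by
  rw [ofPath_mul_ofPath, pathMul, dif_neg h]

theorem ofPath_mul_comp {a b c : V} (p : Quiver.Path a b) (q : Quiver.Path b c) :
    ofPath k ⟨a, b, p⟩ * ofPath k ⟨b, c, q⟩ = ofPath k ⟨a, c, p.comp q⟩ := by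
  rw [ofPath_mul_ofPath, pathMul, dif_pos rfl]
  rfl

theorem induction_on {P : PathAlgebra k V → Prop} (a : PathAlgebra k V)
    (path : ∀ p, P (ofPath k p)) (zero : P 0) (add : ∀ a b, P a → P b → P (a + b))
    (smul : ∀ (c : k) a, P a → P (c • a)) : P a := by
  have h : a ∈ Submodule.span k (Set.range (pathBasis k V)) := by
    rw [(pathBasis k V).span_eq]; trivial
  induction h using Submodule.span_induction with
  | mem a ha => obtain ⟨p, rfl⟩ := ha; exact path p
  | zero => exact zero
  | add a b _ _ ha hb => exact add a b ha hb
  | smul c a _ ha => exact smul c a ha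

instance : NonUnitalNonAssocRing (PathAlgebra k V) where
  zero_mul a := LinearMap.map_zero₂ (mulBilin k V) a
  mul_zero a := map_zero (mulBilin k V a)
  left_distrib a b c := map_add (mulBilin k V a) b c
  right_distrib a b c := LinearMap.map_add₂ (mulBilin k V) a b c

instance : IsScalarTower k (PathAlgebra k V) (PathAlgebra k V) where
  smul_assoc c a b := LinearMap.map_smul₂ (mulBilin k V) c a b

instance : SMulCommClass k (PathAlgebra k V) (PathAlgebra k V) where
  smul_comm c a b := (map_smul (mulBilin k V a) c b).symm

theorem ofPath_mul_assoc (p q s : QuiverPath V) :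
    ofPath k p * ofPath k q * ofPath k s = ofPath k p * (ofPath k q * ofPath k s) := by
  obtain ⟨a, b, p⟩ := p
  obtain ⟨b', c, q⟩ := q
  obtain ⟨c', d, s⟩ := s
  by_cases hb : b = b'
  · subst hb
    by_cases hc : c = c'
    · subst hc
      simp only [ofPath_mul_comp, Quiver.Path.comp_assoc]
    · rw [ofPath_mul_comp, ofPath_mul_of_ne k _ _ hc, ofPath_mul_of_ne k _ _ hc, mul_zero]
  · rw [ofPath_mul_of_ne k _ _ hb, zero_mul]
    by_cases hc : c = c'
    · subst hc
      rw [ofPath_mul_comp, ofPath_mul_of_ne k _ _ hb]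
    · rw [ofPath_mul_of_ne k _ _ hc, mul_zero]

protected theorem mul_assoc' (a b c : PathAlgebra k V) : a * b * c = a * (b * c) := by
  induction a using induction_on with
  | zero => simp only [zero_mul]
  | add x y hx hy => simp only [add_mul, hx, hy]
  | smul t x hx => simp only [smul_mul_assoc, hx]
  | path p =>
  induction b using induction_on with
  | zero => simp only [zero_mul, mul_zero]
  | add x y hx hy => simp only [add_mul, mul_add, hx, hy]
  | smul t x hx => simp only [smul_mul_assoc, mul_smul_comm, hx]
  | path q =>
  induction c using induction_on with
  | zero => simp only [mul_zero]
  | add x y hx hy => simp only [mul_add, hx, hy]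
  | smul t x hx => simp only [mul_smul_comm, hx]
  | path s => exact ofPath_mul_assoc k p q s

/-- The grading of the path algebra in which every arrow has degree `1`: the degree `n` part is
spanned by the paths of length `n`. -/
def grading (V : Type) [Quiver.{0} V] (n : ℤ) : Submodule k (PathAlgebra k V) :=
  Submodule.span k {a | ∃ p : QuiverPath V, (p.2.2.length : ℤ) = n ∧ a = ofPath k p}

theorem ofPath_mem (p : QuiverPath V) : ofPath k p ∈ grading k V p.2.2.length :=
  Submodule.subset_span ⟨p, rfl, rfl⟩

variable [Fintype V]

instance : Ring (PathAlgebra k V) where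
  mul_assoc := PathAlgebra.mul_assoc' k
  one_mul a := by
    induction a using induction_on with
    | zero => exact mul_zero _
    | add x y hx hy => rw [mul_add, hx, hy]
    | smul t x hx => rw [mul_smul_comm, hx]
    | path p =>
      obtain ⟨a, b, p⟩ := p
      rw [one_def, Finset.sum_mul, Finset.sum_eq_single a, ofPath_mul_comp, Quiver.Path.nil_comp]
      · exact fun v _ hv => ofPath_mul_of_ne k _ _ hv
      · exact fun h => absurd (Finset.mem_univ a) h
  mul_one a := by
    induction a using induction_on with
    | zero => exact zero_mul _
    | add x y hx hy => rw [add_mul, hx, hy]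
    | smul t x hx => rw [smul_mul_assoc, hx]
    | path p =>
      obtain ⟨a, b, p⟩ := p
      rw [one_def, Finset.mul_sum, Finset.sum_eq_single b, ofPath_mul_comp, Quiver.Path.comp_nil]
      · exact fun v _ hv => ofPath_mul_of_ne k _ _ hv.symm
      · exact fun h => absurd (Finset.mem_univ b) h

instance : Algebra k (PathAlgebra k V) := Algebra.ofModule smul_mul_assoc mul_smul_comm

instance : SetLike.GradedMonoid (grading k V) where
  one_mem := Submodule.sum_mem _ fun v _ => ofPath_mem k ⟨v, v, .nil⟩
  mul_mem := by
    intro i j a b ha hb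
    have h : grading k V i * grading k V j ≤ grading k V (i + j) := by
      rw [grading, grading, Submodule.span_mul_span, Submodule.span_le]
      rintro _ ⟨_, ⟨⟨a, b, p⟩, hp, rfl⟩, _, ⟨⟨b', c, q⟩, hq, rfl⟩, rfl⟩
      by_cases hb : b = b'
      · subst hb
        refine Submodule.subset_span ⟨⟨a, c, p.comp q⟩, ?_, ofPath_mul_comp k p q⟩
        rw [← hp, ← hq, Quiver.Path.length_comp, Nat.cast_add]
      · simp only [ofPath_mul_of_ne k _ _ hb]
        exact Submodule.zero_mem _
    exact h (Submodule.mul_mem_mul ha hb)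

instance : DirectSum.Decomposition (grading k V) :=
  .ofLinearMap _
    ((pathBasis k V).constr k fun p =>
      DirectSum.lof k ℤ (fun n => grading k V n) p.2.2.length ⟨ofPath k p, ofPath_mem k p⟩)
    (by
      refine (pathBasis k V).ext fun p => ?_
      rw [LinearMap.comp_apply, Module.Basis.constr_basis, DirectSum.coeLinearMap_lof]
      rfl)
    (by
      refine DirectSum.linearMap_ext k fun n => LinearMap.ext ?_
      rintro ⟨a, ha⟩
      simp only [LinearMap.comp_apply, DirectSum.coeLinearMap_lof, LinearMap.id_apply]
      induction ha using Submodule.span_induction with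
      | mem a ha =>
        obtain ⟨p, rfl, rfl⟩ := ha
        exact (pathBasis k V).constr_basis k _ p
      | zero => simp only [map_zero]; exact (map_zero _).symm
      | add a b _ _ ha hb => simp only [map_add] at *; rw [ha, hb, ← map_add]; rfl
      | smul c a _ ha => simp only [map_smul] at *; rw [ha, ← map_smul]; rfl)

instance : GradedAlgebra (grading k V) where

end PathAlgebra

/-! The quiver `Q` with vertices `1, …, r+1` (here `0, …, r`), an arrow `x_i : i → 1` for
`1 ≤ i ≤ r+1`, and an arrow `y_i : i → i+1` for `1 ≤ i ≤ r`. -/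

/-- The vertices of `Q`. -/
def QVertex (r : ℕ) : Type := Fin (r + 1)

instance (r : ℕ) : Fintype (QVertex r) := inferInstanceAs (Fintype (Fin (r + 1)))

/-- The `i`-th vertex of `Q`. -/
def QVertex.mk {r : ℕ} (i : Fin (r + 1)) : QVertex r := i

/-- The arrows of `Q`. -/
inductive QArrow (r : ℕ) : QVertex r → QVertex r → Type
  | x (i : Fin (r + 1)) : QArrow r (.mk i) (.mk 0)
  | y (i : Fin r) : QArrow r (.mk i.castSucc) (.mk i.succ)

instance (r : ℕ) : Quiver.{0} (QVertex r) where
  Hom := QArrow r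

/-- The path algebra `kQ`. -/
abbrev KQ (k : Type u) [Field k] (r : ℕ) : Type u := PathAlgebra k (QVertex r)

namespace KQ

variable (k : Type u) [Field k] (r : ℕ)

/-- The grading of `kQ` by path length. -/
abbrev grading : ℤ → Submodule k (KQ k r) := PathAlgebra.grading k (QVertex r)

/-- The arrow `x_i` as an element of `kQ`. -/
def xArrow (i : Fin (r + 1)) : KQ k r :=
  PathAlgebra.ofPath k ⟨.mk i, .mk 0, Quiver.Hom.toPath (QArrow.x i)⟩

/-- The arrow `y_i` as an element of `kQ`. -/
def yArrow (i : Fin r) : KQ k r :=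
  PathAlgebra.ofPath k ⟨.mk i.castSucc, .mk i.succ, Quiver.Hom.toPath (QArrow.y i)⟩

end KQ

end PathAlgebras

end

/-! Write `D = kQ`, let `e` be the trivial path at the first vertex, and let `X`, `Y` be the images
of `x`, `y` under `f`. A path is determined by its start and by the word in `x`, `y` that it spells
(`ofPath_eq`). Reading off the words of the paths that start at the first vertex gives a right
`B`-linear map `λ : D → B` (`toTrunc`) with `λ(f(b)) = b`, which restricts to an isomorphism `eD ≅
B` of right `B`-modules. In particular `f` is injective. Every `x_i` ends at the first vertex, so `X
= Xe` and `X d = f(x λ(d))` (`X_mul`). Hence the ideal `J = BxB`, the direct sum of the `y^t x B`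
with `0 ≤ t ≤ r`, is stable under right multiplication by `D`, and as a right `D`-module it is
`(eD)^{r+1}`. The quotient `B/J = k[y]/(y^{r+1})` is finite dimensional.

The inverse of `kQ ⊗_B -` is `J ⊗_D -`, that is, `N ↦ (eN)^{r+1}` (`JTensor`). The multiplication
maps `J ⊗ (D ⊗ M) → M` and `D ⊗ (J ⊗ N) → N` are natural, and their kernels and cokernels are
torsion. Indeed, a graded module over `B` or `D` is a union of finite dimensional submodules exactly
when each element is killed by all sufficiently high degrees (compare `fdimIso_iff`). A nonzero word
of length at least `n + r + 1` can be written `y^l x v`, and also `v' x y^{l'}`, with `l, l' ≤ r`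
and `v, v'` of length at least `n`. So it is enough to control multiplication by `x`, and there
`X_mul` and `x_smul_smul` apply. The same argument shows that both functors preserve morphisms with
torsion kernel and cokernel, so they descend to mutually inverse equivalences
(`localizationEquivalence`).

For `qgr` two more facts are needed. Both functors preserve finite presentation; for `J ⊗ -` this
holds because `J` is free as a left `B`-module on the `x y^j`, `0 ≤ j ≤ r` (`selfMap`). Moreover the
torsion of a finitely presented graded module is finite dimensional (`finite_of_torsion`), so that
the two classes of inverted morphisms agree (`finDimIso_iff`). This rests on `finite_socle`, which
uses a right linear map `A_{≥1} → A` taking the value `1`; deleting the first arrow of a path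
provides it. The twist and the structure sheaf are compared already in `Gr`. -/

noncomputable section

/-! ### Deleting the first or the last arrow of a path. -/

namespace PathAlgebra

variable (k : Type u) [Field k] {V : Type} [Quiver.{0} V]

/-- The linear map from the path algebra with given values on the paths. -/
def onPaths {W : Type*} [AddCommGroup W] [Module k W]
    (φ : ∀ a b : V, Quiver.Path a b → W) : PathAlgebra k V →ₗ[k] W :=
  (pathBasis k V).constr k fun p => φ p.1 p.2.1 p.2.2

@[simp]
theorem onPaths_ofPath {W : Type*} [AddCommGroup W] [Module k W]
    (φ : ∀ a b : V, Quiver.Path a b → W) {a b : V} (p : Quiver.Path a b) :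
    onPaths k φ (ofPath k ⟨a, b, p⟩) = φ a b p :=
  (pathBasis k V).constr_basis k _ _

theorem linearMap_ext {W : Type*} [AddCommGroup W] [Module k W] {φ ψ : PathAlgebra k V →ₗ[k] W}
    (h : ∀ (a b : V) (p : Quiver.Path a b), φ (ofPath k ⟨a, b, p⟩) = ψ (ofPath k ⟨a, b, p⟩)) :
    φ = ψ :=
  (pathBasis k V).ext fun p => h p.1 p.2.1 p.2.2

/-- The trivial path at `v`. -/
def idem (v : V) : PathAlgebra k V := ofPath k ⟨v, v, .nil⟩

/-- An arrow as an element of the path algebra. -/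
def ofHom {a b : V} (e : a ⟶ b) : PathAlgebra k V := ofPath k ⟨a, b, e.toPath⟩

theorem ofPath_cons {a b c : V} (p : Quiver.Path a b) (e : b ⟶ c) :
    ofPath k ⟨a, c, p.cons e⟩ = ofPath k ⟨a, b, p⟩ * ofHom k e := by
  rw [ofHom, ofPath_mul_comp]; rfl

theorem idem_mul_self {a b : V} (p : Quiver.Path a b) :
    idem k a * ofPath k ⟨a, b, p⟩ = ofPath k ⟨a, b, p⟩ := by
  rw [idem, ofPath_mul_comp, Quiver.Path.nil_comp]

theorem idem_mul_of_ne {a b c : V} (p : Quiver.Path a b) (h : c ≠ a) :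
    idem k c * ofPath k ⟨a, b, p⟩ = 0 :=
  ofPath_mul_of_ne k _ _ h

theorem mul_idem_self {a b : V} (p : Quiver.Path a b) :
    ofPath k ⟨a, b, p⟩ * idem k b = ofPath k ⟨a, b, p⟩ := by
  rw [idem, ofPath_mul_comp, Quiver.Path.comp_nil]

theorem mul_idem_of_ne {a b c : V} (p : Quiver.Path a b) (h : b ≠ c) :
    ofPath k ⟨a, b, p⟩ * idem k c = 0 :=
  ofPath_mul_of_ne k _ _ h

theorem idem_mem (v : V) : idem k v ∈ grading k V 0 := ofPath_mem k ⟨v, v, .nil⟩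

theorem ofHom_mem {a b : V} (e : a ⟶ b) : ofHom k e ∈ grading k V 1 :=
  ofPath_mem k ⟨a, b, e.toPath⟩

theorem grading_eq_bot_of_neg {n : ℤ} (hn : n < 0) : grading k V n = ⊥ := by
  rw [grading, Submodule.span_eq_bot]
  rintro _ ⟨p, hp, -⟩
  omega

variable [Fintype V]

/-- Deletes the first arrow of a path, and multiplies by the weight of that arrow. Trivial paths
are sent to `0`. -/
def stripFirstPath (c : ∀ a b : V, (a ⟶ b) → k) (a : V) :
    ∀ b : V, Quiver.Path a b → PathAlgebra k V
  | _, .nil => 0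
  | v, .cons p e =>
      (if p.length = 0 then c _ _ e • idem k v else stripFirstPath c a _ p * ofHom k e)

/-- The linear extension of `stripFirstPath`. -/
def stripFirst (c : ∀ a b : V, (a ⟶ b) → k) : PathAlgebra k V →ₗ[k] PathAlgebra k V :=
  onPaths k (stripFirstPath k c)

theorem stripFirst_ofHom (c : ∀ a b : V, (a ⟶ b) → k) {a b : V} (e : a ⟶ b) :
    stripFirst k c (ofHom k e) = c a b e • idem k b := by
  rw [stripFirst, ofHom, onPaths_ofPath, Quiver.Hom.toPath, stripFirstPath]; rfl

/-- A path of positive length keeps its first arrow when it is extended on the right. Degree `0` has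
to be excluded: a trivial path goes to `0`, but its product with an arrow need not. -/
theorem stripFirst_mul (c : ∀ a b : V, (a ⟶ b) → k) {n : ℤ} (hn : 1 ≤ n) {p : PathAlgebra k V}
    (hp : p ∈ grading k V n) (q : PathAlgebra k V) :
    stripFirst k c (p * q) = stripFirst k c p * q := by
  induction hp using Submodule.span_induction with
  | zero => simp
  | add x y _ _ hx hy => simp only [add_mul, map_add, hx, hy]
  | smul t x _ hx => simp only [smul_mul_assoc, map_smul, hx]
  | mem p hp =>
  obtain ⟨⟨a, b, p⟩, hp, rfl⟩ := hp
  have hp' : 1 ≤ p.length := by simp only at hp; omega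
  suffices h : ∀ (b' d : V) (q : Quiver.Path b' d),
      stripFirst k c (ofPath k ⟨a, b, p⟩ * ofPath k ⟨b', d, q⟩) =
        stripFirst k c (ofPath k ⟨a, b, p⟩) * ofPath k ⟨b', d, q⟩ by
    exact LinearMap.congr_fun (linearMap_ext k
      (φ := stripFirst k c ∘ₗ LinearMap.mulLeft k (ofPath k ⟨a, b, p⟩))
      (ψ := LinearMap.mulLeft k (stripFirst k c (ofPath k ⟨a, b, p⟩))) h) q
  -- What is left of `p` still ends at `b`, so both sides vanish against paths that start elsewhere.
  have hend : stripFirst k c (ofPath k ⟨a, b, p⟩) =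
      stripFirst k c (ofPath k ⟨a, b, p⟩) * idem k b := by
    rw [stripFirst, onPaths_ofPath]
    cases p with
    | nil => simp at hp'
    | cons p e =>
      rw [stripFirstPath]
      split_ifs
      · rw [smul_mul_assoc]; congr 1; exact (mul_idem_self k .nil).symm
      · rw [mul_assoc, ofHom, mul_idem_self]
  intro b' d q
  by_cases h : b = b'
  · subst h
    rw [ofPath_mul_comp]
    induction q with
    | nil => exact hend
    | cons q e ih =>
      rw [Quiver.Path.comp_cons, ofPath_cons k q, ← mul_assoc, ← ih, stripFirst, onPaths_ofPath,
        onPaths_ofPath, stripFirstPath, if_neg]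
      rw [Quiver.Path.length_comp]; omega
  · rw [ofPath_mul_of_ne k _ _ h, map_zero, hend, mul_assoc, idem_mul_of_ne k _ h, mul_zero]

/-- Deletes the last arrow of a path, and multiplies by the weight of that arrow. Trivial paths
are sent to `0`. -/
def stripLastPath (c : ∀ a b : V, (a ⟶ b) → k) (a : V) :
    ∀ b : V, Quiver.Path a b → PathAlgebra k V
  | _, .nil => 0
  | _, .cons p e => c _ _ e • ofPath k ⟨_, _, p⟩

/-- The linear extension of `stripLastPath`. -/
def stripLast (c : ∀ a b : V, (a ⟶ b) → k) : PathAlgebra k V →ₗ[k] PathAlgebra k V :=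
  onPaths k (stripLastPath k c)

theorem stripLast_cons (c : ∀ a b : V, (a ⟶ b) → k) {a b d : V} (p : Quiver.Path a b)
    (e : b ⟶ d) : stripLast k c (ofPath k ⟨a, d, p.cons e⟩) = c b d e • ofPath k ⟨a, b, p⟩ := by
  rw [stripLast, onPaths_ofPath, stripLastPath]

/-- The factor `idem k a` remembers that paths in `d` not ending at `a` were killed by the arrow. -/
theorem stripLast_mul_ofHom (c : ∀ a b : V, (a ⟶ b) → k) (d : PathAlgebra k V) {a b : V}
    (e : a ⟶ b) : stripLast k c (d * ofHom k e) = c a b e • (d * idem k a) := by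
  refine LinearMap.congr_fun (linearMap_ext k
    (φ := stripLast k c ∘ₗ LinearMap.mulRight k (ofHom k e))
    (ψ := c a b e • LinearMap.mulRight k (idem k a)) fun a' b' p => ?_) d
  simp only [LinearMap.comp_apply, LinearMap.mulRight_apply, LinearMap.smul_apply]
  by_cases h : b' = a
  · subst h
    rw [← ofPath_cons, stripLast_cons, mul_idem_self]
  · rw [ofHom, ofPath_mul_of_ne k _ _ h, mul_idem_of_ne k _ h, map_zero, smul_zero]

end PathAlgebra

/-! ### Words in `x` and `y`, and their factorizations at an occurrence of `x`. -/

namespace TruncAlg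

variable (k : Type u) [Field k] (r : ℕ)

/-- The algebra homomorphism from `k⟨x, y⟩ / (y^{r+1})` with given values at `x` and `y`. -/
def lift {A : Type*} [Semiring A] [Algebra k A] (a b : A) (h : b ^ (r + 1) = 0) :
    TruncAlg k r →ₐ[k] A :=
  RingQuot.liftAlgHom k ⟨FreeAlgebra.lift k ![a, b], by
    rintro _ _ ⟨rfl, rfl⟩
    rw [map_pow, FreeAlgebra.lift_ι_apply, map_zero]
    exact h⟩

theorem lift_x {A : Type*} [Semiring A] [Algebra k A] (a b : A) (h : b ^ (r + 1) = 0) :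
    lift k r a b h (x k r) = a := by
  simp [lift, gen]

theorem lift_y {A : Type*} [Semiring A] [Algebra k A] (a b : A) (h : b ^ (r + 1) = 0) :
    lift k r a b h (y k r) = b := by
  simp [lift, gen]

/-- The element of `k⟨x, y⟩ / (y^{r+1})` represented by a word in `x` and `y`. -/
def word (w : List (Fin 2)) : TruncAlg k r := (w.map (gen k r)).prod

@[simp] theorem word_nil : word k r [] = 1 := rfl

theorem word_cons_zero (w : List (Fin 2)) : word k r (0 :: w) = x k r * word k r w := by
  simp [word]

theorem word_cons_one (w : List (Fin 2)) : word k r (1 :: w) = y k r * word k r w := by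
  simp [word]

theorem word_append (v w : List (Fin 2)) : word k r (v ++ w) = word k r v * word k r w := by
  simp [word]

theorem word_mem_grading (w : List (Fin 2)) : word k r w ∈ grading k r w.length := word_mem k r w

theorem x_mem : x k r ∈ grading k r 1 := gen_mem k r 0

theorem y_pow_of_lt {n : ℕ} (h : r < n) : y k r ^ n = 0 :=
  pow_eq_zero_of_le h (y_pow k r)

@[elab_as_elim]
theorem grading_induction {n : ℤ} {P : TruncAlg k r → Prop}
    (word : ∀ w : List (Fin 2), (w.length : ℤ) = n → P (word k r w)) (zero : P 0)
    (add : ∀ a b, P a → P b → P (a + b)) (smul : ∀ (c : k) a, P a → P (c • a))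
    {b : TruncAlg k r} (hb : b ∈ grading k r n) : P b := by
  induction hb using Submodule.span_induction with
  | mem b hb => obtain ⟨w, hw, rfl⟩ := hb; exact word w hw
  | zero => exact zero
  | add a b _ _ ha hb => exact add a b ha hb
  | smul c a _ ha => exact smul c a ha

theorem induction {P : TruncAlg k r → Prop} (one : P 1)
    (x_mul : ∀ b, P b → P (x k r * b)) (y_mul : ∀ b, P b → P (y k r * b))
    (add : ∀ a b, P a → P b → P (a + b)) (smul : ∀ (c : k) a, P a → P (c • a))
    (b : TruncAlg k r) : P b := by
  have hz : P 0 := by simpa using smul 0 1 one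
  induction b using DirectSum.Decomposition.inductionOn (grading k r) with
  | zero => exact hz
  | add a b ha hb => exact add a b ha hb
  | homogeneous b =>
    refine grading_induction k r (fun w hw => ?_) hz add smul b.2
    clear hw
    induction w with
    | nil => exact one
    | cons i w ih =>
      fin_cases i
      · exact word_cons_zero k r w ▸ x_mul _ ih
      · exact word_cons_one k r w ▸ y_mul _ ih

/-- The word is cut at its first `x`, if it has one. -/
theorem word_eq_y_pow_or (w : List (Fin 2)) : word k r w = y k r ^ w.length ∨
    ∃ (l : ℕ) (v : List (Fin 2)), l + 1 + v.length = w.length ∧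
      word k r w = y k r ^ l * (x k r * word k r v) := by
  induction w with
  | nil => left; simp
  | cons i w ih =>
    fin_cases i
    · exact .inr ⟨0, w, by simp; omega, by rw [pow_zero, one_mul]; exact word_cons_zero k r w⟩
    · have h := word_cons_one k r w
      rcases ih with ih | ⟨l, v, hv, ih⟩
      · left
        change word k r (1 :: w) = _
        rw [h, ih, List.length_cons, pow_succ']
      · right
        refine ⟨l + 1, v, by simp; omega, ?_⟩
        change word k r (1 :: w) = _
        rw [h, ih, pow_succ', mul_assoc]

/-- The word is cut at its last `x`, if it has one. -/
theorem word_eq_y_pow_or' (w : List (Fin 2)) : word k r w = y k r ^ w.length ∨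
    ∃ (l : ℕ) (v : List (Fin 2)), l + 1 + v.length = w.length ∧
      word k r w = word k r v * (x k r * y k r ^ l) := by
  induction w with
  | nil => left; simp
  | cons i w ih =>
    fin_cases i
    · have h := word_cons_zero k r w
      right
      rcases ih with ih | ⟨l, v, hv, ih⟩
      · refine ⟨w.length, [], by simp, ?_⟩
        change word k r (0 :: w) = _
        rw [h, ih, word_nil, one_mul]
      · refine ⟨l, 0 :: v, by simp; omega, ?_⟩
        change word k r (0 :: w) = _
        rw [h, ih, word_cons_zero, mul_assoc]
    · have h := word_cons_one k r w
      rcases ih with ih | ⟨l, v, hv, ih⟩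
      · left
        change word k r (1 :: w) = _
        rw [h, ih, List.length_cons, pow_succ']
      · right
        refine ⟨l, 1 :: v, by simp; omega, ?_⟩
        change word k r (1 :: w) = _
        rw [h, ih, word_cons_one, mul_assoc]

/-- Elements of degree at least `n + r + 1` are spanned by the `y^l x v` with `l ≤ r` and `v` a
word of length at least `n`. -/
theorem grading_induction_left {n i : ℤ} (hi : n + r + 1 ≤ i) {P : TruncAlg k r → Prop}
    (word : ∀ (l : ℕ) (v : List (Fin 2)), l ≤ r → n ≤ v.length →
      P (y k r ^ l * (x k r * TruncAlg.word k r v)))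
    (zero : P 0) (add : ∀ a b, P a → P b → P (a + b)) (smul : ∀ (c : k) a, P a → P (c • a))
    (hn : 0 ≤ n) {b : TruncAlg k r} (hb : b ∈ grading k r i) : P b := by
  refine grading_induction k r (fun w hw => ?_) zero add smul hb
  rcases word_eq_y_pow_or k r w with h | ⟨l, v, hv, h⟩
  -- Since `0 ≤ n`, the length exceeds `r`, and a word without `x` is zero.
  · rw [h, y_pow_of_lt k r (by omega)]; exact zero
  -- With `l ≤ r` the factor `y^l x` uses at most `r + 1` letters, which leaves at least `n` for
  -- `v`.
  · by_cases hl : l ≤ r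
    · exact h ▸ word l v hl (by omega)
    · rw [h, y_pow_of_lt k r (by omega), zero_mul]; exact zero

/-- Elements of degree at least `n + r + 1` are spanned by the `v x y^l` with `l ≤ r` and `v` a
word of length at least `n`. -/
theorem grading_induction_right {n i : ℤ} (hi : n + r + 1 ≤ i) {P : TruncAlg k r → Prop}
    (word : ∀ (l : ℕ) (v : List (Fin 2)), l ≤ r → n ≤ v.length →
      P (TruncAlg.word k r v * (x k r * y k r ^ l)))
    (zero : P 0) (add : ∀ a b, P a → P b → P (a + b)) (smul : ∀ (c : k) a, P a → P (c • a))
    (hn : 0 ≤ n) {b : TruncAlg k r} (hb : b ∈ grading k r i) : P b := by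
  refine grading_induction k r (fun w hw => ?_) zero add smul hb
  rcases word_eq_y_pow_or' k r w with h | ⟨l, v, hv, h⟩
  · rw [h, y_pow_of_lt k r (by omega)]; exact zero
  · by_cases hl : l ≤ r
    · exact h ▸ word l v hl (by omega)
    · rw [h, y_pow_of_lt k r (by omega), mul_zero, mul_zero]; exact zero

theorem grading_eq_bot_of_neg {n : ℤ} (hn : n < 0) : grading k r n = ⊥ := by
  rw [grading, Submodule.span_eq_bot]
  rintro _ ⟨w, hw, -⟩
  omega

theorem finite_grading (n : ℤ) : Module.Finite k (grading k r n) := by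
  refine Module.Finite.span_of_finite k (((List.finite_length_eq (Fin 2) n.toNat).image
    (fun w => (w.map (gen k r)).prod)).subset ?_)
  rintro _ ⟨w, hw, rfl⟩
  exact ⟨w, by change w.length = _; omega, rfl⟩

end TruncAlg

/-! ### The elements `X` and `Y` of the path algebra. -/

namespace KQ

open PathAlgebra

variable (k : Type u) [Field k] (r : ℕ)

/-- The trivial path at the `i`-th vertex. -/
abbrev e (i : Fin (r + 1)) : KQ k r := idem k (QVertex.mk i)

/-- The sum of the arrows `x_i`. -/
def X : KQ k r := ∑ i : Fin (r + 1), xArrow k r i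

/-- The sum of the arrows `y_i`. -/
def Y : KQ k r := ∑ i : Fin r, yArrow k r i

variable {k r}

theorem xArrow_eq (i : Fin (r + 1)) : xArrow k r i = ofHom k (QArrow.x i) := rfl

theorem yArrow_eq (i : Fin r) : yArrow k r i = ofHom k (QArrow.y i) := rfl

theorem hom_cases {P : ∀ a b : QVertex r, (a ⟶ b) → Prop}
    (x : ∀ i, P (.mk i) (.mk 0) (QArrow.x i))
    (y : ∀ i : Fin r, P (.mk i.castSucc) (.mk i.succ) (QArrow.y i))
    {a b : QVertex r} (e : a ⟶ b) : P a b e :=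
  QArrow.casesOn (motive := fun a b e => P a b e) e x y

/-- Every path is a product of arrows. -/
theorem path_induction {a : QVertex r} {P : ∀ b : QVertex r, Quiver.Path a b → Prop}
    (nil : P a .nil)
    (x : ∀ (i : Fin (r + 1)) (p : Quiver.Path a (.mk i)), P (.mk i) p →
      P (.mk 0) (p.cons (QArrow.x i)))
    (y : ∀ (i : Fin r) (p : Quiver.Path a (.mk i.castSucc)), P (.mk i.castSucc) p →
      P (.mk i.succ) (p.cons (QArrow.y i)))
    {b : QVertex r} (p : Quiver.Path a b) : P b p := by
  induction p with
  | nil => exact nil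
  | cons p e ih =>
    exact hom_cases (P := fun b c e => ∀ p : Quiver.Path a b, P b p → P c (p.cons e)) x y e p ih

theorem ofPath_mul_X {a : QVertex r} (i : Fin (r + 1)) (p : Quiver.Path a (.mk i)) :
    ofPath k ⟨a, .mk i, p⟩ * X k r = ofPath k ⟨a, .mk 0, p.cons (QArrow.x i)⟩ := by
  rw [X, Finset.mul_sum, Finset.sum_eq_single i, ofPath_cons]
  · rfl
  · exact fun j _ hj => ofPath_mul_of_ne k _ _ hj.symm
  · exact fun h => absurd (Finset.mem_univ i) h

theorem ofPath_mul_Y {a : QVertex r} (i : Fin r) (p : Quiver.Path a (.mk i.castSucc)) :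
    ofPath k ⟨a, .mk i.castSucc, p⟩ * Y k r =
      ofPath k ⟨a, .mk i.succ, p.cons (QArrow.y i)⟩ := by
  rw [Y, Finset.mul_sum, Finset.sum_eq_single i, ofPath_cons]
  · rfl
  · exact fun j _ hj => ofPath_mul_of_ne k _ _
      fun h => hj (Fin.castSucc_injective r h).symm
  · exact fun h => absurd (Finset.mem_univ i) h

theorem ofPath_mul_Y_last {a : QVertex r} (p : Quiver.Path a (.mk (Fin.last r))) :
    ofPath k ⟨a, .mk (Fin.last r), p⟩ * Y k r = 0 := by
  rw [Y, Finset.mul_sum]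
  exact Finset.sum_eq_zero fun j _ => ofPath_mul_of_ne k _ _ (Fin.castSucc_lt_last j).ne'

theorem X_mem : X k r ∈ grading k r 1 := Submodule.sum_mem _ fun _ _ => ofHom_mem k _

theorem Y_mem : Y k r ∈ grading k r 1 := Submodule.sum_mem _ fun _ _ => ofHom_mem k _

theorem one_eq : (1 : KQ k r) = ∑ i : Fin (r + 1), e k r i := rfl

/-- The path obtained by following `n` arrows of type `y` to the end. -/
theorem ofPath_mul_Y_pow {a : QVertex r} (n : ℕ) : ∀ (i : Fin (r + 1)) (p : Quiver.Path a (.mk i)),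
    r < i + n → ofPath k ⟨a, .mk i, p⟩ * Y k r ^ n = 0 := by
  induction n with
  | zero => intro i p h; exact absurd h (by have := i.2; omega)
  | succ n ih =>
    intro i p h
    rw [pow_succ', ← mul_assoc]
    induction i using Fin.lastCases with
    | last => rw [ofPath_mul_Y_last, zero_mul]
    | cast i =>
      rw [ofPath_mul_Y]
      exact ih _ _ (by simp at h ⊢; omega)

/-- Each arrow `y_i` advances by one vertex, and there are only `r + 1` vertices. This is the
relation that makes `fromTrunc` well defined. -/
theorem Y_pow : Y k r ^ (r + 1) = 0 := by
  rw [← one_mul (Y k r ^ (r + 1)), one_eq, Finset.sum_mul]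
  exact Finset.sum_eq_zero fun i _ => ofPath_mul_Y_pow _ i .nil (by omega)

end KQ

/-! ### The embedding of `B` in `kQ` and its right linear retraction. -/

namespace KQ

open PathAlgebra

variable (k : Type u) [Field k] (r : ℕ)

/-- The homomorphism `B → kQ` with `x ↦ ∑ x_i` and `y ↦ ∑ y_i`. -/
def fromTrunc : TruncAlg.grading k r →ₐᵍ[k] grading k r :=
  { TruncAlg.lift k r (X k r) (Y k r) Y_pow with
    map_mem := by
      intro i b hb
      change TruncAlg.lift k r (X k r) (Y k r) Y_pow b ∈ _
      refine TruncAlg.grading_induction k r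
        (P := fun b => TruncAlg.lift k r (X k r) (Y k r) Y_pow b ∈ grading k r i)
        (fun w hw => ?_) (by rw [map_zero]; exact zero_mem _)
        (fun a b ha hb => by rw [map_add]; exact add_mem ha hb)
        (fun c a ha => by rw [map_smul]; exact Submodule.smul_mem _ c ha) hb
      subst hw
      clear hb
      induction w with
      | nil => rw [TruncAlg.word_nil, map_one]; exact SetLike.one_mem_graded (grading k r)
      | cons i w ih =>
        fin_cases i
        · change TruncAlg.lift k r _ _ _ (TruncAlg.word k r (0 :: w)) ∈ _
          rw [TruncAlg.word_cons_zero, map_mul, TruncAlg.lift_x, List.length_cons, Nat.cast_succ,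
            add_comm]
          exact SetLike.mul_mem_graded X_mem ih
        · change TruncAlg.lift k r _ _ _ (TruncAlg.word k r (1 :: w)) ∈ _
          rw [TruncAlg.word_cons_one, map_mul, TruncAlg.lift_y, List.length_cons, Nat.cast_succ,
            add_comm]
          exact SetLike.mul_mem_graded Y_mem ih }

variable {k r}

theorem fromTrunc_x : fromTrunc k r (TruncAlg.x k r) = X k r := TruncAlg.lift_x k r _ _ Y_pow

theorem fromTrunc_y : fromTrunc k r (TruncAlg.y k r) = Y k r := TruncAlg.lift_y k r _ _ Y_pow

theorem fromTrunc_mem {i : ℤ} {b : TruncAlg k r} (hb : b ∈ TruncAlg.grading k r i) :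
    fromTrunc k r b ∈ grading k r i := (fromTrunc k r).map_mem hb

/-- The letter that labels an arrow. -/
def letter {a b : QVertex r} : (a ⟶ b) → Fin 2
  | QArrow.x _ => 0
  | QArrow.y _ => 1

variable (r) in
/-- The word spelled by a path. -/
def label {a : QVertex r} : ∀ {b : QVertex r}, Quiver.Path a b → List (Fin 2)
  | _, .nil => []
  | _, .cons p e => label p ++ [letter e]

theorem length_label {a b : QVertex r} (p : Quiver.Path a b) :
    (label r p).length = p.length := by
  induction p with
  | nil => rfl
  | cons p e ih => simp [label, ih]

theorem word_label_x {a : QVertex r} (i : Fin (r + 1)) (p : Quiver.Path a (.mk i)) :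
    TruncAlg.word k r (label r (p.cons (QArrow.x i))) =
      TruncAlg.word k r (label r p) * TruncAlg.x k r := by
  change TruncAlg.word k r (label r p ++ [0]) = _
  rw [TruncAlg.word_append, TruncAlg.word_cons_zero, TruncAlg.word_nil, mul_one]

theorem word_label_y {a : QVertex r} (i : Fin r) (p : Quiver.Path a (.mk i.castSucc)) :
    TruncAlg.word k r (label r (p.cons (QArrow.y i))) =
      TruncAlg.word k r (label r p) * TruncAlg.y k r := by
  change TruncAlg.word k r (label r p ++ [1]) = _
  rw [TruncAlg.word_append, TruncAlg.word_cons_one, TruncAlg.word_nil, mul_one]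

/-- A path is determined by its start and its label. -/
theorem ofPath_eq {a b : QVertex r} (p : Quiver.Path a b) :
    ofPath k ⟨a, b, p⟩ = idem k a * fromTrunc k r (TruncAlg.word k r (label r p)) := by
  induction p using path_induction with
  | nil => rw [label, TruncAlg.word_nil, map_one, mul_one]; rfl
  | x i p ih => rw [← ofPath_mul_X, ih, word_label_x, map_mul, fromTrunc_x, mul_assoc]
  | y i p ih => rw [← ofPath_mul_Y, ih, word_label_y, map_mul, fromTrunc_y, mul_assoc]

/-- The degree `n` part of `kQ` is spanned by the `e_i f(w)` with `w` a word of length `n`. -/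
theorem grading_induction {n : ℤ} {P : KQ k r → Prop}
    (path : ∀ (i : Fin (r + 1)) (w : List (Fin 2)), (w.length : ℤ) = n →
      P (e k r i * fromTrunc k r (TruncAlg.word k r w)))
    (zero : P 0) (add : ∀ a b, P a → P b → P (a + b)) (smul : ∀ (c : k) a, P a → P (c • a))
    {d : KQ k r} (hd : d ∈ grading k r n) : P d := by
  induction hd using Submodule.span_induction with
  | mem d hd =>
    obtain ⟨⟨a, b, p⟩, hp, rfl⟩ := hd
    rw [ofPath_eq]
    exact path a _ (by rw [length_label]; exact hp)
  | zero => exact zero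
  | add a b _ _ ha hb => exact add a b ha hb
  | smul c a _ ha => exact smul c a ha

theorem finite_grading (n : ℤ) : Module.Finite k (grading k r n) := by
  have h : Set.Finite {d : KQ k r | ∃ (i : Fin (r + 1)), ∃ w ∈ {w : List (Fin 2) | w.length = n.toNat},
      e k r i * fromTrunc k r (TruncAlg.word k r w) = d} := by
    have := ((Set.finite_univ (α := Fin (r + 1))).prod (List.finite_length_eq (Fin 2) n.toNat)).image
      (fun p => e k r p.1 * fromTrunc k r (TruncAlg.word k r p.2))
    refine this.subset ?_
    rintro _ ⟨i, w, hw, rfl⟩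
    exact ⟨(i, w), ⟨trivial, hw⟩, rfl⟩
  refine Module.Finite.span_of_finite k (h.subset ?_)
  rintro _ ⟨⟨a, b, p⟩, hp, rfl⟩
  refine ⟨a, label r p, ?_, (ofPath_eq p).symm⟩
  change _ = _
  rw [length_label]
  simp only at hp
  omega

variable (k r) in
/-- The linear map `kQ → B` that sends a path starting at the first vertex to its label, and all
other paths to `0`. -/
def toTrunc : KQ k r →ₗ[k] TruncAlg k r :=
  open Classical in
  onPaths k fun a _ p => if a = .mk 0 then TruncAlg.word k r (label r p) else 0

theorem toTrunc_ofPath_zero {b : QVertex r} (p : Quiver.Path (.mk 0) b) :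
    toTrunc k r (ofPath k ⟨.mk 0, b, p⟩) = TruncAlg.word k r (label r p) := by
  rw [toTrunc, onPaths_ofPath, if_pos rfl]

theorem toTrunc_ofPath_of_ne {a b : QVertex r} (p : Quiver.Path a b) (h : a ≠ .mk 0) :
    toTrunc k r (ofPath k ⟨a, b, p⟩) = 0 := by
  rw [toTrunc, onPaths_ofPath, if_neg h]

/-- Every `x` returns to the first vertex, so a path from there to `b` must end with a run of as
many `y` as the number of `b`. At the last vertex the label ends in `y^r`; one more `y` gives `0` in
`B`, in agreement with the fact that `Y` kills such a path. -/
theorem exists_word_label_eq {b : QVertex r} (p : Quiver.Path (.mk 0) b) :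
    ∃ c : TruncAlg k r, TruncAlg.word k r (label r p) = c * TruncAlg.y k r ^ Fin.val (n := r + 1) b := by
  induction p using path_induction with
  | nil => exact ⟨1, by rw [one_mul]; exact (pow_zero _).symm⟩
  | x i p ih => exact ⟨_, ((congrArg _ (pow_zero _)).trans (mul_one _)).symm⟩
  | y i p ih =>
    obtain ⟨c, hc⟩ := ih
    refine ⟨c, ?_⟩
    rw [word_label_y, hc, mul_assoc, ← pow_succ]
    rfl

theorem toTrunc_mul_X (d : KQ k r) : toTrunc k r (d * X k r) = toTrunc k r d * TruncAlg.x k r := by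
  refine LinearMap.congr_fun (linearMap_ext k
    (φ := toTrunc k r ∘ₗ LinearMap.mulRight k (X k r))
    (ψ := LinearMap.mulRight k (TruncAlg.x k r) ∘ₗ toTrunc k r) fun a b p => ?_) d
  change toTrunc k r (ofPath k ⟨a, b, p⟩ * X k r) = toTrunc k r (ofPath k ⟨a, b, p⟩) * TruncAlg.x k r
  have hp : ofPath k ⟨a, b, p⟩ * X k r = _ := ofPath_mul_X b p
  rw [hp]
  by_cases h : a = .mk 0
  · subst h
    rw [toTrunc_ofPath_zero, toTrunc_ofPath_zero]
    exact word_label_x b p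
  · rw [toTrunc_ofPath_of_ne _ h, toTrunc_ofPath_of_ne _ h, zero_mul]

theorem toTrunc_mul_Y (d : KQ k r) : toTrunc k r (d * Y k r) = toTrunc k r d * TruncAlg.y k r := by
  refine LinearMap.congr_fun (linearMap_ext k
    (φ := toTrunc k r ∘ₗ LinearMap.mulRight k (Y k r))
    (ψ := LinearMap.mulRight k (TruncAlg.y k r) ∘ₗ toTrunc k r) fun a b p => ?_) d
  change toTrunc k r (ofPath k ⟨a, b, p⟩ * Y k r) = toTrunc k r (ofPath k ⟨a, b, p⟩) * TruncAlg.y k r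
  revert p
  refine Fin.lastCases (motive := fun b => ∀ p : Quiver.Path a (.mk b),
    toTrunc k r (ofPath k ⟨a, .mk b, p⟩ * Y k r) = toTrunc k r (ofPath k ⟨a, .mk b, p⟩) * TruncAlg.y k r)
    (fun p => ?_) (fun b p => ?_) b
  · rw [ofPath_mul_Y_last, map_zero]
    by_cases h : a = .mk 0
    · subst h
      obtain ⟨c, hc⟩ := exists_word_label_eq (k := k) p
      rw [toTrunc_ofPath_zero, hc, mul_assoc]
      exact (mul_eq_zero_of_right c ((pow_succ _ _).symm.trans (TruncAlg.y_pow k r))).symm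
    · rw [toTrunc_ofPath_of_ne _ h, zero_mul]
  · rw [ofPath_mul_Y b]
    by_cases h : a = .mk 0
    · subst h
      rw [toTrunc_ofPath_zero, toTrunc_ofPath_zero, ← word_label_y]
    · rw [toTrunc_ofPath_of_ne _ h, toTrunc_ofPath_of_ne _ h, zero_mul]

/-- This right `B`-linearity is what lets `toTrunc` induce a map on `kQ ⊗_B M`. -/
theorem toTrunc_mul_fromTrunc (d : KQ k r) (b : TruncAlg k r) :
    toTrunc k r (d * fromTrunc k r b) = toTrunc k r d * b := by
  induction b using TruncAlg.induction generalizing d with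
  | one => rw [map_one, mul_one, mul_one]
  | x_mul b ih => rw [map_mul (fromTrunc k r), ← mul_assoc, ih, fromTrunc_x, toTrunc_mul_X, mul_assoc]
  | y_mul b ih => rw [map_mul (fromTrunc k r), ← mul_assoc, ih, fromTrunc_y, toTrunc_mul_Y, mul_assoc]
  | add a b ha hb => rw [map_add, mul_add, map_add, ha, hb, mul_add]
  | smul c a ha => rw [map_smul, mul_smul_comm, map_smul, ha, mul_smul_comm]

theorem toTrunc_idem_zero : toTrunc k r (e k r 0) = 1 := toTrunc_ofPath_zero (k := k) .nil

theorem toTrunc_idem_mul (d : KQ k r) : toTrunc k r (e k r 0 * d) = toTrunc k r d := by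
  refine LinearMap.congr_fun (linearMap_ext k
    (φ := toTrunc k r ∘ₗ LinearMap.mulLeft k (e k r 0)) (ψ := toTrunc k r) fun a b p => ?_) d
  change toTrunc k r (e k r 0 * ofPath k ⟨a, b, p⟩) = _
  by_cases h : a = .mk 0
  · subst h
    exact congrArg _ (idem_mul_self k p)
  · rw [toTrunc_ofPath_of_ne p h]
    refine (congrArg _ (idem_mul_of_ne k p ?_)).trans (map_zero _)
    exact fun h' => h h'.symm

theorem toTrunc_one : toTrunc k r 1 = 1 := by
  rw [← toTrunc_idem_mul, mul_one, toTrunc_idem_zero]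

theorem toTrunc_fromTrunc (b : TruncAlg k r) : toTrunc k r (fromTrunc k r b) = b := by
  rw [← one_mul (fromTrunc k r b), toTrunc_mul_fromTrunc, toTrunc_one, one_mul]

theorem fromTrunc_injective : Function.Injective (fromTrunc k r) :=
  Function.LeftInverse.injective toTrunc_fromTrunc

/-- Together with `toTrunc_mul_fromTrunc` and `toTrunc_idem_zero`, this makes `b ↦ e f(b)` an
isomorphism of right `B`-modules from `B` onto `e kQ`. -/
theorem idem_zero_mul (d : KQ k r) : e k r 0 * d = e k r 0 * fromTrunc k r (toTrunc k r d) := by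
  refine LinearMap.congr_fun (linearMap_ext k
    (φ := LinearMap.mulLeft k (e k r 0))
    (ψ := LinearMap.mulLeft k (e k r 0) ∘ₗ (fromTrunc k r).toAlgHom.toLinearMap ∘ₗ toTrunc k r)
    fun a b p => ?_) d
  change e k r 0 * ofPath k ⟨a, b, p⟩ = e k r 0 * fromTrunc k r (toTrunc k r (ofPath k ⟨a, b, p⟩))
  by_cases h : a = .mk 0
  · subst h
    rw [toTrunc_ofPath_zero, ← ofPath_eq]
    exact idem_mul_self k p
  · rw [toTrunc_ofPath_of_ne p h, map_zero, mul_zero]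
    exact idem_mul_of_ne k p fun h' => h h'.symm

theorem X_mul_idem_zero : X k r * e k r 0 = X k r := by
  rw [X, Finset.sum_mul]
  exact Finset.sum_congr rfl fun i _ => mul_idem_self k _

/-- All the `x_i` end at the first vertex, so `X = X e`, and `e d = e f(λ(d))`. Thus `X kQ` lies in
`f(B)`, and the ideal of `B` generated by `x` is a right `kQ`-module. The comparison of the two
algebras turns on this. -/
theorem X_mul (d : KQ k r) :
    X k r * d = fromTrunc k r (TruncAlg.x k r * toTrunc k r d) := by
  rw [← X_mul_idem_zero, mul_assoc, idem_zero_mul, ← mul_assoc, X_mul_idem_zero, map_mul,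
    fromTrunc_x]

theorem idem_mul_idem_zero : e k r 0 * e k r 0 = e k r 0 := mul_idem_self k _

theorem toTrunc_mem {n : ℤ} {d : KQ k r} (hd : d ∈ grading k r n) :
    toTrunc k r d ∈ TruncAlg.grading k r n := by
  induction hd using Submodule.span_induction with
  | mem d hd =>
    obtain ⟨⟨a, b, p⟩, rfl, rfl⟩ := hd
    by_cases h : a = .mk 0
    · subst h
      rw [toTrunc_ofPath_zero]
      simpa [length_label] using TruncAlg.word_mem_grading k r (label r p)
    · rw [toTrunc_ofPath_of_ne p h]; exact zero_mem _
  | zero => rw [map_zero]; exact zero_mem _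
  | add a b _ _ ha hb => rw [map_add]; exact add_mem ha hb
  | smul c a _ ha => rw [map_smul]; exact Submodule.smul_mem _ c ha

/-- The weight `s` on the arrow `x_1`, `0` on the other `x_i`, and `t` on the `y_i`. -/
def firstWeight (t : k) : ∀ a b : QVertex r, (a ⟶ b) → k
  | _, _, QArrow.x i => if i = 0 then 1 else 0
  | _, _, QArrow.y _ => t

/-- Among the `x_i` only the loop at the first vertex counts. Equal weights `1` would give `(r + 1)
e`, which can vanish in positive characteristic. -/
theorem stripFirst_X (t : k) : stripFirst k (firstWeight t) (X k r) = e k r 0 := by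
  rw [X, map_sum, Finset.sum_eq_single 0]
  · rw [xArrow_eq, stripFirst_ofHom]
    exact one_smul _ _
  · intro i _ hi
    rw [xArrow_eq, stripFirst_ofHom]
    change (if i = 0 then (1 : k) else 0) • _ = _
    rw [if_neg hi, zero_smul]
  · exact fun h => absurd (Finset.mem_univ _) h

theorem stripFirst_Y : stripFirst k (firstWeight 1) (Y k r) = ∑ i : Fin r, e k r i.succ := by
  rw [Y, map_sum]
  refine Finset.sum_congr rfl fun i _ => ?_
  rw [yArrow_eq, stripFirst_ofHom]
  exact one_smul _ _

/-- Exactly one of the arrows of weight `1`, the loop at the first vertex and the `y_i`, ends at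
each vertex. -/
theorem stripFirst_X_add_Y : stripFirst k (firstWeight 1) (X k r + Y k r) = 1 := by
  rw [map_add, stripFirst_X, stripFirst_Y, one_eq, Fin.sum_univ_succ]

/-- The weight `s` on the arrows `x_i` and `t` on the arrows `y_i`. -/
def lastWeight (s t : k) : ∀ a b : QVertex r, (a ⟶ b) → k
  | _, _, QArrow.x _ => s
  | _, _, QArrow.y _ => t

theorem stripLast_mul_X (s t : k) (d : KQ k r) :
    stripLast k (lastWeight s t) (d * X k r) = s • d := by
  rw [X, Finset.mul_sum, map_sum]
  refine (Finset.sum_congr rfl fun i _ => stripLast_mul_ofHom k _ d (QArrow.x i)).trans ?_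
  change ∑ i : Fin (r + 1), s • (d * e k r i) = _
  rw [← Finset.smul_sum, ← Finset.mul_sum, ← one_eq, mul_one]

/-- No `y` leaves the last vertex, whence the correction by its trivial path. -/
theorem stripLast_mul_Y (s t : k) (d : KQ k r) :
    stripLast k (lastWeight s t) (d * Y k r) = t • (d * (1 - e k r (Fin.last r))) := by
  rw [Y, Finset.mul_sum, map_sum]
  refine (Finset.sum_congr rfl fun i _ => stripLast_mul_ofHom k _ d (QArrow.y i)).trans ?_
  change ∑ i : Fin r, t • (d * e k r i.castSucc) = _
  rw [one_eq, Fin.sum_univ_castSucc, add_sub_cancel_right, Finset.mul_sum, Finset.smul_sum]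

/-- The paths in `X Y^n` end at the vertex numbered `n`, which is not the last one. This removes the
correction term of `stripLast_mul_Y`. -/
theorem X_mul_Y_pow_mul_idem_last {n : ℕ} (h : n < r) :
    X k r * Y k r ^ n * e k r (Fin.last r) = 0 := by
  suffices H : ∃ p : Quiver.Path (V := QVertex r) (.mk 0) (.mk ⟨n, by omega⟩),
      e k r 0 * Y k r ^ n = ofPath k ⟨_, _, p⟩ by
    obtain ⟨p, hp⟩ := H
    rw [← X_mul_idem_zero, mul_assoc (X k r), hp, mul_assoc, mul_idem_of_ne, mul_zero]
    exact fun h' => h.ne (congrArg Fin.val h')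
  induction n with
  | zero => exact ⟨.nil, by rw [pow_zero, mul_one]; rfl⟩
  | succ n ih =>
    obtain ⟨p, hp⟩ := ih (by omega)
    exact ⟨p.cons (QArrow.y ⟨n, by omega⟩), by
      rw [pow_succ, ← mul_assoc, hp]; exact ofPath_mul_Y (k := k) ⟨n, by omega⟩ p⟩

/-- Deleting `j` letters `y` and then one `x` from the right succeeds only if the number of final
`y` is exactly `j`. This isolates one coefficient of a sum `∑ d_l X Y^l`. -/
theorem stripLast_pow_mul_X_Y_pow (d : KQ k r) (j l : ℕ) (hl : l ≤ r) :
    stripLast k (lastWeight 1 0) ((stripLast k (lastWeight 0 1))^[j] (d * (X k r * Y k r ^ l))) =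
      if j = l then d else 0 := by
  induction j generalizing l with
  | zero =>
    rw [Function.iterate_zero, id]
    cases l with
    | zero => rw [pow_zero, mul_one, stripLast_mul_X, one_smul, if_pos rfl]
    | succ l =>
      rw [pow_succ, ← mul_assoc, ← mul_assoc, stripLast_mul_Y, zero_smul, if_neg (by omega)]
  | succ j ih =>
    rw [Function.iterate_succ_apply]
    cases l with
    | zero =>
      rw [pow_zero, mul_one, stripLast_mul_X, zero_smul, if_neg (by omega)]
      rw [Function.iterate_fixed (map_zero _), map_zero]
    | succ l =>
      rw [pow_succ, ← mul_assoc, ← mul_assoc, stripLast_mul_Y, one_smul, mul_sub, mul_one,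
        mul_assoc d, mul_assoc d, X_mul_Y_pow_mul_idem_last (by omega), mul_zero, sub_zero,
        ih l (by omega)]
      simp

end KQ

/-! ### Graded modules and torsion -/

section Torsion

variable {k A : Type u} [Field k] [Ring A] [Algebra k A] {𝒜 : ℤ → Submodule k A}

namespace GrMod

instance (M : GrMod 𝒜) : DirectSum.Decomposition M.deg := M.isInternal.chooseDecomposition

/-- The homogeneous component of degree `i`. -/
def comp (M : GrMod 𝒜) (i : ℤ) : M.carrier →ₗ[k] M.carrier :=
  (M.deg i).subtype ∘ₗ DirectSum.component k ℤ (fun i => M.deg i) i ∘ₗ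
    (DirectSum.decomposeLinearEquiv M.deg).toLinearMap

theorem comp_mem (M : GrMod 𝒜) (i : ℤ) (m : M.carrier) : M.comp i m ∈ M.deg i :=
  (DirectSum.decompose M.deg m i).2

theorem comp_same (M : GrMod 𝒜) {i : ℤ} {m : M.carrier} (hm : m ∈ M.deg i) : M.comp i m = m :=
  DirectSum.decompose_of_mem_same _ hm

theorem comp_of_ne (M : GrMod 𝒜) {i j : ℤ} {m : M.carrier} (hm : m ∈ M.deg i) (h : i ≠ j) :
    M.comp j m = 0 :=
  DirectSum.decompose_of_mem_ne _ hm h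

open Classical in
theorem sum_comp (M : GrMod 𝒜) (m : M.carrier) :
    ∑ i ∈ (DirectSum.decompose M.deg m).support, M.comp i m = m :=
  DirectSum.sum_support_decompose M.deg m

@[elab_as_elim]
theorem induction (M : GrMod 𝒜) {P : M.carrier → Prop} (m : M.carrier)
    (homogeneous : ∀ (i : ℤ) (m : M.carrier), m ∈ M.deg i → P m)
    (add : ∀ m m', P m → P m' → P (m + m')) : P m :=
  DirectSum.Decomposition.inductionOn M.deg (homogeneous 0 0 (zero_mem _))
    (fun m => homogeneous _ m m.2) (fun m m' => add m m') m

theorem map_comp {M N : GrMod 𝒜} (φ : M ⟶ N) (i : ℤ) (m : M.carrier) :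
    N.comp i (φ.toLin m) = φ.toLin (M.comp i m) := by
  induction m using GrMod.induction with
  | homogeneous j m hm =>
    by_cases h : j = i
    · subst h
      rw [comp_same _ hm, comp_same _ (φ.map_deg hm)]
    · rw [comp_of_ne _ hm h, comp_of_ne _ (φ.map_deg hm) h, map_zero]
  | add m m' h h' => simp only [map_add, h, h']

/-- A submodule that contains the homogeneous components of its elements. -/
def IsHomogeneous (M : GrMod 𝒜) (P : Submodule A M.carrier) : Prop :=
  ∀ (i : ℤ) (m : M.carrier), m ∈ P → M.comp i m ∈ P

theorem isHomogeneous_ker {M N : GrMod 𝒜} (φ : M ⟶ N) : M.IsHomogeneous (LinearMap.ker φ.toLin) :=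
  fun i m hm => by
    rw [LinearMap.mem_ker] at hm ⊢
    rw [← map_comp, hm, map_zero]

theorem isHomogeneous_range {M N : GrMod 𝒜} (φ : M ⟶ N) :
    N.IsHomogeneous (LinearMap.range φ.toLin) := by
  rintro i _ ⟨m, rfl⟩
  exact ⟨M.comp i m, (map_comp φ i m).symm⟩

theorem isHomogeneous_bot (M : GrMod 𝒜) : M.IsHomogeneous ⊥ := fun i m hm => by
  rw [Submodule.mem_bot] at hm ⊢
  rw [hm, map_zero]

end GrMod

/-- The elements of sufficiently large degree of `A` multiply `m` into `P`. -/
def EventuallyMem (𝒜 : ℤ → Submodule k A) {M : Type*} [AddCommGroup M] [Module A M]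
    (P : Submodule A M) (m : M) : Prop :=
  ∃ n : ℕ, ∀ i : ℤ, n ≤ i → ∀ a ∈ 𝒜 i, a • m ∈ P

namespace EventuallyMem

variable {M : Type*} [AddCommGroup M] [Module A M] {P : Submodule A M}

theorem of_mem {m : M} (h : m ∈ P) : EventuallyMem 𝒜 P m :=
  ⟨0, fun _ _ a _ => P.smul_mem a h⟩

theorem add {m m' : M} (h : EventuallyMem 𝒜 P m) (h' : EventuallyMem 𝒜 P m') :
    EventuallyMem 𝒜 P (m + m') := by
  obtain ⟨n, hn⟩ := h
  obtain ⟨n', hn'⟩ := h'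
  refine ⟨max n n', fun i hi a ha => ?_⟩
  rw [smul_add]
  push_cast at hi
  exact add_mem (hn i (by omega) a ha) (hn' i (by omega) a ha)

theorem sum {ι : Type*} (s : Finset ι) {m : ι → M} (h : ∀ i ∈ s, EventuallyMem 𝒜 P (m i)) :
    EventuallyMem 𝒜 P (∑ i ∈ s, m i) := by
  classical
  induction s using Finset.induction_on with
  | empty => exact of_mem (by simp)
  | insert i s hi ih =>
    rw [Finset.sum_insert hi]
    exact (h i (Finset.mem_insert_self _ _)).add
      (ih fun j hj => h j (Finset.mem_insert_of_mem hj))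

/-- One bound works for finitely many elements. -/
theorem uniform {ι : Type*} (s : Finset ι) {m : ι → M} (h : ∀ i ∈ s, EventuallyMem 𝒜 P (m i)) :
    ∃ n : ℕ, ∀ j ∈ s, ∀ i : ℤ, n ≤ i → ∀ a ∈ 𝒜 i, a • m j ∈ P := by
  classical
  induction s using Finset.induction_on with
  | empty => exact ⟨0, by simp⟩
  | insert i s hi ih =>
    obtain ⟨n, hn⟩ := h i (Finset.mem_insert_self _ _)
    obtain ⟨n', hn'⟩ := ih fun j hj => h j (Finset.mem_insert_of_mem hj)
    refine ⟨max n n', fun j hj l hl a ha => ?_⟩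
    push_cast at hl
    rcases Finset.mem_insert.1 hj with rfl | hj
    · exact hn l (by omega) a ha
    · exact hn' j hj l (by omega) a ha

end EventuallyMem

theorem LinearIndependent.setFinite_of_mem {V ι : Type*} [AddCommGroup V] [Module k V]
    {W : Submodule k V} [Module.Finite k W] {v : ι → V} (hv : LinearIndependent k v)
    (h : ∀ i, v i ∈ W) : Finite ι := by
  have : LinearIndependent k (fun i => (⟨v i, h i⟩ : W)) :=
    LinearIndependent.of_comp W.subtype hv
  exact this.finite

/-- Nonzero values `ψ (a_i • m)` with `a_i` of distinct degrees are linearly independent because the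
kernel is homogeneous, so the finite dimensional `V` has room for finitely many degrees only. `W`
carries no grading of its own: `ψ` is the identity when kernels are treated, and the quotient map
for cokernels. -/
theorem eventuallyMem_of_mem_finite {M : GrMod 𝒜} {W : Type u} [AddCommGroup W] [Module k W]
    [Module A W] [IsScalarTower k A W] (ψ : M.carrier →ₗ[A] W)
    (hψ : M.IsHomogeneous (LinearMap.ker ψ)) {V : Submodule A W}
    (hV : Module.Finite k V) {j : ℤ} {m : M.carrier} (hm : m ∈ M.deg j) (hmV : ψ m ∈ V) :
    EventuallyMem 𝒜 (LinearMap.ker ψ) m := by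
  let S : Set ℤ := {i | ∃ a ∈ 𝒜 i, ψ (a • m) ≠ 0}
  choose! a ha ha' using fun i (hi : i ∈ S) => hi
  have hlin : LinearIndependent k (fun i : S => ψ (a i • m)) := by
    rw [linearIndependent_iff']
    intro s c hc i hi
    have hc' : ∑ i ∈ s, c i • a i • m ∈ LinearMap.ker ψ := by
      rw [LinearMap.mem_ker, map_sum, ← hc]
      exact Finset.sum_congr rfl fun i _ => LinearMap.map_smul_of_tower ψ _ _
    -- Taking the component of degree `i + j` leaves a single term of the linear relation.
    have := hψ (i + j) _ hc'
    rw [map_sum, Finset.sum_eq_single i, map_smul,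
      M.comp_same (M.smul_mem (ha i i.2) hm), LinearMap.mem_ker,
      LinearMap.map_smul_of_tower] at this
    · exact (smul_eq_zero.1 this).resolve_right (ha' i i.2)
    · intro l _ hl
      rw [map_smul, M.comp_of_ne (M.smul_mem (ha l l.2) hm), smul_zero]
      intro h
      exact hl (Subtype.ext (add_right_cancel h))
    · exact fun h => absurd hi h
  have : Module.Finite k (V.restrictScalars k) := hV
  have hfin : Finite S := hlin.setFinite_of_mem (W := V.restrictScalars k) fun i => by
    rw [Submodule.restrictScalars_mem, map_smul]
    exact V.smul_mem _ hmV
  obtain ⟨b, hb⟩ := (Set.toFinite S).bddAbove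
  refine ⟨(b + 1).toNat, fun i hi c hc => ?_⟩
  by_contra h
  have := hb (show i ∈ S from ⟨c, hc, h⟩)
  omega

theorem EventuallyMem.of_homogeneous {M : GrMod 𝒜} {P : Submodule A M.carrier} {m : M.carrier}
    (h : ∀ i, EventuallyMem 𝒜 P (M.comp i m)) : EventuallyMem 𝒜 P m := by
  rw [← M.sum_comp m]
  exact EventuallyMem.sum _ fun i _ => h i

/-- The pieces of the grading are finite dimensional, and vanish in negative degrees. -/
structure IsLocallyFinite (𝒜 : ℤ → Submodule k A) : Prop where
  finite : ∀ n, Module.Finite k (𝒜 n)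
  neg : ∀ n < 0, 𝒜 n = ⊥

/-- Only the finitely many `A_i` with `0 ≤ i ≤ n` can contribute to `A w`, and each is finite
dimensional. -/
theorem IsLocallyFinite.finite_span_of_eventually [GradedAlgebra 𝒜] (h𝒜 : IsLocallyFinite 𝒜)
    {W : Type u} [AddCommGroup W] [Module k W] [Module A W] [IsScalarTower k A W] {w : W}
    (hw : EventuallyMem 𝒜 (⊥ : Submodule A W) w) :
    ∃ N : Submodule A W, w ∈ N ∧ Module.Finite k N := by
  obtain ⟨n, hn⟩ := hw
  refine ⟨Submodule.span A {w}, Submodule.mem_span_singleton_self w, ?_⟩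
  have := h𝒜.finite
  let T : (∀ i : Finset.Icc (0 : ℤ) n, 𝒜 i) →ₗ[k] W :=
    ∑ i : Finset.Icc (0 : ℤ) n, ((LinearMap.toSpanSingleton A W w).restrictScalars k) ∘ₗ (𝒜 i).subtype ∘ₗ
      LinearMap.proj i
  have hT : (Submodule.span A {w}).restrictScalars k ≤ LinearMap.range T := by
    intro z hz
    rw [Submodule.restrictScalars_mem, Submodule.mem_span_singleton] at hz
    obtain ⟨a, rfl⟩ := hz
    induction a using DirectSum.Decomposition.inductionOn 𝒜 with
    | zero => rw [zero_smul]; exact zero_mem _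
    | add a b ha hb => rw [add_smul]; exact add_mem ha hb
    | @homogeneous i a =>
      by_cases hi : i < 0
      · have h0 : (a : A) = 0 := by
          have h := (Submodule.eq_bot_iff _).1 (h𝒜.neg i hi)
          exact h _ a.2
        rw [h0, zero_smul]; exact zero_mem _
      · by_cases hi' : n ≤ i
        · rw [(Submodule.mem_bot A).1 (hn i hi' _ a.2)]; exact zero_mem _
        · classical
          refine ⟨Pi.single ⟨i, Finset.mem_Icc.2 (by omega)⟩ a, ?_⟩
          rw [LinearMap.sum_apply, Finset.sum_eq_single ⟨i, Finset.mem_Icc.2 (by omega)⟩]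
          · simp
          · intro j _ hj
            simp [Pi.single_eq_of_ne hj]
          · exact fun h => absurd (Finset.mem_univ _) h
  have : Module.Finite k (LinearMap.range T) := inferInstance
  exact Module.Finite.of_injective (Submodule.inclusion hT) (Submodule.inclusion_injective hT)

variable [GradedAlgebra 𝒜]

theorem isFdim_ker_iff (h𝒜 : IsLocallyFinite 𝒜) {M N : GrMod 𝒜} (φ : M ⟶ N) :
    IsFdim k A (LinearMap.ker φ.toLin) ↔
      ∀ m, φ.toLin m = 0 → EventuallyMem 𝒜 (⊥ : Submodule A M.carrier) m := by
  constructor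
  · intro h m hm
    refine EventuallyMem.of_homogeneous fun i => ?_
    obtain ⟨V, hV, hV'⟩ := h ⟨M.comp i m, GrMod.isHomogeneous_ker φ i m hm⟩
    have : Module.Finite k (V.restrictScalars k) := hV'
    have := eventuallyMem_of_mem_finite (𝒜 := 𝒜) (M := M) LinearMap.id
      (by rw [LinearMap.ker_id]; exact M.isHomogeneous_bot)
      (V := V.map (LinearMap.ker φ.toLin).subtype)
      (Module.Finite.map (V.restrictScalars k)
        ((LinearMap.ker φ.toLin).subtype.restrictScalars k)) (M.comp_mem i m) ⟨_, hV, rfl⟩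
    rwa [LinearMap.ker_id] at this
  · rintro h ⟨m, hm⟩
    refine h𝒜.finite_span_of_eventually ?_
    obtain ⟨n, hn⟩ := h m hm
    exact ⟨n, fun i hi a ha => by
      rw [Submodule.mem_bot]
      exact Subtype.ext ((Submodule.mem_bot A).1 (hn i hi a ha))⟩

theorem isFdim_coker_iff (h𝒜 : IsLocallyFinite 𝒜) {M N : GrMod 𝒜} (φ : M ⟶ N) :
    IsFdim k A (N.carrier ⧸ LinearMap.range φ.toLin) ↔
      ∀ n, EventuallyMem 𝒜 (LinearMap.range φ.toLin) n := by
  constructor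
  · intro h n
    refine EventuallyMem.of_homogeneous fun i => ?_
    obtain ⟨V, hV, hV'⟩ := h (Submodule.Quotient.mk (N.comp i n))
    have := eventuallyMem_of_mem_finite (𝒜 := 𝒜) (M := N) (LinearMap.range φ.toLin).mkQ
      (by rw [Submodule.ker_mkQ]; exact GrMod.isHomogeneous_range φ) hV' (N.comp_mem i n) hV
    rwa [Submodule.ker_mkQ] at this
  · intro h w
    obtain ⟨n, rfl⟩ := Submodule.Quotient.mk_surjective _ w
    refine h𝒜.finite_span_of_eventually ?_
    obtain ⟨l, hl⟩ := h n
    exact ⟨l, fun i hi a ha => by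
      rw [Submodule.mem_bot, ← Submodule.Quotient.mk_smul, Submodule.Quotient.mk_eq_zero]
      exact hl i hi a ha⟩

/-- Finite dimensional submodules give way to a degree condition on single elements, the form in
which all kernels and cokernels below are examined. -/
theorem fdimIso_iff (h𝒜 : IsLocallyFinite 𝒜) {M N : GrMod 𝒜} (φ : M ⟶ N) :
    fdimIso 𝒜 φ ↔
      (∀ m, φ.toLin m = 0 → EventuallyMem 𝒜 (⊥ : Submodule A M.carrier) m) ∧
        ∀ n, EventuallyMem 𝒜 (LinearMap.range φ.toLin) n :=
  and_congr (isFdim_ker_iff h𝒜 φ) (isFdim_coker_iff h𝒜 φ)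

/-! ### Torsion in finitely presented modules -/

theorem IsLocallyFinite.exists_sub_mem (h𝒜 : IsLocallyFinite 𝒜) (a : A) :
    ∃ a₀ : 𝒜 0, a - a₀ ∈ ⨆ i : Set.Ici (1 : ℤ), 𝒜 i := by
  induction a using DirectSum.Decomposition.inductionOn 𝒜 with
  | zero => exact ⟨0, by simp⟩
  | add a b ha hb =>
    obtain ⟨a₀, ha⟩ := ha
    obtain ⟨b₀, hb⟩ := hb
    refine ⟨a₀ + b₀, ?_⟩
    rw [Submodule.coe_add, add_sub_add_comm]
    exact add_mem ha hb
  | @homogeneous i a =>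
    rcases lt_trichotomy i 0 with hi | rfl | hi
    · have h0 : (a : A) = 0 := by
        have h := (Submodule.eq_bot_iff _).1 (h𝒜.neg i hi)
        exact h _ a.2
      exact ⟨0, by simp [h0]⟩
    · exact ⟨a, by simp⟩
    · refine ⟨0, ?_⟩
      rw [Submodule.coe_zero, sub_zero]
      exact Submodule.mem_iSup_of_mem (p := fun i : Set.Ici (1 : ℤ) => 𝒜 i) ⟨i, hi⟩ a.2

variable (𝒜) in
/-- The right ideal `A_{≥ 1}` admits a right linear map to `A` that hits `1`. -/
def HasStrip : Prop :=
  ∃ (g : A) (σ : A →ₗ[k] A), g ∈ 𝒜 1 ∧ σ g = 1 ∧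
    ∀ i : ℤ, 1 ≤ i → ∀ a ∈ 𝒜 i, ∀ b, σ (a * b) = σ a * b

/-- The elements killed by `A_{≥ 1}`. -/
def socle (𝒜 : ℤ → Submodule k A) (M : Type u) [AddCommGroup M] [Module k M] [Module A M]
    [IsScalarTower k A M] : Submodule k M where
  carrier := {m | ∀ i : ℤ, 1 ≤ i → ∀ a ∈ 𝒜 i, a • m = 0}
  add_mem' h h' i hi a ha := by rw [smul_add, h i hi a ha, h' i hi a ha, add_zero]
  zero_mem' i hi a ha := smul_zero a
  smul_mem' c m h i hi a ha := by
    rw [← algebraMap_smul A c m, smul_smul, ← Algebra.commutes, ← Algebra.smul_def]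
    exact h i hi _ (Submodule.smul_mem _ c ha)

/-- Let `M = A^n / g(A^m)`. If `v` represents a socle element, then `γ v` is a relation. Up to
relations with coefficients in `A_{≥1}` there are only finitely many dimensions of relations, and if
`γ v` is itself of that kind, `σ` shows that `v` represents `0`. -/
theorem finite_socle (h𝒜 : IsLocallyFinite 𝒜) (hs : HasStrip 𝒜) {M : Type u} [AddCommGroup M]
    [Module k M] [Module A M] [IsScalarTower k A M] (hM : Module.FinitePresentation A M) :
    Module.Finite k (socle 𝒜 M) := by
  obtain ⟨γ, σ, hγ, hσγ, hσ⟩ := hs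
  obtain ⟨n, m, π, g, hπ, hg⟩ := hM.exists_fin'
  let I : Submodule k A := ⨆ i : Set.Ici (1 : ℤ), 𝒜 i
  have hσI : ∀ a ∈ I, ∀ b, σ (a * b) = σ a * b := by
    intro a ha b
    induction ha using Submodule.iSup_induction' with
    | mem i a ha => exact hσ i i.2 a ha b
    | zero => simp
    | add a a' _ _ h h' => simp only [add_mul, map_add, h, h']
  let IR : Submodule k (Fin n → A) :=
    (Submodule.pi Set.univ fun _ : Fin m => I).map (g.restrictScalars k)
  let P : Submodule k (Fin n → A) := (socle 𝒜 M).comap (π.restrictScalars k)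
  let ψ : P →ₗ[k] (Fin n → A) ⧸ IR := IR.mkQ ∘ₗ
    (Module.toModuleEnd k (S := A) (Fin n → A) γ) ∘ₗ P.subtype
  have hψ : ∀ v : P, ψ v = IR.mkQ (γ • (v : Fin n → A)) := fun v => by simp [ψ]
  -- Since `A = A_0 + A_{≥1}`, the relations modulo `IR` are the image of `A_0^m`.
  have hfin : Module.Finite k (LinearMap.range (IR.mkQ ∘ₗ g.restrictScalars k)) := by
    have := h𝒜.finite
    let T : (Fin m → 𝒜 0) →ₗ[k] (Fin n → A) ⧸ IR := IR.mkQ ∘ₗ g.restrictScalars k ∘ₗ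
      LinearMap.pi fun j => (𝒜 0).subtype ∘ₗ LinearMap.proj j
    have hT : LinearMap.range (IR.mkQ ∘ₗ g.restrictScalars k) ≤ LinearMap.range T := by
      rintro _ ⟨u, rfl⟩
      choose u₀ hu₀ using fun j => h𝒜.exists_sub_mem (u j)
      refine ⟨u₀, ?_⟩
      refine ((Submodule.Quotient.eq IR).2 ⟨u - fun j => (u₀ j : A), fun j _ => hu₀ j, ?_⟩).symm
      rw [map_sub]; rfl
    exact Module.Finite.of_injective (Submodule.inclusion hT) (Submodule.inclusion_injective hT)
  have hrange : LinearMap.range ψ ≤ LinearMap.range (IR.mkQ ∘ₗ g.restrictScalars k) := by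
    rintro _ ⟨v, rfl⟩
    have h0 : π (γ • (v : Fin n → A)) = 0 := by
      rw [map_smul]; exact v.2 1 le_rfl γ hγ
    obtain ⟨w, hw⟩ := (hg _).1 h0
    exact ⟨w, by rw [hψ, ← hw]; rfl⟩
  have hker : ∀ v : P, ψ v = 0 → π v = 0 := by
    intro v hv
    rw [hψ, Submodule.mkQ_apply, Submodule.Quotient.mk_eq_zero] at hv
    obtain ⟨w, hw, hw'⟩ := hv
    -- The map `g` is right multiplication by a matrix, so right linearity of `σ` turns `γ v = g w`
    -- into `v = g (σ w)`.
    have hv' : (v : Fin n → A) = g (fun j => σ (w j)) := by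
      funext t
      have h1 : ∀ w' : Fin m → A, g w' t = ∑ j, w' j * g (Pi.single j 1) t := by
        intro w'
        conv_lhs => rw [LinearMap.pi_apply_eq_sum_univ g w']
        rw [Finset.sum_apply]
        refine Finset.sum_congr rfl fun j _ => ?_
        rw [Pi.smul_apply, smul_eq_mul]
        congr 2
        have h2 : (fun j' => if j = j' then (1 : A) else 0) = Pi.single j 1 :=
          funext fun i => by rw [Pi.single_apply]; exact if_congr eq_comm rfl rfl
        exact congrFun (congrArg g h2) t
      have h2 : γ * (v : Fin n → A) t = ∑ j, w j * g (Pi.single j 1) t := by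
        rw [← h1]; exact (congrFun hw' t).symm
      have h3 := congrArg σ h2
      rw [hσ 1 le_rfl γ hγ, hσγ, one_mul, map_sum] at h3
      rw [h3, h1]
      exact Finset.sum_congr rfl fun j _ => hσI _ (hw j trivial) _
    exact (hg _).2 ⟨_, hv'.symm⟩
  have : Module.Finite k (LinearMap.range ψ) :=
    Module.Finite.of_injective (Submodule.inclusion hrange) (Submodule.inclusion_injective hrange)
  have : Module.Finite k (P ⧸ LinearMap.ker ψ) :=
    Module.Finite.equiv ψ.quotKerEquivRange.symm
  let π' : P →ₗ[k] socle 𝒜 M := (π.restrictScalars k).restrict fun _ h => h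
  refine Module.Finite.of_surjective ((LinearMap.ker ψ).liftQ π'
    fun v hv => Subtype.ext (hker v hv)) ?_
  rintro ⟨s, hs⟩
  obtain ⟨v, rfl⟩ := hπ s
  exact ⟨Submodule.Quotient.mk ⟨v, hs⟩, rfl⟩

end Torsion

/-! ### Bounds on the degrees of torsion elements. -/

section Torsion

variable {k A : Type u} [Field k] [Ring A] [Algebra k A] {𝒜 : ℤ → Submodule k A} [GradedAlgebra 𝒜]

/-- Nonzero socle elements of distinct degrees are independent, so a finite dimensional socle meets
finitely many degrees. -/
theorem exists_socle_bound (h𝒜 : IsLocallyFinite 𝒜) (hs : HasStrip 𝒜) (M : GrMod 𝒜)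
    (hM : Module.FinitePresentation A M.carrier) :
    ∃ c : ℤ, ∀ i, c < i → ∀ m ∈ M.deg i, m ∈ socle 𝒜 M.carrier → m = 0 := by
  have := finite_socle h𝒜 hs hM
  let S : Set ℤ := {i | ∃ m ∈ M.deg i, m ∈ socle 𝒜 M.carrier ∧ m ≠ 0}
  choose! m hm hm' hm0 using fun i (hi : i ∈ S) => hi
  have hind := (((DirectSum.isInternal_submodule_iff_iSupIndep_and_iSup_eq_top _).1
    M.isInternal).1.comp (Subtype.val_injective (p := (· ∈ S))))
  have hlin : LinearIndependent k (fun i : S => m i) :=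
    hind.linearIndependent _ (fun i => hm i i.2) fun i => hm0 i i.2
  have hfin : Finite S := hlin.setFinite_of_mem (fun i => hm' i i.2)
  obtain ⟨b, hb⟩ := (Set.toFinite S).bddAbove
  refine ⟨b, fun i hi m hm hm' => ?_⟩
  by_contra h
  exact absurd (hb (show i ∈ S from ⟨m, hm, hm', h⟩)) (not_le.2 hi)

/-- A nonzero homogeneous torsion element has a nonzero multiple in the socle, of no smaller degree:
if `n + 1` is the least bound beyond which it is annihilated, some element of degree at least `n`
does not kill it, and that multiple is killed by `A_{≥1}`. -/
theorem exists_torsion_bound (h𝒜 : IsLocallyFinite 𝒜) (hs : HasStrip 𝒜) (M : GrMod 𝒜)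
    (hM : Module.FinitePresentation A M.carrier) :
    ∃ c : ℤ, ∀ i, c < i → ∀ m ∈ M.deg i,
      EventuallyMem 𝒜 (⊥ : Submodule A M.carrier) m → m = 0 := by
  classical
  obtain ⟨c, hc⟩ := exists_socle_bound h𝒜 hs M hM
  refine ⟨c, fun i hi m hm ht => ?_⟩
  by_contra h0
  have hmin := fun l => Nat.find_min (m := l) ht
  have hspec := Nat.find_spec ht
  generalize Nat.find ht = n at hmin hspec
  cases n with
  | zero => exact h0 (by simpa using hspec 0 (by simp) 1 SetLike.GradedOne.one_mem)
  | succ n =>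
    have := hmin n (Nat.lt_succ_self n)
    push Not at this
    obtain ⟨j, hj, a, ha, ham⟩ := this
    refine ham ((Submodule.mem_bot A).2 (hc (j + i) (by omega) _ (M.smul_mem ha hm) ?_))
    intro l hl b hb
    rw [smul_smul]
    exact (Submodule.mem_bot A).1 (hspec (l + j) (by push_cast; omega) _
      (SetLike.mul_mem_graded hb ha))

/-- Take finitely many homogeneous generators `g`. As `A` has no negative part, only the finitely
many `A_i g` with `0 ≤ i ≤ c - deg g` reach degrees up to `c`. -/
theorem exists_finite_le (h𝒜 : IsLocallyFinite 𝒜) (M : GrMod 𝒜)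
    (hM : Module.Finite A M.carrier) (c : ℤ) :
    ∃ Q : Submodule k M.carrier, Q.FG ∧ ∀ j ≤ c, M.deg j ≤ Q := by
  classical
  obtain ⟨s, hs⟩ := hM.fg_top
  let G : Finset (ℤ × M.carrier) := s.biUnion fun m =>
    (DirectSum.decompose M.deg m).support.image fun i => (i, M.comp i m)
  have hG : ∀ p ∈ G, p.2 ∈ M.deg p.1 := by
    intro p hp
    obtain ⟨m, _, hp⟩ := Finset.mem_biUnion.1 hp
    obtain ⟨i, _, rfl⟩ := Finset.mem_image.1 hp
    exact M.comp_mem i m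
  have hspan : Submodule.span A (Prod.snd '' (G : Set (ℤ × M.carrier))) = ⊤ := by
    rw [eq_top_iff, ← hs, Submodule.span_le]
    intro m hm
    rw [← M.sum_comp m]
    refine Submodule.sum_mem _ fun i hi => Submodule.subset_span ⟨(i, M.comp i m), ?_, rfl⟩
    exact Finset.mem_coe.2 (Finset.mem_biUnion.2 ⟨m, hm, Finset.mem_image_of_mem _ hi⟩)
  let Q : Submodule k M.carrier := ⨆ p ∈ G, ⨆ i ∈ Finset.Icc 0 (c - p.1),
    (𝒜 i).map ((LinearMap.toSpanSingleton A M.carrier p.2).restrictScalars k)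
  have hmem : ∀ p ∈ G, ∀ i ≤ c - p.1, ∀ a ∈ 𝒜 i, a • p.2 ∈ Q := by
    intro p hp i hi a ha
    by_cases h : i < 0
    · have h0 : a = 0 := (Submodule.eq_bot_iff _).1 (h𝒜.neg i h) a ha
      rw [h0, zero_smul]; exact zero_mem _
    · exact Submodule.mem_iSup_of_mem p (Submodule.mem_iSup_of_mem hp
        (Submodule.mem_iSup_of_mem i (Submodule.mem_iSup_of_mem
          (Finset.mem_Icc.2 ⟨not_lt.1 h, hi⟩) ⟨a, ha, rfl⟩)))
  refine ⟨Q, Submodule.fg_biSup _ _ fun p _ => Submodule.fg_biSup _ _ fun i _ => ?_, ?_⟩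
  · exact Submodule.FG.map _ (Module.Finite.iff_fg.1 (h𝒜.finite i))
  · have key : ∀ m : M.carrier, ∀ a : A, ∀ j ≤ c, M.comp j (a • m) ∈ Q := by
      intro m
      have hm : m ∈ Submodule.span A (Prod.snd '' (G : Set (ℤ × M.carrier))) := hspan ▸ trivial
      induction hm using Submodule.span_induction with
      | zero => intro a j _; rw [smul_zero, map_zero]; exact zero_mem _
      | add m m' _ _ h h' =>
        intro a j hj; rw [smul_add, map_add]; exact add_mem (h a j hj) (h' a j hj)
      | smul b m _ h => intro a j hj; rw [smul_smul]; exact h _ j hj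
      | mem m hm =>
        obtain ⟨p, hp, rfl⟩ := hm
        have hp : p ∈ G := hp
        intro a j hj
        induction a using DirectSum.Decomposition.inductionOn 𝒜 with
        | zero => rw [zero_smul, map_zero]; exact zero_mem _
        | add a b ha hb => rw [add_smul, map_add]; exact add_mem ha hb
        | @homogeneous i a =>
          by_cases h : i + p.1 = j
          · rw [← h, M.comp_same (M.smul_mem a.2 (hG p hp))]
            exact hmem p hp i (by omega) _ a.2
          · rw [M.comp_of_ne (M.smul_mem a.2 (hG p hp)) h]; exact zero_mem _
    intro j hj m hm
    have := key m 1 j hj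
    rwa [one_smul, M.comp_same hm] at this

/-- Torsion submodules of finitely presented graded modules are finite dimensional. -/
theorem finite_of_torsion (h𝒜 : IsLocallyFinite 𝒜) (hs : HasStrip 𝒜) (M : GrMod 𝒜)
    (hM : Module.FinitePresentation A M.carrier) {P : Submodule A M.carrier}
    (hP : M.IsHomogeneous P)
    (ht : ∀ m ∈ P, EventuallyMem 𝒜 (⊥ : Submodule A M.carrier) m) : Module.Finite k P := by
  obtain ⟨c, hc⟩ := exists_torsion_bound h𝒜 hs M hM
  obtain ⟨Q, hQ, hQ'⟩ := exists_finite_le h𝒜 M inferInstance c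
  have hPQ : P.restrictScalars k ≤ Q := by
    classical
    intro m hm
    rw [← M.sum_comp m]
    refine Submodule.sum_mem _ fun i _ => ?_
    by_cases h : c < i
    · rw [hc i h _ (M.comp_mem i m) (ht _ (hP i m hm))]; exact zero_mem _
    · exact hQ' i (not_lt.1 h) (M.comp_mem i m)
  have : Module.Finite k Q := Module.Finite.iff_fg.2 hQ
  exact Module.Finite.of_injective (Submodule.inclusion hPQ) (Submodule.inclusion_injective hPQ)

theorem IsFdim.finite {M : Type u} [AddCommGroup M] [Module k M] [Module A M]
    [IsScalarTower k A M] (h : IsFdim k A M) (hM : Module.Finite A M) : Module.Finite k M := by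
  obtain ⟨s, hs⟩ := hM.fg_top
  choose N hN hN' using h
  have hle : (⊤ : Submodule A M) ≤ ⨆ m ∈ s, N m := by
    rw [← hs, Submodule.span_le]
    exact fun m hm => Submodule.mem_iSup_of_mem m (Submodule.mem_iSup_of_mem hm (hN m))
  have hfg : (⨆ m ∈ s, (N m).restrictScalars k).FG :=
    Submodule.fg_biSup _ _ fun m _ => Module.Finite.iff_fg.1 (hN' m)
  refine ⟨?_⟩
  convert hfg
  refine (eq_top_iff.2 fun m _ => ?_).symm
  have hm := hle (show m ∈ ⊤ from trivial)
  have hrs : ∀ t : Finset M, (⨆ m ∈ t, N m).restrictScalars k ≤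
      ⨆ m ∈ t, (N m).restrictScalars k := by
    classical
    intro t
    induction t using Finset.induction_on with
    | empty => simp
    | insert a t _ ih =>
      rw [Finset.iSup_insert, Finset.iSup_insert]
      intro x hx
      obtain ⟨y, hy, z, hz, rfl⟩ := Submodule.mem_sup.1 (show x ∈ _ ⊔ _ from hx)
      exact add_mem (Submodule.mem_sup_left hy) (Submodule.mem_sup_right (ih hz))
  exact hrs s hm

/-- This lets every statement about `qgr` be read off from the one about `QGr`. -/
theorem finDimIso_iff (h𝒜 : IsLocallyFinite 𝒜) (hs : HasStrip 𝒜) {M N : FpGrMod 𝒜} (φ : M ⟶ N) :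
    finDimIso 𝒜 φ ↔ fdimIso 𝒜 φ.hom := by
  constructor
  · exact fun h => ⟨.of_finite _ h.1, .of_finite _ h.2⟩
  · refine fun h => ⟨?_, ?_⟩
    · exact finite_of_torsion h𝒜 hs M.obj M.property (GrMod.isHomogeneous_ker φ.hom)
        ((isFdim_ker_iff h𝒜 φ.hom).1 h.1)
    · have : Module.FinitePresentation A N.obj.carrier := N.property
      exact h.2.finite inferInstance

end Torsion

/-! ### Both algebras satisfy the finiteness conditions. -/

theorem TruncAlg.isLocallyFinite (k : Type u) [Field k] (r : ℕ) :
    IsLocallyFinite (TruncAlg.grading k r) :=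
  ⟨TruncAlg.finite_grading k r, fun _ => TruncAlg.grading_eq_bot_of_neg k r⟩

theorem KQ.isLocallyFinite (k : Type u) [Field k] (r : ℕ) : IsLocallyFinite (KQ.grading k r) :=
  ⟨KQ.finite_grading, fun _ => PathAlgebra.grading_eq_bot_of_neg k⟩

theorem KQ.hasStrip (k : Type u) [Field k] (r : ℕ) : HasStrip (KQ.grading k r) :=
  ⟨KQ.X k r + KQ.Y k r, PathAlgebra.stripFirst k (KQ.firstWeight 1), add_mem KQ.X_mem KQ.Y_mem,
    KQ.stripFirst_X_add_Y, fun _ hi _ ha b => PathAlgebra.stripFirst_mul k _ hi ha b⟩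

/-- The first arrow is deleted in `kQ`, and `toTrunc`, which is right `B`-linear, leads back to `B`.
With weight `0` on the `y_i` the element `X` goes to `e`, and `toTrunc` sends `e` to `1`. -/
theorem TruncAlg.hasStrip (k : Type u) [Field k] (r : ℕ) : HasStrip (TruncAlg.grading k r) := by
  refine ⟨TruncAlg.x k r, KQ.toTrunc k r ∘ₗ PathAlgebra.stripFirst k (KQ.firstWeight 0) ∘ₗ
    (KQ.fromTrunc k r).toAlgHom.toLinearMap, TruncAlg.x_mem k r, ?_, ?_⟩
  · change KQ.toTrunc k r (PathAlgebra.stripFirst k _ (KQ.fromTrunc k r (TruncAlg.x k r))) = 1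
    rw [KQ.fromTrunc_x, KQ.stripFirst_X, KQ.toTrunc_idem_zero]
  · intro i hi a ha b
    change KQ.toTrunc k r (PathAlgebra.stripFirst k _ (KQ.fromTrunc k r (a * b))) =
      KQ.toTrunc k r (PathAlgebra.stripFirst k _ (KQ.fromTrunc k r a)) * b
    rw [map_mul, PathAlgebra.stripFirst_mul k _ hi (KQ.fromTrunc_mem ha),
      KQ.toTrunc_mul_fromTrunc]

/-- A `k`-linear map that commutes with `x` and `y` is linear over `k⟨x, y⟩ / (y^{r+1})`. -/
def TruncAlg.linearMapOfGens {k : Type u} [Field k] {r : ℕ} {M N : Type*} [AddCommGroup M]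
    [Module k M] [Module (TruncAlg k r) M] [IsScalarTower k (TruncAlg k r) M] [AddCommGroup N]
    [Module k N] [Module (TruncAlg k r) N] [IsScalarTower k (TruncAlg k r) N] (φ : M →ₗ[k] N)
    (hx : ∀ m, φ (TruncAlg.x k r • m) = TruncAlg.x k r • φ m)
    (hy : ∀ m, φ (TruncAlg.y k r • m) = TruncAlg.y k r • φ m) : M →ₗ[TruncAlg k r] N where
  toFun := φ
  map_add' := φ.map_add
  map_smul' b m := by
    rw [RingHom.id_apply]
    induction b using TruncAlg.induction generalizing m with
    | one => rw [one_smul, one_smul]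
    | x_mul b ih => rw [mul_smul, hx, ih, mul_smul]
    | y_mul b ih => rw [mul_smul, hy, ih, mul_smul]
    | add a b ha hb => rw [add_smul, map_add, ha, hb, add_smul]
    | smul c a ha => rw [smul_assoc, map_smul, ha, smul_assoc]

/-! ### The ideal `J` generated by `x` and the space `J ⊗ N`. -/

namespace KQ

section

variable (k : Type u) [Field k] (r : ℕ) (N : Type u) [AddCommGroup N] [Module k N]
  [Module (KQ k r) N] [IsScalarTower k (KQ k r) N]

/-- The subspace `e_1 N` of a `kQ`-module `N`. -/
def corner : Submodule k N :=
  LinearMap.eqLocus (Algebra.lsmul k k N (e k r 0)) LinearMap.id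

variable {N}

theorem mem_corner {n : N} : n ∈ corner k r N ↔ e k r 0 • n = n := Iff.rfl

theorem idem_smul_mem_corner (n : N) : e k r 0 • n ∈ corner k r N := by
  rw [mem_corner, smul_smul, idem_mul_idem_zero]

variable (N) in
/-- The projection of `N` to `e_1 N`. -/
def toCorner : N →ₗ[k] corner k r N :=
  (Algebra.lsmul k k N (e k r 0)).codRestrict _ (idem_smul_mem_corner k r)

theorem coe_toCorner (n : N) : (toCorner k r N n : N) = e k r 0 • n := rfl

theorem toCorner_coe (n : corner k r N) : toCorner k r N n = n := Subtype.ext n.2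

variable (N) in
/-- The space `(e_1 N)^{r+1}`, which is `J ⊗ N` for the ideal `J` of `B` generated by `x`: the
`t`-th coordinate `n` stands for `y^t x ⊗ n`. -/
def JTensor : Type u := Fin (r + 1) → corner k r N

namespace JTensor

instance : AddCommGroup (JTensor k r N) := inferInstanceAs (AddCommGroup (Fin (r + 1) → _))

instance : Module k (JTensor k r N) := inferInstanceAs (Module k (Fin (r + 1) → corner k r N))

variable (N) in
/-- The coordinates. -/
def coord (t : Fin (r + 1)) : JTensor k r N →ₗ[k] corner k r N :=
  LinearMap.proj (φ := fun _ : Fin (r + 1) => corner k r N) t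

variable (N) in
/-- The inclusion of a coordinate. -/
def single (t : Fin (r + 1)) : corner k r N →ₗ[k] JTensor k r N :=
  LinearMap.single k (fun _ : Fin (r + 1) => corner k r N) t

variable {k r} in
@[ext]
theorem ext {z w : JTensor k r N} (h : ∀ t, coord k r N t z = coord k r N t w) : z = w :=
  funext h

theorem coord_single_same (t : Fin (r + 1)) (n : corner k r N) :
    coord k r N t (single k r N t n) = n :=
  Pi.single_eq_same (M := fun _ : Fin (r + 1) => corner k r N) t n

theorem coord_single_of_ne {s t : Fin (r + 1)} (h : s ≠ t) (n : corner k r N) :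
    coord k r N s (single k r N t n) = 0 :=
  Pi.single_eq_of_ne (M := fun _ : Fin (r + 1) => corner k r N) h n

theorem sum_single (z : JTensor k r N) : ∑ t, single k r N t (coord k r N t z) = z :=
  Finset.univ_sum_single (M := fun _ : Fin (r + 1) => corner k r N) z

variable (N) in
/-- The multiplication map `J ⊗ N → N`. -/
def mul : JTensor k r N →ₗ[k] N :=
  ∑ t : Fin (r + 1), Algebra.lsmul k k N (Y k r ^ (t : ℕ) * X k r) ∘ₗ
    (corner k r N).subtype ∘ₗ coord k r N t

theorem mul_apply (z : JTensor k r N) :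
    mul k r N z = ∑ t : Fin (r + 1), (Y k r ^ (t : ℕ) * X k r) • (coord k r N t z : N) := by
  rw [mul, LinearMap.sum_apply]; rfl

theorem mul_single (t : Fin (r + 1)) (n : corner k r N) :
    mul k r N (single k r N t n) = (Y k r ^ (t : ℕ) * X k r) • (n : N) := by
  rw [mul_apply, Finset.sum_eq_single t]
  · rw [coord_single_same]
  · intro s _ hs
    rw [coord_single_of_ne k r hs, Submodule.coe_zero, smul_zero]
  · exact fun h => absurd (Finset.mem_univ _) h

variable (N) in
/-- The action of `x`. -/
def xEnd : Module.End k (JTensor k r N) := single k r N 0 ∘ₗ toCorner k r N ∘ₗ mul k r N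

variable (N) in
/-- The action of `y`. -/
def yEnd : Module.End k (JTensor k r N) :=
  ∑ t : Fin r, single k r N t.succ ∘ₗ coord k r N t.castSucc

theorem yEnd_apply (z : JTensor k r N) :
    yEnd k r N z = ∑ t : Fin r, single k r N t.succ (coord k r N t.castSucc z) := by
  simp [yEnd]

theorem yEnd_single_castSucc (t : Fin r) (n : corner k r N) :
    yEnd k r N (single k r N t.castSucc n) = single k r N t.succ n := by
  rw [yEnd_apply, Finset.sum_eq_single t]
  · rw [coord_single_same]
  · intro s _ hs
    rw [coord_single_of_ne k r fun h => hs (Fin.castSucc_injective r h), map_zero]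
  · exact fun h => absurd (Finset.mem_univ _) h

theorem yEnd_single_last (n : corner k r N) :
    yEnd k r N (single k r N (Fin.last r) n) = 0 := by
  rw [yEnd_apply]
  exact Finset.sum_eq_zero fun s _ => by
    rw [coord_single_of_ne k r (Fin.castSucc_lt_last s).ne, map_zero]

theorem yEnd_pow_single (l : ℕ) (t : Fin (r + 1)) (h : r < t + l) (n : corner k r N) :
    (yEnd k r N ^ l) (single k r N t n) = 0 := by
  induction l generalizing t with
  | zero => exact absurd h (by have := t.2; omega)
  | succ l ih =>
    rw [pow_succ, Module.End.mul_apply]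
    induction t using Fin.lastCases with
    | last => rw [yEnd_single_last, map_zero]
    | cast t =>
      rw [yEnd_single_castSucc]
      exact ih _ (by simp at h ⊢; omega)

theorem yEnd_pow : yEnd k r N ^ (r + 1) = 0 := by
  refine LinearMap.ext fun z => ?_
  rw [← sum_single k r z, map_sum]
  exact Finset.sum_eq_zero fun t _ => yEnd_pow_single k r _ t (by omega) _

variable (N) in
/-- The action of `B`. -/
def action : TruncAlg k r →ₐ[k] Module.End k (JTensor k r N) :=
  TruncAlg.lift k r (xEnd k r N) (yEnd k r N) (yEnd_pow k r)

instance : Module (TruncAlg k r) (JTensor k r N) :=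
  Module.compHom (JTensor k r N) (action k r N).toRingHom

theorem smul_def (b : TruncAlg k r) (z : JTensor k r N) : b • z = action k r N b z := rfl

instance : IsScalarTower k (TruncAlg k r) (JTensor k r N) :=
  ⟨fun c b z => by rw [smul_def, map_smul]; rfl⟩

variable {k r}

/-- In `J ⊗ N` one has `x (y^t x ⊗ n) = x ⊗ Y^t X n`, as `y^t x` moves across the tensor sign by the
right action of `kQ` on `J`. -/
theorem x_smul (z : JTensor k r N) :
    TruncAlg.x k r • z = single k r N 0 (toCorner k r N (mul k r N z)) := by
  rw [smul_def, action, TruncAlg.lift_x]; rfl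

theorem y_smul (z : JTensor k r N) : TruncAlg.y k r • z = yEnd k r N z := by
  rw [smul_def, action, TruncAlg.lift_y]

theorem y_smul_single_castSucc (t : Fin r) (n : corner k r N) :
    TruncAlg.y k r • single k r N t.castSucc n = single k r N t.succ n := by
  rw [y_smul, yEnd_single_castSucc]

theorem y_smul_single_last (n : corner k r N) :
    TruncAlg.y k r • single k r N (Fin.last r) n = 0 := by
  rw [y_smul, yEnd_single_last]

theorem y_pow_smul_single {l : ℕ} (h : l < r + 1) (n : corner k r N) :
    TruncAlg.y k r ^ l • single k r N 0 n = single k r N ⟨l, h⟩ n := by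
  induction l with
  | zero => rw [pow_zero, one_smul]; rfl
  | succ l ih =>
    rw [pow_succ', mul_smul, ih (by omega)]
    exact y_smul_single_castSucc ⟨l, by omega⟩ n

theorem X_smul_toCorner (n : N) : X k r • (toCorner k r N n : N) = X k r • n := by
  rw [coe_toCorner, smul_smul, X_mul_idem_zero]

theorem mul_smul' (b : TruncAlg k r) (z : JTensor k r N) :
    mul k r N (b • z) = fromTrunc k r b • mul k r N z := by
  induction b using TruncAlg.induction generalizing z with
  | one => rw [map_one, one_smul, one_smul]
  | x_mul b ih =>
    rw [mul_smul, x_smul, mul_single, ih, Fin.val_zero, pow_zero, one_mul, X_smul_toCorner,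
      map_mul, fromTrunc_x, mul_smul]
  | y_mul b ih =>
    rw [mul_smul, map_mul, mul_smul, ← ih, fromTrunc_y]
    generalize b • z = w
    rw [← sum_single k r w, Finset.smul_sum, map_sum, map_sum, Finset.smul_sum]
    refine Finset.sum_congr rfl fun t _ => ?_
    induction t using Fin.lastCases with
    -- The shift by `y` drops the last coordinate, which matches `Y ^ (r + 1) = 0` in `kQ`.
    | last =>
      rw [y_smul_single_last, map_zero, mul_single, smul_smul, ← mul_assoc, Fin.val_last,
        ← pow_succ', Y_pow, zero_mul, zero_smul]
    | cast t =>
      rw [y_smul_single_castSucc, mul_single, mul_single, smul_smul, ← mul_assoc, ← pow_succ']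
      rfl
  | add a b ha hb => rw [add_smul, map_add, ha, hb, map_add, add_smul]
  | smul c a ha => rw [smul_assoc, map_smul, ha, map_smul, smul_assoc]

/-- After multiplication by `x`, an element of `J ⊗ N` is known from its product in `N` alone. The
torsion estimates for `J ⊗ N` rest on this. -/
theorem x_smul_smul (b : TruncAlg k r) (z : JTensor k r N) : TruncAlg.x k r • b • z =
    single k r N 0 (toCorner k r N (fromTrunc k r b • mul k r N z)) := by
  rw [x_smul, mul_smul']

/-- Maps out of `J ⊗ N` commute with `y` if they do so on the coordinates. -/
theorem map_y_smul {M : Type*} [AddCommGroup M] [Module k M] [Module (TruncAlg k r) M]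
    (φ : JTensor k r N →ₗ[k] M)
    (hlt : ∀ (t : Fin r) n, φ (single k r N t.succ n) =
      TruncAlg.y k r • φ (single k r N t.castSucc n))
    (hlast : ∀ n, TruncAlg.y k r • φ (single k r N (Fin.last r) n) = 0) (z : JTensor k r N) :
    φ (TruncAlg.y k r • z) = TruncAlg.y k r • φ z := by
  rw [← sum_single k r z, Finset.smul_sum, map_sum, map_sum, Finset.smul_sum]
  refine Finset.sum_congr rfl fun t _ => ?_
  induction t using Fin.lastCases with
  | last => rw [y_smul_single_last, map_zero, hlast]
  | cast t => rw [y_smul_single_castSucc, hlt]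

variable {N' : Type u} [AddCommGroup N'] [Module k N'] [Module (KQ k r) N']
  [IsScalarTower k (KQ k r) N']

/-- The map induced on the corners. -/
def cornerMap (φ : N →ₗ[KQ k r] N') : corner k r N →ₗ[k] corner k r N' :=
  (φ.restrictScalars k).restrict fun n hn => by
    rw [mem_corner] at hn ⊢
    exact (φ.map_smul _ _).symm.trans (congrArg φ hn)

theorem cornerMap_toCorner (φ : N →ₗ[KQ k r] N') (n : N) :
    cornerMap φ (toCorner k r N n) = toCorner k r N' (φ n) :=
  Subtype.ext (φ.map_smul _ _)

/-- The `k`-linear map underlying `map`. -/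
def mapAux (φ : N →ₗ[KQ k r] N') : JTensor k r N →ₗ[k] JTensor k r N' :=
  LinearMap.pi fun t => cornerMap φ ∘ₗ coord k r N t

theorem mapAux_single (φ : N →ₗ[KQ k r] N') (t : Fin (r + 1)) (n : corner k r N) :
    mapAux φ (single k r N t n) = single k r N' t (cornerMap φ n) := by
  ext s
  by_cases h : s = t
  · subst h
    rw [coord_single_same]
    exact congrArg _ (congrArg (cornerMap φ) (coord_single_same k r s n))
  · rw [coord_single_of_ne k r h]
    exact congrArg _ ((congrArg (cornerMap φ) (coord_single_of_ne k r h n)).trans (map_zero _))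

theorem mul_mapAux (φ : N →ₗ[KQ k r] N') (z : JTensor k r N) :
    mul k r N' (mapAux φ z) = φ (mul k r N z) := by
  rw [mul_apply, mul_apply, map_sum]
  exact Finset.sum_congr rfl fun t _ => (φ.map_smul _ _).symm

/-- The map `J ⊗ N → J ⊗ N'` induced by a map `N → N'`. -/
def map (φ : N →ₗ[KQ k r] N') : JTensor k r N →ₗ[TruncAlg k r] JTensor k r N' :=
  TruncAlg.linearMapOfGens (mapAux φ)
    (fun z => by rw [x_smul, x_smul, mapAux_single, cornerMap_toCorner, mul_mapAux])
    (map_y_smul _ (fun t n => by rw [mapAux_single, mapAux_single, y_smul_single_castSucc])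
      fun n => by rw [mapAux_single, y_smul_single_last])

theorem map_single (φ : N →ₗ[KQ k r] N') (t : Fin (r + 1)) (n : corner k r N) :
    map φ (single k r N t n) = single k r N' t (cornerMap φ n) := mapAux_single φ t n

theorem mul_map (φ : N →ₗ[KQ k r] N') (z : JTensor k r N) :
    mul k r N' (map φ z) = φ (mul k r N z) := mul_mapAux φ z

/-! ### Finite presentation -/

variable (k r) in
/-- The generators of the free `B`-module `J`. -/
def selfMap : (Fin (r + 1) → TruncAlg k r) →ₗ[TruncAlg k r] JTensor k r (KQ k r) :=
  Fintype.linearCombination (TruncAlg k r)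
    fun j : Fin (r + 1) => single k r (KQ k r) 0 (toCorner k r (KQ k r) (Y k r ^ (j : ℕ)))

theorem selfMap_apply (b : Fin (r + 1) → TruncAlg k r) : selfMap k r b =
    ∑ j, b j • single k r (KQ k r) 0 (toCorner k r (KQ k r) (Y k r ^ (j : ℕ))) := by
  rw [selfMap, Fintype.linearCombination_apply]

/-- In `kQ` the image becomes `∑ f(b_j) X Y^j`. Deleting `i` letters `y` and one `x` from the right
recovers `f(b_i)`, and `f` is injective. -/
theorem selfMap_injective : Function.Injective (selfMap k r) := by
  rw [injective_iff_map_eq_zero]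
  intro b hb
  have h : ∑ j, fromTrunc k r (b j) * (X k r * Y k r ^ (j : ℕ)) = 0 := by
    have h := congrArg (mul k r (KQ k r)) hb
    rw [selfMap_apply, map_sum, map_zero] at h
    rw [← h]
    refine Finset.sum_congr rfl fun j _ => ?_
    rw [mul_smul', mul_single, Fin.val_zero, pow_zero, one_mul, X_smul_toCorner]
    rfl
  funext i
  let σ := PathAlgebra.stripLast k (lastWeight (r := r) (1 : k) 0) ∘ₗ
    (PathAlgebra.stripLast k (lastWeight (r := r) (0 : k) 1)) ^ (i : ℕ)
  have h2 : ∀ j : Fin (r + 1), σ (fromTrunc k r (b j) * (X k r * Y k r ^ (j : ℕ))) =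
      if (i : ℕ) = j then fromTrunc k r (b j) else 0 := fun j => by
    rw [← stripLast_pow_mul_X_Y_pow _ _ _ (Nat.lt_succ_iff.1 j.2), LinearMap.comp_apply,
      Module.End.pow_apply]
  have h1 := congrArg σ h
  rw [map_sum, Finset.sum_congr rfl fun j _ => h2 j, map_zero, Finset.sum_eq_single i,
    if_pos rfl] at h1
  · exact fromTrunc_injective (h1.trans (map_zero _).symm)
  · exact fun j _ hj => if_neg fun h => hj (Fin.ext h.symm)
  · exact fun h => absurd (Finset.mem_univ _) h

/-- The element stands for `x w`. If `w = y^l x v`, then `x w = (x y^l)(x v)` with `v` shorter than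
`w`; if `w = y^l`, it is a generator or zero. -/
theorem single_toCorner_mem_range (w : List (Fin 2)) :
    single k r (KQ k r) 0 (toCorner k r (KQ k r) (fromTrunc k r (TruncAlg.word k r w))) ∈
      LinearMap.range (selfMap k r) := by
  induction hn : w.length using Nat.strong_induction_on generalizing w with
  | _ n ih =>
  rcases TruncAlg.word_eq_y_pow_or k r w with h | ⟨l, v, hv, h⟩
  · rw [h]
    by_cases hw : w.length < r + 1
    · refine ⟨Pi.single ⟨w.length, hw⟩ 1, ?_⟩
      rw [selfMap, Fintype.linearCombination_apply_single, one_smul,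
        map_pow (fromTrunc k r), fromTrunc_y]
    · rw [TruncAlg.y_pow_of_lt k r (by omega), map_zero, map_zero, map_zero]
      exact zero_mem _
  · rw [h]
    by_cases hl : l < r + 1
    · have h1 := ih v.length (by omega) v rfl
      convert Submodule.smul_mem _ (TruncAlg.x k r * TruncAlg.y k r ^ l) h1 using 1
      rw [mul_smul, x_smul_smul, mul_single, Fin.val_zero, pow_zero, one_mul, X_smul_toCorner,
        map_mul (fromTrunc k r), map_mul (fromTrunc k r), fromTrunc_x, map_pow (fromTrunc k r),
        fromTrunc_y]
      rfl
    · rw [TruncAlg.y_pow_of_lt k r (by omega), zero_mul, map_zero, map_zero, map_zero]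
      exact zero_mem _

theorem selfMap_surjective : Function.Surjective (selfMap k r) := by
  have h0 : ∀ n, single k r (KQ k r) 0 n ∈ LinearMap.range (selfMap k r) := by
    intro n
    have hn : n = toCorner k r (KQ k r) (fromTrunc k r (toTrunc k r (n : KQ k r))) :=
      (toCorner_coe k r n).symm.trans (Subtype.ext (idem_zero_mul _))
    rw [hn]
    clear hn
    generalize toTrunc k r (n : KQ k r) = b
    induction b using DirectSum.Decomposition.inductionOn (TruncAlg.grading k r) with
    | zero => rw [map_zero, map_zero, map_zero]; exact zero_mem _
    | add a b ha hb => rw [map_add, map_add, map_add]; exact add_mem ha hb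
    | homogeneous b =>
      refine TruncAlg.grading_induction k r
        (P := fun b => single k r (KQ k r) 0 (toCorner k r (KQ k r) (fromTrunc k r b)) ∈
          LinearMap.range (selfMap k r)) (fun w _ => single_toCorner_mem_range w) ?_
        (fun a b ha hb => ?_) (fun c a ha => ?_) b.2
      · rw [map_zero, map_zero, map_zero]; exact zero_mem _
      · rw [map_add, map_add, map_add]; exact add_mem ha hb
      · rw [map_smul, map_smul, map_smul]; exact Submodule.smul_of_tower_mem _ c ha
  intro z
  rw [← sum_single k r z]
  refine Submodule.sum_mem (LinearMap.range (selfMap k r)) fun t _ => ?_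
  have h := y_pow_smul_single t.2 (coord k r (KQ k r) t z)
  exact h ▸ Submodule.smul_mem _ _ (h0 _)

instance : Module.FinitePresentation (TruncAlg k r) (JTensor k r (KQ k r)) :=
  .of_equiv (LinearEquiv.ofBijective (selfMap k r) ⟨selfMap_injective, selfMap_surjective⟩)

instance (n : ℕ) : Module.FinitePresentation (TruncAlg k r) (JTensor k r (Fin n → KQ k r)) := by
  refine .of_equiv (LinearEquiv.ofBijective
    (LinearMap.pi fun i : Fin n => map (N := Fin n → KQ k r)
      (LinearMap.proj (R := KQ k r) (φ := fun _ => KQ k r) i)) ⟨?_, ?_⟩).symm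
  · intro z w h
    refine JTensor.ext fun t => Subtype.ext (funext fun i => ?_)
    exact congrArg (fun z => (coord k r (KQ k r) t z : KQ k r)) (congrFun h i)
  · intro w
    refine ⟨fun t => ⟨fun i => coord k r (KQ k r) t (w i), ?_⟩, rfl⟩
    exact funext fun i => (coord k r (KQ k r) t (w i)).2

theorem map_surjective {φ : N →ₗ[KQ k r] N'} (h : Function.Surjective φ) :
    Function.Surjective (map φ) := by
  intro z
  choose n hn using fun t => h (coord k r N' t z : N')
  refine ⟨fun t => toCorner k r N (n t), JTensor.ext fun t => ?_⟩
  refine (cornerMap_toCorner φ (n t)).trans ?_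
  rw [hn, toCorner_coe]

/-- Passing to `e N` is exact: a preimage of an element fixed by `e` may be replaced by its product
with `e`. -/
theorem ker_map_le {N'' : Type u} [AddCommGroup N''] [Module k N''] [Module (KQ k r) N'']
    [IsScalarTower k (KQ k r) N''] {ψ : N'' →ₗ[KQ k r] N} {φ : N →ₗ[KQ k r] N'}
    (h : Function.Exact ψ φ) : LinearMap.ker (map φ) = LinearMap.range (map ψ) := by
  ext z
  constructor
  · intro hz
    have hz' : ∀ t, φ (coord k r N t z) = 0 := fun t =>
      congrArg (fun z => (coord k r N' t z : N')) hz
    choose n hn using fun t => (h _).1 (hz' t)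
    refine ⟨fun t => toCorner k r N'' (n t), JTensor.ext fun t => ?_⟩
    refine (cornerMap_toCorner ψ (n t)).trans ?_
    rw [hn, toCorner_coe]
  · rintro ⟨w, rfl⟩
    refine JTensor.ext fun t => Subtype.ext ?_
    exact (h _).2 ⟨_, rfl⟩

theorem finitePresentation (hN : Module.FinitePresentation (KQ k r) N) :
    Module.FinitePresentation (TruncAlg k r) (JTensor k r N) := by
  obtain ⟨n, m, φ, ψ, hφ, hψ⟩ := hN.exists_fin'
  refine Module.finitePresentation_of_surjective (map φ) (map_surjective hφ) ?_
  rw [ker_map_le hψ, LinearMap.range_eq_map]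
  exact (Module.Finite.fg_top (R := TruncAlg k r) (M := JTensor k r (Fin m → KQ k r))).map _

end JTensor

end

end KQ

/-! ### Tensor products over `B`: universal property and finite presentation. -/

namespace BaseChange

variable {k B D : Type u} [Field k] [Ring B] [Algebra k B] [Ring D] [Algebra k D] (f : B →ₐ[k] D)
  {M : Type u} [AddCommGroup M] [Module k M] [Module B M]

@[elab_as_elim]
theorem induction_on {P : BaseChange f M → Prop} (z : BaseChange f M)
    (tmul : ∀ d m, P (tmul f d m)) (add : ∀ z w, P z → P w → P (z + w)) : P z := by
  obtain ⟨z, rfl⟩ := Submodule.Quotient.mk_surjective _ z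
  induction z using TensorProduct.induction_on with
  | zero =>
    have h := tmul 0 0
    rwa [BaseChange.tmul, TensorProduct.tmul_zero] at h
  | tmul d m => exact tmul d m
  | add z w hz hw => exact add _ _ hz hw

theorem balance (d : D) (b : B) (m : M) : tmul f (d * f b) m = tmul f d (b • m) :=
  (Submodule.Quotient.eq _).2 (Submodule.subset_span ⟨d, b, m, rfl⟩)

theorem smul_one_tmul (b : B) (m : M) : f b • tmul f 1 m = tmul f 1 (b • m) := by
  rw [smul_tmul, ← balance, mul_one, one_mul]

theorem tmul_eq_smul (d : D) (m : M) : tmul f d m = d • tmul f 1 m := by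
  rw [smul_tmul, mul_one]

theorem tmul_add (d : D) (m m' : M) : tmul f d (m + m') = tmul f d m + tmul f d m' :=
  map_add (tmulBilin f M d) m m'

theorem tmul_zero (d : D) : tmul f d (0 : M) = 0 := map_zero (tmulBilin f M d)

theorem add_tmul (d d' : D) (m : M) : tmul f (d + d') m = tmul f d m + tmul f d' m :=
  LinearMap.map_add₂ (tmulBilin f M) d d' m

theorem smul_tmul_base (c : k) (d : D) (m : M) : tmul f (c • d) m = c • tmul f d m :=
  LinearMap.map_smul₂ (tmulBilin f M) c d m

theorem tmul_sum {ι : Type*} (s : Finset ι) (d : D) (m : ι → M) :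
    tmul f d (∑ i ∈ s, m i) = ∑ i ∈ s, tmul f d (m i) :=
  map_sum (tmulBilin f M d) m s

variable {N : Type u} [AddCommGroup N] [Module k N] [Module D N] [IsScalarTower k D N]

/-- The `D`-linear map `d ⊗ m ↦ d s(m)` given by a map `s` that is linear along `f`. -/
def lift (s : M →ₗ[k] N) (hs : ∀ (b : B) (m : M), s (b • m) = f b • s m) :
    BaseChange f M →ₗ[D] N :=
  (balanced f M).liftQ
    (TensorProduct.AlgebraTensorModule.lift (LinearMap.toSpanSingleton D (M →ₗ[k] N) s)) (by
      rw [balanced, Submodule.span_le]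
      rintro _ ⟨d, b, m, rfl⟩
      rw [SetLike.mem_coe, LinearMap.mem_ker, map_sub, sub_eq_zero,
        TensorProduct.AlgebraTensorModule.lift_tmul, TensorProduct.AlgebraTensorModule.lift_tmul]
      simp [hs, mul_smul])

theorem lift_tmul (s : M →ₗ[k] N) (hs : ∀ (b : B) (m : M), s (b • m) = f b • s m) (d : D) (m : M) :
    lift f s hs (tmul f d m) = d • s m := by
  change TensorProduct.AlgebraTensorModule.lift
    (LinearMap.toSpanSingleton D (M →ₗ[k] N) s) (d ⊗ₜ m) = _
  rw [TensorProduct.AlgebraTensorModule.lift_tmul]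
  rfl

/-- Base change preserves finite presentation. -/
theorem finitePresentation [IsScalarTower k B M] (hM : Module.FinitePresentation B M) :
    Module.FinitePresentation D (BaseChange f M) := by
  obtain ⟨n, m, π, g, hπ, hg⟩ := hM.exists_fin'
  let fn : (Fin n → B) →ₗ[k] (Fin n → D) :=
    LinearMap.pi fun i => f.toLinearMap ∘ₗ LinearMap.proj i
  have hfn : ∀ b v, fn (b • v) = f b • fn v := fun b v => funext fun i => map_mul f b (v i)
  -- `R` is generated by the images in `D^n` of the defining relations of `M`; the aim is `D ⊗_B M =
  -- D^n / R`.
  let R : Submodule D (Fin n → D) := Submodule.span D (Set.range fun i : Fin m =>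
    fn (g (Pi.single i 1)))
  have hR : ∀ u, fn (g u) ∈ R := by
    intro u
    rw [LinearMap.pi_apply_eq_sum_univ g u, map_sum]
    refine Submodule.sum_mem _ fun i _ => ?_
    rw [hfn]
    refine Submodule.smul_mem _ _ (Submodule.subset_span ⟨i, ?_⟩)
    have h2 : (fun j => if i = j then (1 : B) else 0) = Pi.single i 1 :=
      funext fun j => by rw [Pi.single_apply]; exact if_congr eq_comm rfl rfl
    exact congrArg (fun u => fn (g u)) h2.symm
  let s' : ((Fin n → B) ⧸ (LinearMap.ker π).restrictScalars k) →ₗ[k] (Fin n → D) ⧸ R :=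
    ((LinearMap.ker π).restrictScalars k).liftQ (R.mkQ.restrictScalars k ∘ₗ fn) (by
      intro v hv
      obtain ⟨u, rfl⟩ := (hg v).1 hv
      exact (Submodule.Quotient.mk_eq_zero R).2 (hR u))
  let s : M →ₗ[k] (Fin n → D) ⧸ R :=
    s' ∘ₗ ((LinearMap.quotKerEquivOfSurjective π hπ).restrictScalars k).symm.toLinearMap
  have hs : ∀ v, s (π v) = R.mkQ (fn v) := by
    intro v
    have h : ((LinearMap.quotKerEquivOfSurjective π hπ).restrictScalars k).symm (π v) =
        Submodule.Quotient.mk v :=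
      (LinearMap.quotKerEquivOfSurjective π hπ).symm_apply_eq.2 rfl
    change s' _ = _
    erw [h]
    rfl
  have hs' : ∀ (b : B) (m : M), s (b • m) = f b • s m := by
    intro b m
    obtain ⟨v, rfl⟩ := hπ m
    rw [← map_smul, hs, hs, hfn, map_smul]
  let ρ : (Fin n → D) →ₗ[D] BaseChange f M :=
    Fintype.linearCombination D fun i => tmul f 1 (π (Pi.single i 1))
  have hρ : ∀ v, ρ v = ∑ i, v i • tmul f 1 (π (Pi.single i 1)) := fun v =>
    Fintype.linearCombination_apply D _ v
  have hρfn : ∀ v, ρ (fn v) = tmul f 1 (π v) := by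
    intro v
    rw [hρ]
    conv_rhs => rw [LinearMap.pi_apply_eq_sum_univ π v]
    rw [tmul_sum]
    refine Finset.sum_congr rfl fun i _ => ?_
    have h2 : (fun j => if i = j then (1 : B) else 0) = Pi.single i 1 :=
      funext fun j => by rw [Pi.single_apply]; exact if_congr eq_comm rfl rfl
    rw [h2, ← smul_one_tmul]
    rfl
  refine Module.finitePresentation_of_free_of_surjective ρ ?_ ?_
  · intro z
    induction z using induction_on with
    | tmul d m =>
      obtain ⟨v, rfl⟩ := hπ m
      exact ⟨d • fn v, by rw [map_smul, hρfn, tmul_eq_smul f d]⟩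
    | add z w hz hw =>
      obtain ⟨v, rfl⟩ := hz
      obtain ⟨v', rfl⟩ := hw
      exact ⟨v + v', map_add _ _ _⟩
  · have hker : LinearMap.ker ρ = R := by
      refine le_antisymm (fun v hv => ?_) (Submodule.span_le.2 ?_)
      -- The map `lift f s hs'` undoes `ρ` modulo `R`, so the kernel of `ρ` is contained in `R`.
      · have h1 : lift f s hs' (ρ v) = R.mkQ v := by
          rw [hρ, map_sum]
          conv_rhs => rw [LinearMap.pi_apply_eq_sum_univ R.mkQ v]
          refine Finset.sum_congr rfl fun i _ => ?_
          rw [map_smul, lift_tmul, one_smul, hs]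
          congr 2
          funext j
          change f ((Pi.single i 1 : Fin n → B) j) = _
          rw [Pi.single_apply]
          by_cases h : j = i
          · rw [if_pos h, if_pos h.symm, map_one]
          · rw [if_neg h, if_neg (Ne.symm h), map_zero]
        rw [LinearMap.mem_ker.1 hv, map_zero] at h1
        exact (Submodule.Quotient.mk_eq_zero R).1 h1.symm
      · rintro _ ⟨i, rfl⟩
        rw [SetLike.mem_coe, LinearMap.mem_ker, hρfn, (hg _).2 ⟨_, rfl⟩, tmul_zero]
    rw [hker]
    exact Submodule.fg_span (Set.finite_range _)

end BaseChange

namespace KQ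

variable {k : Type u} [Field k] {r : ℕ}

open JTensor

/-! ### The functor `J ⊗ -` -/

section JFunctor

theorem Y_pow_mul_X_mem (t : ℕ) : Y k r ^ t * X k r ∈ grading k r (t + 1) := by
  have h : Y k r ^ t ∈ grading k r t := by simpa using SetLike.pow_mem_graded t (Y_mem (k := k))
  exact SetLike.mul_mem_graded h X_mem

theorem idem_smul_mem (N : GrMod (grading k r)) {i : ℤ} {n : N.carrier} (hn : n ∈ N.deg i) :
    e k r 0 • n ∈ N.deg i := by
  have h := N.smul_mem (PathAlgebra.idem_mem k (.mk 0)) hn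
  rwa [zero_add] at h

/-- The degree `i` part of `J ⊗ N`. -/
def jDeg (N : GrMod (grading k r)) (i : ℤ) : Submodule k (JTensor k r N.carrier) :=
  -- The `t`-th coordinate is shifted by `t + 1`, the degree of `y^t x`.
  ⨅ t : Fin (r + 1), (N.deg (i - (t : ℕ) - 1)).comap ((corner k r N.carrier).subtype ∘ₗ coord k r _ t)

theorem mem_jDeg {N : GrMod (grading k r)} {i : ℤ} {z : JTensor k r N.carrier} :
    z ∈ jDeg N i ↔ ∀ t : Fin (r + 1), (coord k r _ t z : N.carrier) ∈ N.deg (i - (t : ℕ) - 1) := by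
  simp only [jDeg, Submodule.mem_iInf]; rfl

theorem single_mem_jDeg {N : GrMod (grading k r)} {i j : ℤ} {t : Fin (r + 1)}
    (h : j + (t : ℕ) + 1 = i) {n : corner k r N.carrier} (hn : (n : N.carrier) ∈ N.deg j) :
    single k r _ t n ∈ jDeg N i := by
  rw [mem_jDeg]
  intro s
  by_cases hs : s = t
  · subst hs
    rw [coord_single_same]
    convert hn using 2
    omega
  · rw [coord_single_of_ne k r hs]; exact zero_mem _

theorem mul_mem_deg {N : GrMod (grading k r)} {i : ℤ} {z : JTensor k r N.carrier}
    (hz : z ∈ jDeg N i) : mul k r _ z ∈ N.deg i := by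
  rw [mul_apply]
  refine Submodule.sum_mem _ fun t _ => ?_
  convert N.smul_mem (Y_pow_mul_X_mem (k := k) t) (mem_jDeg.1 hz t) using 2
  omega

theorem x_smul_mem_jDeg {N : GrMod (grading k r)} {i : ℤ} {z : JTensor k r N.carrier}
    (hz : z ∈ jDeg N i) : TruncAlg.x k r • z ∈ jDeg N (1 + i) := by
  rw [x_smul]
  exact single_mem_jDeg (by simp; omega) (idem_smul_mem N (mul_mem_deg hz))

theorem y_smul_mem_jDeg {N : GrMod (grading k r)} {i : ℤ} {z : JTensor k r N.carrier}
    (hz : z ∈ jDeg N i) : TruncAlg.y k r • z ∈ jDeg N (1 + i) := by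
  rw [y_smul, yEnd_apply]
  refine Submodule.sum_mem _ fun t _ => single_mem_jDeg ?_ (mem_jDeg.1 hz t.castSucc)
  simp
  omega

theorem smul_mem_jDeg {N : GrMod (grading k r)} {i j : ℤ} {b : TruncAlg k r}
    {z : JTensor k r N.carrier} (hb : b ∈ TruncAlg.grading k r i) (hz : z ∈ jDeg N j) :
    b • z ∈ jDeg N (i + j) := by
  refine TruncAlg.grading_induction k r (P := fun b => b • z ∈ jDeg N (i + j)) (fun w hw => ?_)
    ?_ (fun a b ha hb => ?_) (fun c a ha => ?_) hb
  · subst hw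
    clear hb
    induction w with
    | nil => simpa using hz
    | cons a w ih =>
      rw [List.length_cons, Nat.cast_succ, add_comm (w.length : ℤ), add_assoc]
      fin_cases a
      · have h := x_smul_mem_jDeg ih
        rwa [smul_smul, ← TruncAlg.word_cons_zero] at h
      · have h := y_smul_mem_jDeg ih
        rwa [smul_smul, ← TruncAlg.word_cons_one] at h
  · rw [zero_smul]; exact zero_mem _
  · rw [add_smul]; exact add_mem ha hb
  · rw [smul_assoc]; exact Submodule.smul_mem _ c ha

theorem isInternal_jDeg (N : GrMod (grading k r)) : DirectSum.IsInternal (jDeg N) := by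
  have h := N.isInternal
  rw [DirectSum.isInternal_submodule_iff_iSupIndep_and_iSup_eq_top] at h ⊢
  constructor
  · rw [iSupIndep_def]
    intro i
    rw [Submodule.disjoint_def]
    intro z hz hz'
    refine JTensor.ext fun t => Subtype.ext ?_
    have h1 := iSupIndep_def.1 h.1 (i - (t : ℕ) - 1)
    rw [Submodule.disjoint_def] at h1
    refine h1 _ (mem_jDeg.1 hz t) ?_
    have hle : (⨆ (j) (_ : j ≠ i), jDeg N j) ≤
        (⨆ (j) (_ : j ≠ i - (t : ℕ) - 1), N.deg j).comap
          ((corner k r N.carrier).subtype ∘ₗ coord k r _ t) := by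
      refine iSup₂_le fun j hj w hw => ?_
      exact Submodule.mem_iSup_of_mem (j - (t : ℕ) - 1) (Submodule.mem_iSup_of_mem (by omega)
        (mem_jDeg.1 hw t))
    exact hle hz'
  · rw [eq_top_iff]
    intro z _
    rw [← sum_single k r z]
    refine Submodule.sum_mem _ fun t _ => ?_
    rw [← toCorner_coe k r (coord k r _ t z)]
    generalize (coord k r _ t z : N.carrier) = n
    induction n using GrMod.induction with
    | homogeneous i n hn =>
      exact Submodule.mem_iSup_of_mem (i + (t : ℕ) + 1)
        (single_mem_jDeg rfl (idem_smul_mem N hn))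
    | add n n' h h' => rw [map_add, map_add]; exact add_mem h h'

variable (k r) in
/-- The functor `J ⊗ -` from graded `kQ`-modules to graded `B`-modules. -/
def jFunctor : GrMod (grading k r) ⥤ GrMod (TruncAlg.grading k r) where
  obj N :=
    { carrier := JTensor k r N.carrier
      deg := jDeg N
      smul_mem := smul_mem_jDeg
      isInternal := isInternal_jDeg N }
  map φ := ⟨JTensor.map φ.toLin, fun hz => mem_jDeg.2 fun t => φ.map_deg (mem_jDeg.1 hz t)⟩
  map_id _ := rfl
  map_comp _ _ := rfl

end JFunctor

/-! ### The maps `D ⊗ M → M` and `J ⊗ (D ⊗ M) → M` -/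

section Unit

variable {M : Type u} [AddCommGroup M] [Module k M] [Module (TruncAlg k r) M]

/-- The element `1 ⊗ m` of `kQ ⊗_B M`. -/
abbrev unit (m : M) : BaseChange (fromTrunc k r).toAlgHom M :=
  BaseChange.tmul (fromTrunc k r).toAlgHom 1 m

theorem fromTrunc_smul_unit (b : TruncAlg k r) (m : M) :
    fromTrunc k r b • unit (k := k) (r := r) m = unit (b • m) :=
  BaseChange.smul_one_tmul (fromTrunc k r).toAlgHom b m

variable [IsScalarTower k (TruncAlg k r) M]

variable (k r M) in
/-- The linear map `d ⊗ m ↦ λ(d) m`, where `λ : kQ → B` deletes the paths that do not start at the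
first vertex. -/
def retract : BaseChange (fromTrunc k r).toAlgHom M →ₗ[k] M :=
  ((balanced (fromTrunc k r).toAlgHom M).restrictScalars k).liftQ
    (TensorProduct.lift ((Algebra.lsmul k k M).toLinearMap ∘ₗ toTrunc k r)) (by
      intro z hz
      rw [LinearMap.mem_ker]
      -- `balanced` is a `kQ`-span and `toTrunc` is not left linear, so the induction has to carry
      -- an arbitrary left factor `c`.
      suffices h : ∀ c : KQ k r, TensorProduct.lift
          ((Algebra.lsmul k k M).toLinearMap ∘ₗ toTrunc k r) (c • z) = 0 by simpa using h 1
      replace hz : z ∈ balanced (fromTrunc k r).toAlgHom M := hz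
      induction hz using Submodule.span_induction with
      | mem z hz =>
        obtain ⟨d, b, m, rfl⟩ := hz
        intro c
        rw [smul_sub, map_sub, sub_eq_zero, TensorProduct.smul_tmul', TensorProduct.smul_tmul',
          TensorProduct.lift.tmul, TensorProduct.lift.tmul, smul_eq_mul, smul_eq_mul, ← mul_assoc]
        change toTrunc k r (c * d * fromTrunc k r b) • m = toTrunc k r (c * d) • b • m
        rw [toTrunc_mul_fromTrunc, mul_smul]
      | zero => simp
      | add x y _ _ hx hy => intro c; rw [smul_add, map_add, hx, hy, add_zero]
      | smul a x _ hx => intro c; rw [← mul_smul]; exact hx _)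

theorem retract_tmul (d : KQ k r) (m : M) :
    retract k r M (BaseChange.tmul _ d m) = toTrunc k r d • m := rfl

theorem retract_unit (m : M) : retract k r M (unit m) = m := by
  rw [retract_tmul, toTrunc_one, one_smul]

theorem retract_idem_smul (z : BaseChange (fromTrunc k r).toAlgHom M) :
    retract k r M (e k r 0 • z) = retract k r M z := by
  induction z using BaseChange.induction_on with
  | tmul d m => rw [BaseChange.smul_tmul, retract_tmul, retract_tmul, toTrunc_idem_mul]
  | add z w hz hw => rw [smul_add, map_add, map_add, hz, hw]

/-- This is `X_mul` for modules: multiplication by `X` carries `kQ ⊗_B M` into the elements `1 ⊗ m`.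
-/
theorem X_smul_eq (z : BaseChange (fromTrunc k r).toAlgHom M) :
    X k r • z = unit (TruncAlg.x k r • retract k r M z) := by
  induction z using BaseChange.induction_on with
  | tmul d m =>
    rw [BaseChange.smul_tmul, X_mul, retract_tmul, BaseChange.tmul_eq_smul]
    exact (fromTrunc_smul_unit _ _).trans (by rw [mul_smul])
  | add z w hz hw =>
    rw [smul_add, map_add, smul_add, hz, hw]
    exact (BaseChange.tmul_add _ _ _ _).symm

theorem Y_pow_X_smul_eq (t : ℕ) (z : BaseChange (fromTrunc k r).toAlgHom M) :
    (Y k r ^ t * X k r) • z =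
      unit ((TruncAlg.y k r ^ t * TruncAlg.x k r) • retract k r M z) := by
  rw [mul_smul, X_smul_eq, mul_smul, ← fromTrunc_smul_unit (TruncAlg.y k r ^ t),
    map_pow (fromTrunc k r), fromTrunc_y]

theorem retract_map {M' : Type u} [AddCommGroup M'] [Module k M'] [Module (TruncAlg k r) M']
    [IsScalarTower k (TruncAlg k r) M'] (φ : M →ₗ[TruncAlg k r] M')
    (ψ : BaseChange (fromTrunc k r).toAlgHom M →ₗ[KQ k r]
      BaseChange (fromTrunc k r).toAlgHom M')
    (hψ : ∀ d m, ψ (BaseChange.tmul _ d m) = BaseChange.tmul _ d (φ m))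
    (z : BaseChange (fromTrunc k r).toAlgHom M) :
    retract k r M' (ψ z) = φ (retract k r M z) := by
  induction z using BaseChange.induction_on with
  | tmul d m => rw [hψ, retract_tmul, retract_tmul, map_smul]
  | add z w hz hw => simp only [map_add, hz, hw]

/-- Each product `y^t x · z` has the form `1 ⊗ m`, and `m` is recovered by `retract` by
`retract_unit`. So multiplication takes `J ⊗ (kQ ⊗_B M)` into the copy of `M` in `kQ ⊗_B M`. -/
theorem mul_eq_unit (z : JTensor k r (BaseChange (fromTrunc k r).toAlgHom M)) :
    mul k r _ z = unit (retract k r M (mul k r _ z)) := by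
  have h : ∀ t : Fin (r + 1), (Y k r ^ (t : ℕ) * X k r) •
      (coord k r _ t z : BaseChange (fromTrunc k r).toAlgHom M) = unit _ :=
    fun t => Y_pow_X_smul_eq t _
  rw [mul_apply, Finset.sum_congr rfl fun t _ => h t,
    ← BaseChange.tmul_sum (fromTrunc k r).toAlgHom, retract_unit]

theorem retract_mul_single (t : Fin (r + 1))
    (n : corner k r (BaseChange (fromTrunc k r).toAlgHom M)) :
    retract k r M (mul k r _ (single k r _ t n)) =
      (TruncAlg.y k r ^ (t : ℕ) * TruncAlg.x k r) • retract k r M n := by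
  rw [mul_single, Y_pow_X_smul_eq, retract_unit]

variable (k r M) in
/-- The multiplication map `J ⊗ (kQ ⊗_B M) → M`. -/
def jCounit : JTensor k r (BaseChange (fromTrunc k r).toAlgHom M) →ₗ[TruncAlg k r] M :=
  TruncAlg.linearMapOfGens (retract k r M ∘ₗ mul k r _)
    (fun z => by
      rw [LinearMap.comp_apply, LinearMap.comp_apply, x_smul, retract_mul_single, Fin.val_zero,
        pow_zero, one_mul, coe_toCorner, retract_idem_smul])
    (map_y_smul _
      (fun t n => by
        rw [LinearMap.comp_apply, LinearMap.comp_apply, retract_mul_single, retract_mul_single,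
          smul_smul, ← mul_assoc, ← pow_succ']
        rfl)
      (fun n => by
        rw [LinearMap.comp_apply, retract_mul_single, smul_smul, ← mul_assoc, ← pow_succ',
          Fin.val_last, TruncAlg.y_pow, zero_mul, zero_smul]))

theorem jCounit_apply (z : JTensor k r (BaseChange (fromTrunc k r).toAlgHom M)) :
    jCounit k r M z = retract k r M (mul k r _ z) := rfl

end Unit

/-! ### The map `D ⊗ (J ⊗ N) → N` -/

section Counit

variable {N : Type u} [AddCommGroup N] [Module k N] [Module (KQ k r) N]
  [IsScalarTower k (KQ k r) N]

variable (k r N) in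
/-- The multiplication map `kQ ⊗_B (J ⊗ N) → N`. -/
def dCounit : BaseChange (fromTrunc k r).toAlgHom (JTensor k r N) →ₗ[KQ k r] N :=
  BaseChange.lift _ (mul k r N) mul_smul'

theorem dCounit_tmul (d : KQ k r) (z : JTensor k r N) :
    dCounit k r N (BaseChange.tmul _ d z) = d • mul k r N z :=
  BaseChange.lift_tmul _ _ mul_smul' d z

/-- On `d ⊗ z` both sides stand for `x ⊗ d · mul z`, by `idem_zero_mul`. Combined with `X_smul_eq`,
it shows that `X` kills the kernel of `dCounit`. -/
theorem x_smul_retract (z : BaseChange (fromTrunc k r).toAlgHom (JTensor k r N)) :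
    TruncAlg.x k r • retract k r (JTensor k r N) z =
      single k r N 0 (toCorner k r N (dCounit k r N z)) := by
  induction z using BaseChange.induction_on with
  | tmul d n =>
    rw [retract_tmul, x_smul_smul, dCounit_tmul]
    congr 1
    refine Subtype.ext ?_
    rw [coe_toCorner, coe_toCorner, smul_smul, smul_smul, ← idem_zero_mul]
  | add z w hz hw => simp only [map_add, smul_add, hz, hw]

end Counit

end KQ

/-! ### The functors and the multiplication maps modulo torsion. -/

namespace KQ

variable {k : Type u} [Field k] {r : ℕ}

open JTensor

section Eventually

/-- High degrees of `kQ` are spanned by the `e_i f(w)`, and the submodule absorbs the factor `e_i`.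
-/
theorem eventuallyMem_of_words {N : Type u} [AddCommGroup N] [Module k N] [Module (KQ k r) N]
    [IsScalarTower k (KQ k r) N] {P : Submodule (KQ k r) N} {z : N} (n : ℕ)
    (h : ∀ w : List (Fin 2), n ≤ w.length → fromTrunc k r (TruncAlg.word k r w) • z ∈ P) :
    EventuallyMem (grading k r) P z := by
  refine ⟨n, fun i hi d hd => ?_⟩
  refine grading_induction (P := fun d => d • z ∈ P) (fun i w hw => ?_) ?_ (fun a b ha hb => ?_)
    (fun c a ha => ?_) hd
  · rw [mul_smul]; exact P.smul_mem _ (h w (by omega))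
  · rw [zero_smul]; exact zero_mem _
  · rw [add_smul]; exact add_mem ha hb
  · rw [smul_assoc]; exact P.smul_of_tower_mem c ha

/-- Long words are `y^l x v` with `v` long, and the submodule absorbs `y^l`. -/
theorem eventuallyMem_of_left {M : Type u} [AddCommGroup M] [Module k M] [Module (TruncAlg k r) M]
    [IsScalarTower k (TruncAlg k r) M] {P : Submodule (TruncAlg k r) M} {z : M} (n : ℕ)
    (h : ∀ v : List (Fin 2), n ≤ v.length → TruncAlg.x k r • TruncAlg.word k r v • z ∈ P) :
    EventuallyMem (TruncAlg.grading k r) P z := by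
  refine ⟨n + r + 1, fun i hi b hb => ?_⟩
  refine TruncAlg.grading_induction_left k r (n := n) (P := fun b => b • z ∈ P)
    (by push_cast at hi; exact hi) (fun l v _ hv => ?_) ?_ (fun a b ha hb => ?_)
    (fun c a ha => ?_) (by positivity) hb
  · rw [mul_smul, mul_smul]; exact P.smul_mem _ (h v (by exact_mod_cast hv))
  · rw [zero_smul]; exact zero_mem _
  · rw [add_smul]; exact add_mem ha hb
  · rw [smul_assoc]; exact P.smul_of_tower_mem c ha

/-- Here the factor `y^l` stands next to `z` and is not absorbed, but only the finitely many `l ≤ r`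
occur. -/
theorem eventuallyMem_of_right {N : Type u} [AddCommGroup N] [Module k N] [Module (KQ k r) N]
    [IsScalarTower k (KQ k r) N] {P : Submodule (KQ k r) N} {z : N} (n : ℕ)
    (h : ∀ (l : ℕ) (v : List (Fin 2)), l ≤ r → n ≤ v.length →
      fromTrunc k r (TruncAlg.word k r v) • X k r • Y k r ^ l • z ∈ P) :
    EventuallyMem (grading k r) P z := by
  refine eventuallyMem_of_words (n + r + 1) fun w hw => ?_
  refine TruncAlg.grading_induction_right k r (n := n) (P := fun b => fromTrunc k r b • z ∈ P)
    (by exact_mod_cast hw) (fun l v hl hv => ?_) ?_ (fun a b ha hb => ?_)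
    (fun c a ha => ?_) (by positivity) (TruncAlg.word_mem_grading k r w)
  · rw [map_mul, map_mul, map_pow, fromTrunc_x, fromTrunc_y, mul_smul, mul_smul]
    exact h l v hl (by exact_mod_cast hv)
  · rw [map_zero, zero_smul]; exact zero_mem _
  · rw [map_add, add_smul]; exact add_mem ha hb
  · rw [map_smul, smul_assoc]; exact P.smul_of_tower_mem c ha

end Eventually

theorem fdimIso_iff_trunc {M N : GrMod (TruncAlg.grading k r)} (φ : M ⟶ N) :
    fdimIso _ φ ↔ (∀ m, φ.toLin m = 0 →
        EventuallyMem (TruncAlg.grading k r) (⊥ : Submodule (TruncAlg k r) M.carrier) m) ∧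
      ∀ n, EventuallyMem (TruncAlg.grading k r) (LinearMap.range φ.toLin) n :=
  fdimIso_iff (TruncAlg.isLocallyFinite k r) φ

theorem fdimIso_iff_kq {M N : GrMod (grading k r)} (φ : M ⟶ N) :
    fdimIso _ φ ↔ (∀ m, φ.toLin m = 0 →
        EventuallyMem (grading k r) (⊥ : Submodule (KQ k r) M.carrier) m) ∧
      ∀ n, EventuallyMem (grading k r) (LinearMap.range φ.toLin) n :=
  fdimIso_iff (KQ.isLocallyFinite k r) φ

variable (k r) in
/-- The functor `kQ ⊗_B -`. -/
abbrev dFunctor : GrMod (TruncAlg.grading k r) ⥤ GrMod (grading k r) :=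
  inductionFunctor (fromTrunc k r)

theorem dFunctor_map_tmul {M N : GrMod (TruncAlg.grading k r)} (φ : M ⟶ N) (d : KQ k r)
    (m : M.carrier) : ((dFunctor k r).map φ).toLin (BaseChange.tmul _ d m) =
      BaseChange.tmul _ d (φ.toLin m) := rfl

section DFunctor

variable {M M' : Type u} [AddCommGroup M] [Module k M] [Module (TruncAlg k r) M]
  [AddCommGroup M'] [Module k M'] [Module (TruncAlg k r) M'] (φ : M →ₗ[TruncAlg k r] M')
  (ψ : BaseChange (fromTrunc k r).toAlgHom M →ₗ[KQ k r] BaseChange (fromTrunc k r).toAlgHom M')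
  (hψ : ∀ d m, ψ (BaseChange.tmul _ d m) = BaseChange.tmul _ d (φ m))

include hψ in
theorem eventuallyMem_range_baseChange
    (h : ∀ m, EventuallyMem (TruncAlg.grading k r) (LinearMap.range φ) m)
    (z : BaseChange (fromTrunc k r).toAlgHom M') :
    EventuallyMem (grading k r) (LinearMap.range ψ) z := by
  induction z using BaseChange.induction_on with
  | add z w hz hw => exact hz.add hw
  | tmul d m =>
    obtain ⟨n, hn⟩ := h m
    have h0 : BaseChange.tmul (fromTrunc k r).toAlgHom (0 : KQ k r) m = 0 :=
      LinearMap.map_zero₂ (BaseChange.tmulBilin (fromTrunc k r).toAlgHom _) m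
    have key : ∀ i : ℤ, n ≤ i → ∀ c ∈ grading k r i,
        (BaseChange.tmul (fromTrunc k r).toAlgHom c m) ∈ LinearMap.range ψ := by
      intro i hi c hc
      refine grading_induction (P := fun c =>
          (BaseChange.tmul (fromTrunc k r).toAlgHom c m) ∈ LinearMap.range ψ)
          (fun j w hw => ?_) ?_ (fun a b ha hb => ?_) (fun c a ha => ?_) hc
      -- One has `e_j f(w) ⊗ m = e_j ⊗ w m`, and `w m` lies in the range of `φ` for long `w`.
      · obtain ⟨m', hm'⟩ := hn i hi _ (hw ▸ TruncAlg.word_mem_grading k r w)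
        refine ⟨BaseChange.tmul _ (e k r j) m', ?_⟩
        rw [hψ, hm']
        exact (BaseChange.balance (fromTrunc k r).toAlgHom _ _ _).symm
      · rw [h0]; exact zero_mem _
      · rw [BaseChange.add_tmul]; exact add_mem ha hb
      · rw [BaseChange.smul_tmul_base]; exact Submodule.smul_of_tower_mem _ c ha
    induction d using DirectSum.Decomposition.inductionOn (grading k r) with
    | zero => rw [h0]; exact .of_mem (zero_mem _)
    | add d d' h h' => rw [BaseChange.add_tmul]; exact h.add h'
    | @homogeneous j d =>
      refine ⟨(n - j).toNat, fun i hi a ha => ?_⟩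
      rw [BaseChange.smul_tmul]
      exact key (i + j) (by omega) _ (SetLike.mul_mem_graded ha d.2)

variable [IsScalarTower k (TruncAlg k r) M] [IsScalarTower k (TruncAlg k r) M']

include hψ in
-- No flatness is used. By naturality `retract (Y^l z)` lies in the kernel of `φ`, and `f(v) X Y^l z
-- = 1 ⊗ v x · retract (Y^l z)`, which vanishes for long `v`. One bound serves all `l ≤ r`.
theorem eventuallyMem_ker_baseChange
    (h : ∀ m, φ m = 0 → EventuallyMem (TruncAlg.grading k r) (⊥ : Submodule (TruncAlg k r) M) m)
    (z : BaseChange (fromTrunc k r).toAlgHom M) (hz : ψ z = 0) :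
    EventuallyMem (grading k r)
      (⊥ : Submodule (KQ k r) (BaseChange (fromTrunc k r).toAlgHom M)) z := by
  have hφz : ∀ l ∈ Finset.range (r + 1), EventuallyMem (TruncAlg.grading k r)
      (⊥ : Submodule (TruncAlg k r) M) (retract k r M (Y k r ^ l • z)) := by
    intro l _
    refine h _ ?_
    rw [← retract_map φ ψ hψ, map_smul, hz, smul_zero, map_zero]
  obtain ⟨n, hn⟩ := EventuallyMem.uniform _ hφz
  refine eventuallyMem_of_right n fun l v hl hv => ?_
  have h0 := hn l (Finset.mem_range.2 (by omega)) (v.length + 1) (by omega)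
    _ (SetLike.mul_mem_graded (TruncAlg.word_mem_grading k r v) (TruncAlg.x_mem k r))
  rw [Submodule.mem_bot] at h0 ⊢
  rw [X_smul_eq, fromTrunc_smul_unit, ← mul_smul, h0]
  exact BaseChange.tmul_zero _ _

end DFunctor

theorem fdimIso_dFunctor_map {M N : GrMod (TruncAlg.grading k r)} (φ : M ⟶ N)
    (hφ : fdimIso _ φ) : fdimIso _ ((dFunctor k r).map φ) := by
  rw [fdimIso_iff_trunc] at hφ
  rw [fdimIso_iff_kq]
  exact ⟨eventuallyMem_ker_baseChange φ.toLin _ (dFunctor_map_tmul φ) hφ.1,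
    eventuallyMem_range_baseChange φ.toLin _ (dFunctor_map_tmul φ) hφ.2⟩

section JFunctor

variable {N N' : Type u} [AddCommGroup N] [Module k N] [Module (KQ k r) N]
  [IsScalarTower k (KQ k r) N] [AddCommGroup N'] [Module k N'] [Module (KQ k r) N']
  [IsScalarTower k (KQ k r) N'] (φ : N →ₗ[KQ k r] N')

/-- The product `mul z` lies in the kernel of `φ`, and it determines all `x v z` by `x_smul_smul`.
-/
theorem eventuallyMem_ker_map
    (h : ∀ n, φ n = 0 → EventuallyMem (grading k r) (⊥ : Submodule (KQ k r) N) n)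
    (z : JTensor k r N) (hz : JTensor.map φ z = 0) :
    EventuallyMem (TruncAlg.grading k r) (⊥ : Submodule (TruncAlg k r) (JTensor k r N)) z := by
  obtain ⟨n, hn⟩ := h (mul k r N z) (by rw [← mul_map, hz, map_zero])
  refine eventuallyMem_of_left n fun v hv => ?_
  rw [Submodule.mem_bot, x_smul_smul, (Submodule.mem_bot _).1 (hn v.length (by omega) _
    (fromTrunc_mem (TruncAlg.word_mem_grading k r v))), map_zero, map_zero]

/-- If `f(v) · mul z = φ u`, then `x v z` is the image of `x ⊗ u`. -/
theorem eventuallyMem_range_map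
    (h : ∀ n, EventuallyMem (grading k r) (LinearMap.range φ) n) (z : JTensor k r N') :
    EventuallyMem (TruncAlg.grading k r) (LinearMap.range (JTensor.map φ)) z := by
  obtain ⟨n, hn⟩ := h (mul k r N' z)
  refine eventuallyMem_of_left n fun v hv => ?_
  obtain ⟨u, hu⟩ := hn v.length (by omega) _
    (fromTrunc_mem (TruncAlg.word_mem_grading k r v))
  refine ⟨single k r N 0 (toCorner k r N u), ?_⟩
  rw [x_smul_smul, map_single, cornerMap_toCorner, hu]

end JFunctor

theorem fdimIso_jFunctor_map {M N : GrMod (grading k r)} (φ : M ⟶ N)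
    (hφ : fdimIso _ φ) : fdimIso _ ((jFunctor k r).map φ) := by
  rw [fdimIso_iff_kq] at hφ
  rw [fdimIso_iff_trunc]
  exact ⟨eventuallyMem_ker_map φ.toLin hφ.1, eventuallyMem_range_map φ.toLin hφ.2⟩

section JCounit

variable {M : Type u} [AddCommGroup M] [Module k M] [Module (TruncAlg k r) M]
  [IsScalarTower k (TruncAlg k r) M]

/-- By `mul_eq_unit` the product of `z` in `kQ ⊗_B M` is already zero, so `x v z = 0` for every word
`v`. -/
theorem eventuallyMem_ker_jCounit
    (z : JTensor k r (BaseChange (fromTrunc k r).toAlgHom M)) (hz : jCounit k r M z = 0) :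
    EventuallyMem (TruncAlg.grading k r) (⊥ : Submodule (TruncAlg k r)
      (JTensor k r (BaseChange (fromTrunc k r).toAlgHom M))) z := by
  refine eventuallyMem_of_left 0 fun v _ => ?_
  rw [jCounit_apply] at hz
  have h0 : unit (0 : M) = 0 := BaseChange.tmul_zero (fromTrunc k r).toAlgHom 1
  rw [Submodule.mem_bot, x_smul_smul, mul_eq_unit, hz, h0, smul_zero, map_zero, map_zero]

/-- The element `x v m` is the image of `x ⊗ (1 ⊗ v m)`. -/
theorem eventuallyMem_range_jCounit (m : M) :
    EventuallyMem (TruncAlg.grading k r) (LinearMap.range (jCounit k r M)) m := by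
  refine eventuallyMem_of_left 0 fun v _ => ?_
  refine ⟨single k r _ 0 (toCorner k r _ (unit (TruncAlg.word k r v • m))), ?_⟩
  rw [jCounit_apply, retract_mul_single, Fin.val_zero, pow_zero, one_mul, coe_toCorner,
    retract_idem_smul, retract_unit]

theorem retract_mem {ℳ : ℤ → Submodule k M}
    (hℳ : ∀ {i j : ℤ} {b : TruncAlg k r} {m : M}, b ∈ TruncAlg.grading k r i → m ∈ ℳ j →
      b • m ∈ ℳ (i + j)) {i : ℤ} {z : BaseChange (fromTrunc k r).toAlgHom M}
    (hz : z ∈ BaseChange.grading (fromTrunc k r).toAlgHom (grading k r) ℳ i) :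
    retract k r M z ∈ ℳ i := by
  induction hz using Submodule.span_induction with
  | mem y hy =>
    obtain ⟨a, b, d, m, hd, hm, rfl, rfl⟩ := hy
    exact hℳ (toTrunc_mem hd) hm
  | zero => rw [map_zero]; exact zero_mem _
  | add x y _ _ hx hy => rw [map_add]; exact add_mem hx hy
  | smul c x _ hx => rw [map_smul]; exact Submodule.smul_mem _ c hx

end JCounit

variable (k r) in
/-- The natural map `J ⊗ (kQ ⊗_B M) → M`. -/
def jCounitNat : dFunctor k r ⋙ jFunctor k r ⟶ 𝟭 _ where
  app M := ⟨jCounit k r M.carrier, fun {_ _} hz =>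
    retract_mem (M := M.carrier) M.smul_mem (mul_mem_deg (N := (dFunctor k r).obj M) hz)⟩
  naturality _ N φ := GrMod.Hom.ext (LinearMap.ext fun _ =>
    (congrArg (retract k r N.carrier) (mul_map ((dFunctor k r).map φ).toLin _)).trans
      (retract_map φ.toLin ((dFunctor k r).map φ).toLin (dFunctor_map_tmul φ) _))

theorem fdimIso_jCounitNat (M : GrMod (TruncAlg.grading k r)) :
    fdimIso _ ((jCounitNat k r).app M) :=
  (fdimIso_iff_trunc _).2 ⟨eventuallyMem_ker_jCounit (M := M.carrier),
    eventuallyMem_range_jCounit (M := M.carrier)⟩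

section DCounit

variable {N N' : Type u} [AddCommGroup N] [Module k N] [Module (KQ k r) N]
  [IsScalarTower k (KQ k r) N] [AddCommGroup N'] [Module k N'] [Module (KQ k r) N']
  [IsScalarTower k (KQ k r) N']

/-- The element `X Y^l z` equals `1 ⊗ (x ⊗ n)` with `n` the image of `Y^l z` in `N`, which is zero.
-/
theorem eventuallyMem_ker_dCounit (z : BaseChange (fromTrunc k r).toAlgHom (JTensor k r N))
    (hz : dCounit k r N z = 0) : EventuallyMem (grading k r)
      (⊥ : Submodule (KQ k r) (BaseChange (fromTrunc k r).toAlgHom (JTensor k r N))) z := by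
  refine eventuallyMem_of_right 0 fun l v _ _ => ?_
  have h0 : unit (0 : JTensor k r N) = 0 := BaseChange.tmul_zero (fromTrunc k r).toAlgHom 1
  rw [Submodule.mem_bot, X_smul_eq, x_smul_retract, map_smul, hz, smul_zero, map_zero, map_zero,
    h0, smul_zero]

/-- The element `X f(v) n` is the image of `1 ⊗ (x ⊗ f(v) n)`. -/
theorem eventuallyMem_range_dCounit (n : N) :
    EventuallyMem (grading k r) (LinearMap.range (dCounit k r N)) n := by
  refine eventuallyMem_of_words (r + 1) fun w hw => ?_
  refine TruncAlg.grading_induction_left k r (n := 0)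
    (P := fun b => fromTrunc k r b • n ∈ LinearMap.range (dCounit k r N))
    (by rw [zero_add]; exact_mod_cast hw) (fun l v _ _ => ?_) ?_ (fun a b ha hb => ?_)
    (fun c a ha => ?_) le_rfl (TruncAlg.word_mem_grading k r w)
  · rw [map_mul, map_mul, fromTrunc_x, mul_smul, mul_smul]
    refine Submodule.smul_mem _ _ ⟨unit (single k r N 0 (toCorner k r N
      (fromTrunc k r (TruncAlg.word k r v) • n))), ?_⟩
    rw [dCounit_tmul, mul_single, Fin.val_zero, pow_zero, one_mul, one_smul, X_smul_toCorner]
  · rw [map_zero, zero_smul]; exact zero_mem _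
  · rw [map_add, add_smul]; exact add_mem ha hb
  · rw [map_smul, smul_assoc]; exact Submodule.smul_of_tower_mem _ c ha

theorem dCounit_mem (N : GrMod (grading k r)) {i : ℤ}
    {z : BaseChange (fromTrunc k r).toAlgHom (JTensor k r N.carrier)}
    (hz : z ∈ BaseChange.grading (fromTrunc k r).toAlgHom (grading k r) (jDeg N) i) :
    dCounit k r N.carrier z ∈ N.deg i := by
  induction hz using Submodule.span_induction with
  | mem z hz =>
    obtain ⟨a, b, d, m, hd, hm, rfl, rfl⟩ := hz
    rw [dCounit_tmul]
    exact N.smul_mem hd (mul_mem_deg hm)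
  | zero => rw [map_zero]; exact zero_mem _
  | add x y _ _ hx hy => rw [map_add]; exact add_mem hx hy
  | smul c x _ hx => rw [LinearMap.map_smul_of_tower]; exact Submodule.smul_mem _ c hx

theorem dCounit_map (φ : N →ₗ[KQ k r] N')
    (ψ : BaseChange (fromTrunc k r).toAlgHom (JTensor k r N) →ₗ[KQ k r]
      BaseChange (fromTrunc k r).toAlgHom (JTensor k r N'))
    (hψ : ∀ d z, ψ (BaseChange.tmul _ d z) = BaseChange.tmul _ d (JTensor.map φ z))
    (z : BaseChange (fromTrunc k r).toAlgHom (JTensor k r N)) :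
    dCounit k r N' (ψ z) = φ (dCounit k r N z) := by
  induction z using BaseChange.induction_on with
  | add z w hz hw => simp only [map_add, hz, hw]
  | tmul d z => rw [hψ, dCounit_tmul, dCounit_tmul, mul_map, map_smul]

end DCounit

variable (k r) in
/-- The natural map `kQ ⊗_B (J ⊗ N) → N`. -/
def dCounitNat : jFunctor k r ⋙ dFunctor k r ⟶ 𝟭 _ where
  app N := ⟨dCounit k r N.carrier, fun {_ _} hz => dCounit_mem N hz⟩
  naturality _ _ φ := GrMod.Hom.ext (LinearMap.ext fun z =>
    dCounit_map φ.toLin ((dFunctor k r).map ((jFunctor k r).map φ)).toLin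
      (dFunctor_map_tmul ((jFunctor k r).map φ)) z)

theorem fdimIso_dCounitNat (N : GrMod (grading k r)) : fdimIso _ ((dCounitNat k r).app N) :=
  (fdimIso_iff_kq _).2 ⟨eventuallyMem_ker_dCounit (N := N.carrier),
    eventuallyMem_range_dCounit (N := N.carrier)⟩

/-! ### Finitely presented modules -/

variable (k r) in
/-- The functor `kQ ⊗_B -` on finitely presented modules. -/
def dFunctorFp : FpGrMod (TruncAlg.grading k r) ⥤ FpGrMod (grading k r) :=
  ObjectProperty.lift _ (ObjectProperty.ι _ ⋙ dFunctor k r)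
    fun M => BaseChange.finitePresentation (M := M.obj.carrier) _ M.property

variable (k r) in
/-- The functor `J ⊗ -` on finitely presented modules. -/
def jFunctorFp : FpGrMod (grading k r) ⥤ FpGrMod (TruncAlg.grading k r) :=
  ObjectProperty.lift _ (ObjectProperty.ι _ ⋙ jFunctor k r)
    fun N => JTensor.finitePresentation (N := N.obj.carrier) N.property

theorem finDimIso_iff_trunc {M N : FpGrMod (TruncAlg.grading k r)} (φ : M ⟶ N) :
    finDimIso _ φ ↔ fdimIso _ φ.hom :=
  finDimIso_iff (TruncAlg.isLocallyFinite k r) (TruncAlg.hasStrip k r) φ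

theorem finDimIso_iff_kq {M N : FpGrMod (grading k r)} (φ : M ⟶ N) :
    finDimIso _ φ ↔ fdimIso _ φ.hom :=
  finDimIso_iff (KQ.isLocallyFinite k r) (KQ.hasStrip k r) φ

variable (k r) in
/-- The natural map `J ⊗ (kQ ⊗_B M) → M` for finitely presented `M`. -/
def jCounitNatFp : dFunctorFp k r ⋙ jFunctorFp k r ⟶ 𝟭 _ where
  app M := ObjectProperty.homMk ((jCounitNat k r).app M.obj)
  naturality _ _ φ := ObjectProperty.hom_ext _ ((jCounitNat k r).naturality φ.hom)

variable (k r) in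
/-- The natural map `kQ ⊗_B (J ⊗ N) → N` for finitely presented `N`. -/
def dCounitNatFp : jFunctorFp k r ⋙ dFunctorFp k r ⟶ 𝟭 _ where
  app N := ObjectProperty.homMk ((dCounitNat k r).app N.obj)
  naturality _ _ φ := ObjectProperty.hom_ext _ ((dCounitNat k r).naturality φ.hom)

end KQ

/-! ### Equivalences between localizations. -/

namespace CategoryTheory.MorphismProperty

variable {C₁ C₂ E : Type*} [Category* C₁] [Category* C₂] [Category* E]
  {W₁ : MorphismProperty C₁} {W₂ : MorphismProperty C₂}

/-- Functors on a localization are isomorphic if their restrictions are. -/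
def isoOfCompQ {F₁ F₂ : W₁.Localization ⥤ E} (e : W₁.Q ⋙ F₁ ≅ W₁.Q ⋙ F₂) : F₁ ≅ F₂ :=
  Localization.liftNatIso W₁.Q W₁ (W₁.Q ⋙ F₁) (W₁.Q ⋙ F₂) F₁ F₂ e

/-- The functor between localizations induced by a functor. -/
def localizationMap (F : C₁ ⥤ C₂) (hF : W₁ ≤ W₂.inverseImage F) :
    W₁.Localization ⥤ W₂.Localization :=
  Localization.Construction.lift (F ⋙ W₂.Q) fun _ _ φ hφ => W₂.Q_inverts _ (hF φ hφ)

theorem Q_comp_localizationMap (F : C₁ ⥤ C₂) (hF : W₁ ≤ W₂.inverseImage F) :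
    W₁.Q ⋙ localizationMap F hF = F ⋙ W₂.Q :=
  Localization.Construction.fac _ _

theorem isIso_whiskerRight_Q {F : C₁ ⥤ C₁} (α : F ⟶ 𝟭 C₁) (hα : ∀ X, W₁ (α.app X)) :
    IsIso (Functor.whiskerRight α W₁.Q) := by
  have : ∀ X, IsIso ((Functor.whiskerRight α W₁.Q).app X) := fun X => W₁.Q_inverts _ (hα X)
  exact NatIso.isIso_of_isIso_app _

/-- The restriction to `C₁` of the composition of two functors between localizations is the
quotient functor if the composition maps naturally to the identity by morphisms in `W₁`. -/
def compLocalizationMapIso (F : C₁ ⥤ C₂) (hF : W₁ ≤ W₂.inverseImage F) (G : C₂ ⥤ C₁)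
    (hG : W₂ ≤ W₁.inverseImage G) (α : F ⋙ G ⟶ 𝟭 C₁) (hα : ∀ X, W₁ (α.app X)) :
    W₁.Q ⋙ localizationMap F hF ⋙ localizationMap G hG ≅ W₁.Q ⋙ 𝟭 _ :=
  have := isIso_whiskerRight_Q α hα
  Functor.isoWhiskerRight (eqToIso (Q_comp_localizationMap F hF)) (localizationMap G hG) ≪≫
    Functor.isoWhiskerLeft F (eqToIso (Q_comp_localizationMap G hG)) ≪≫
    asIso (Functor.whiskerRight α W₁.Q)

/-- Functors that preserve the given classes of morphisms, and are mutually inverse up to these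
classes, induce an equivalence of localizations. -/
def localizationEquivalence (F : C₁ ⥤ C₂) (hF : W₁ ≤ W₂.inverseImage F) (G : C₂ ⥤ C₁)
    (hG : W₂ ≤ W₁.inverseImage G) (α : F ⋙ G ⟶ 𝟭 C₁) (hα : ∀ X, W₁ (α.app X))
    (β : G ⋙ F ⟶ 𝟭 C₂) (hβ : ∀ X, W₂ (β.app X)) : W₁.Localization ≌ W₂.Localization :=
  Equivalence.mk (localizationMap F hF) (localizationMap G hG)
    (isoOfCompQ (compLocalizationMapIso F hF G hG α hα)).symm
    (isoOfCompQ (compLocalizationMapIso G hG F hF β hβ))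

end CategoryTheory.MorphismProperty

open CategoryTheory.MorphismProperty

/-! ### The equivalences, the twists and the structure sheaf. -/

namespace KQ

variable (k : Type u) [Field k] (r : ℕ)

theorem fdimIso_le_dFunctor :
    fdimIso (TruncAlg.grading k r) ≤ (fdimIso (grading k r)).inverseImage (dFunctor k r) :=
  fun _ _ φ hφ => fdimIso_dFunctor_map φ hφ

theorem finDimIso_le_dFunctorFp :
    finDimIso (TruncAlg.grading k r) ≤ (finDimIso (grading k r)).inverseImage (dFunctorFp k r) :=
  fun _ _ φ hφ => (finDimIso_iff_kq _).2 (fdimIso_dFunctor_map φ.hom ((finDimIso_iff_trunc φ).1 hφ))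

/-- The equivalence `QGr B ≌ QGr kQ` induced by `kQ ⊗_B -`. -/
def qgrBigEquivalence : QGr (TruncAlg.grading k r) ≌ QGr (grading k r) :=
  localizationEquivalence (dFunctor k r) (fdimIso_le_dFunctor k r) (jFunctor k r)
    (fun _ _ φ hφ => fdimIso_jFunctor_map φ hφ) (jCounitNat k r) fdimIso_jCounitNat
    (dCounitNat k r) fdimIso_dCounitNat

/-- The equivalence `qgr B ≌ qgr kQ` induced by `kQ ⊗_B -`. -/
def qgrEquivalence : Qgr (TruncAlg.grading k r) ≌ Qgr (grading k r) :=
  localizationEquivalence (dFunctorFp k r) (finDimIso_le_dFunctorFp k r) (jFunctorFp k r)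
    (fun _ _ φ hφ => (finDimIso_iff_trunc _).2
      (fdimIso_jFunctor_map φ.hom ((finDimIso_iff_kq φ).1 hφ)))
    (jCounitNatFp k r) (fun M => (finDimIso_iff_trunc _).2 (fdimIso_jCounitNat M.obj))
    (dCounitNatFp k r) (fun N => (finDimIso_iff_kq _).2 (fdimIso_dCounitNat N.obj))

theorem toQGr_comp_qgrBigEquivalence :
    toQGr (TruncAlg.grading k r) ⋙ (qgrBigEquivalence k r).functor =
      dFunctor k r ⋙ toQGr (grading k r) :=
  Q_comp_localizationMap _ (fdimIso_le_dFunctor k r)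

theorem Q_comp_qgrEquivalence :
    (finDimIso (TruncAlg.grading k r)).Q ⋙ (qgrEquivalence k r).functor =
      dFunctorFp k r ⋙ (finDimIso (grading k r)).Q :=
  Q_comp_localizationMap _ (finDimIso_le_dFunctorFp k r)

/-- The two equivalences are compatible with `qgr ⥤ QGr`. -/
def qgrEquivalenceCompIso : (qgrEquivalence k r).functor ⋙ qgrToQGr (grading k r) ≅
    qgrToQGr (TruncAlg.grading k r) ⋙ (qgrBigEquivalence k r).functor :=
  isoOfCompQ (eqToIso (by
    have h1 : (finDimIso (grading k r)).Q ⋙ qgrToQGr (grading k r) =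
      ObjectProperty.ι _ ⋙ toQGr (grading k r) := Localization.Construction.fac _ _
    have h2 : (finDimIso (TruncAlg.grading k r)).Q ⋙ qgrToQGr (TruncAlg.grading k r) =
      ObjectProperty.ι _ ⋙ toQGr (TruncAlg.grading k r) := Localization.Construction.fac _ _
    rw [← Functor.assoc, Q_comp_qgrEquivalence, Functor.assoc, h1, ← Functor.assoc _ _
      (qgrBigEquivalence k r).functor, h2, Functor.assoc, toQGr_comp_qgrBigEquivalence]
    rfl))

/-- Shifting `M` shifts the total degree by the same amount, so the identity map serves as the
isomorphism in `shiftDFunctorIso`. -/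
theorem grading_shift (M : GrMod (TruncAlg.grading k r)) (n i : ℤ) :
    BaseChange.grading (fromTrunc k r).toAlgHom (grading k r) (fun i => M.deg (n + i)) i =
      BaseChange.grading (fromTrunc k r).toAlgHom (grading k r) M.deg (n + i) := by
  refine congrArg (Submodule.span k) (Set.ext fun z => ⟨?_, ?_⟩)
  · rintro ⟨a, b, d, m, hd, hm, h, rfl⟩
    exact ⟨a, n + b, d, m, hd, hm, by omega, rfl⟩
  · rintro ⟨a, b, d, m, hd, hm, h, rfl⟩
    exact ⟨a, b - n, d, m, hd, by change m ∈ M.deg (n + (b - n)); rwa [add_sub_cancel], by omega, rfl⟩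

/-- The functor `kQ ⊗_B -` commutes with the degree shift. -/
def shiftDFunctorIso (n : ℤ) : GrMod.shift (TruncAlg.grading k r) n ⋙ dFunctor k r ≅
    dFunctor k r ⋙ GrMod.shift (grading k r) n :=
  NatIso.ofComponents (fun M =>
    { hom := ⟨LinearMap.id (M := BaseChange (fromTrunc k r).toAlgHom M.carrier),
        fun {i _} h => (grading_shift k r M n i).le h⟩
      inv := ⟨LinearMap.id (M := BaseChange (fromTrunc k r).toAlgHom M.carrier),
        fun {i _} h => (grading_shift k r M n i).ge h⟩
      hom_inv_id := rfl
      inv_hom_id := rfl }) fun _ => rfl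

/-- The equivalence commutes with the Serre twists. -/
def serreTwistIso (n : ℤ) :
    serreTwist (TruncAlg.grading k r) n ⋙ (qgrBigEquivalence k r).functor ≅
      (qgrBigEquivalence k r).functor ⋙ serreTwist (grading k r) n :=
  isoOfCompQ (by
    have h1 : (fdimIso (grading k r)).Q ⋙ serreTwist (grading k r) n =
      GrMod.shift (grading k r) n ⋙ toQGr (grading k r) := Localization.Construction.fac _ _
    have h2 : (fdimIso (TruncAlg.grading k r)).Q ⋙ serreTwist (TruncAlg.grading k r) n =
      GrMod.shift (TruncAlg.grading k r) n ⋙ toQGr (TruncAlg.grading k r) :=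
        Localization.Construction.fac _ _
    exact eqToIso (by
        rw [← Functor.assoc, h2, Functor.assoc, toQGr_comp_qgrBigEquivalence, Functor.assoc]) ≪≫
      Functor.isoWhiskerRight (shiftDFunctorIso k r n) (toQGr (grading k r)) ≪≫
      eqToIso (by
        rw [← Functor.assoc, toQGr_comp_qgrBigEquivalence, Functor.assoc, Functor.assoc, h1]))

section Self

/-- The map `kQ ⊗_B B → kQ`. -/
def selfHom : BaseChange (fromTrunc k r).toAlgHom (TruncAlg k r) →ₗ[KQ k r] KQ k r :=
  BaseChange.lift (fromTrunc k r).toAlgHom (fromTrunc k r).toAlgHom.toLinearMap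
    fun b c => map_mul (fromTrunc k r) b c

theorem selfHom_tmul (d : KQ k r) (b : TruncAlg k r) :
    selfHom k r (BaseChange.tmul _ d b) = d * fromTrunc k r b :=
  BaseChange.lift_tmul _ _ _ d b

theorem selfHom_mem {i : ℤ} {z : BaseChange (fromTrunc k r).toAlgHom (TruncAlg k r)}
    (hz : z ∈ BaseChange.grading (fromTrunc k r).toAlgHom (grading k r) (TruncAlg.grading k r) i) :
    selfHom k r z ∈ grading k r i := by
  induction hz using Submodule.span_induction with
  | mem z hz =>
    obtain ⟨a, b, d, m, hd, hm, rfl, rfl⟩ := hz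
    rw [selfHom_tmul]
    exact SetLike.mul_mem_graded hd (fromTrunc_mem hm)
  | zero => rw [map_zero]; exact zero_mem _
  | add x y _ _ hx hy => rw [map_add]; exact add_mem hx hy
  | smul c x _ hx => rw [LinearMap.map_smul_of_tower]; exact Submodule.smul_mem _ c hx

/-- The map `kQ → kQ ⊗_B B`. -/
def selfInv : KQ k r →ₗ[KQ k r] BaseChange (fromTrunc k r).toAlgHom (TruncAlg k r) :=
  LinearMap.toSpanSingleton _ _ (unit 1)

theorem selfInv_apply (d : KQ k r) : selfInv k r d = BaseChange.tmul _ d 1 :=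
  (BaseChange.tmul_eq_smul _ d 1).symm

theorem selfInv_mem {i : ℤ} {d : KQ k r} (hd : d ∈ grading k r i) :
    selfInv k r d ∈
      BaseChange.grading (fromTrunc k r).toAlgHom (grading k r) (TruncAlg.grading k r) i := by
  rw [selfInv_apply]
  exact Submodule.subset_span ⟨i, 0, d, 1, hd, SetLike.GradedOne.one_mem, add_zero i, rfl⟩

theorem selfInv_selfHom (z : BaseChange (fromTrunc k r).toAlgHom (TruncAlg k r)) :
    selfInv k r (selfHom k r z) = z := by
  induction z using BaseChange.induction_on with
  | tmul d b =>
    rw [selfHom_tmul, selfInv_apply]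
    refine (BaseChange.balance (fromTrunc k r).toAlgHom d b 1).trans ?_
    rw [smul_eq_mul, mul_one]
  | add z w hz hw => rw [map_add, map_add, hz, hw]

theorem selfHom_selfInv (d : KQ k r) : selfHom k r (selfInv k r d) = d := by
  rw [selfInv_apply, selfHom_tmul, map_one, mul_one]

/-- The isomorphism `kQ ⊗_B B ≅ kQ`. -/
def dFunctorSelfIso : (dFunctor k r).obj (GrMod.self (TruncAlg.grading k r)) ≅
    GrMod.self (grading k r) where
  hom := ⟨selfHom k r, fun hz => selfHom_mem k r hz⟩
  inv := ⟨selfInv k r, fun hd => selfInv_mem k r hd⟩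
  hom_inv_id := GrMod.Hom.ext (LinearMap.ext (selfInv_selfHom k r))
  inv_hom_id := GrMod.Hom.ext (LinearMap.ext (selfHom_selfInv k r))

end Self

end KQ

end

theorem mainTheorem8 {k : Type u} [Field k] (r : ℕ) (hr : 1 ≤ r) :
    ∃ f : TruncAlg.grading k r →ₐᵍ[k] KQ.grading k r,
      f (TruncAlg.x k r) = ∑ i : Fin (r + 1), KQ.xArrow k r i ∧
      f (TruncAlg.y k r) = ∑ i : Fin r, KQ.yArrow k r i ∧
      Function.Injective f ∧
      ∃ F : QGr (TruncAlg.grading k r) ≌ QGr (KQ.grading k r),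
        Nonempty (toQGr (TruncAlg.grading k r) ⋙ F.functor ≅
          inductionFunctor f ⋙ toQGr (KQ.grading k r)) ∧
        (∃ F' : Qgr (TruncAlg.grading k r) ≌ Qgr (KQ.grading k r),
          Nonempty (F'.functor ⋙ qgrToQGr (KQ.grading k r) ≅
            qgrToQGr (TruncAlg.grading k r) ⋙ F.functor)) ∧
        (∀ n : ℤ, Nonempty (serreTwist (TruncAlg.grading k r) n ⋙ F.functor ≅
          F.functor ⋙ serreTwist (KQ.grading k r) n)) ∧
        Nonempty (F.functor.obj (structureSheaf (TruncAlg.grading k r)) ≅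
          structureSheaf (KQ.grading k r)) :=
  ⟨KQ.fromTrunc k r, KQ.fromTrunc_x, KQ.fromTrunc_y, KQ.fromTrunc_injective,
    KQ.qgrBigEquivalence k r, ⟨eqToIso (KQ.toQGr_comp_qgrBigEquivalence k r)⟩,
    ⟨KQ.qgrEquivalence k r, ⟨KQ.qgrEquivalenceCompIso k r⟩⟩,
    fun n => ⟨KQ.serreTwistIso k r n⟩,
    ⟨(eqToIso (KQ.toQGr_comp_qgrBigEquivalence k r)).app _ ≪≫
      (toQGr (KQ.grading k r)).mapIso (KQ.dFunctorSelfIso k r)⟩⟩
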